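/- Let $\mathfrak g$ be a real Lie algebra of dimension nine. Assume that $\mathfrak g$ is indecomposable (it is not the direct sum of two nonzero ideals) and that it has a nontrivial Levi decomposition, that is, $\mathfrak g=\mathfrak s\oplus\mathfrak r$ as a vector space, where $\mathfrak r\neq 0$ is the radical of $\mathfrak g$ and $\mathfrak s\neq 0$ is a semisimple subalgebra. Let $X_1,\dots,X_9$ be a basis of $\mathfrak g$, with $[X_i,X_j]=\sum_k C_{ij}^kX_k$, and let $x_1,\dots,x_9$ be the corresponding linear coordinates on $\mathfrak g^*$. An invariant of $\mathfrak g$ on an open set $U\subseteq\mathfrak g^*$ is a real-analytic function $F:U\to\mathbb R$ with $$\sum_{j,k}C_{ij}^k\,x_k\,\frac{\partial F}{\partial x_j}=0\quad\text{on } U,\qquad 1\le i\le 9 .$$ Invariants $F_1,\dots,F_k$ on $U$ are functionally independent if $dF_1,\dots,dF_k$ are linearly independent at the points of a dense subset of $U$. Let $\mathcal N(\mathfrak g)$ be the largest $k$ for which there are $k$ functionally independent invariants of $\mathfrak g$ on some nonempty open set $U\subseteq\mathfrak g^*$ (this number does not depend on the basis). Then $\mathcal N(\mathfrak g)=1$ or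 $\mathcal N(\mathfrak g)=3$. -/

import Mathlib

/-- A Lie algebra over `ℝ` is indecomposable if it is not the direct sum of two nonzero ideals.
(Complementary ideals `I`, `J` automatically commute, since `⁅I, J⁆ ≤ I ⊓ J = ⊥`.) -/
def IsIndecomposableLie (𝔤 : Type*) [LieRing 𝔤] [LieAlgebra ℝ 𝔤] : Prop :=
  Nontrivial 𝔤 ∧ ∀ I J : LieIdeal ℝ 𝔤, IsCompl I J → I = ⊥ ∨ J = ⊥

/-- `𝔤` admits a nontrivial Levi decomposition: `𝔤 = 𝔰 ⊕ 𝔯` as a vector space, where `𝔰` is a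
nonzero semisimple subalgebra and `𝔯` is the radical of `𝔤` (the largest solvable ideal), which is
nonzero as well. If `𝔤` is moreover indecomposable, then `⁅𝔰, 𝔯⁆ ≠ 0`, because otherwise `𝔰` and
`𝔯` would be complementary nonzero ideals. -/
def HasNontrivialLeviDecomposition (𝔤 : Type*) [LieRing 𝔤] [LieAlgebra ℝ 𝔤] : Prop :=
  ∃ 𝔰 : LieSubalgebra ℝ 𝔤,
    LieAlgebra.IsSemisimple ℝ 𝔰 ∧
    IsCompl 𝔰.toSubmodule (LieAlgebra.radical ℝ 𝔤).toSubmodule ∧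
    𝔰 ≠ ⊥ ∧ LieAlgebra.radical ℝ 𝔤 ≠ ⊥

section Invariants

variable {𝔤 : Type*} [LieRing 𝔤] [LieAlgebra ℝ 𝔤] {n : ℕ}

/-- The structure constants `C_{ij}^k` of `𝔤` over the basis `X_1, …, X_n`:
`⁅X_i, X_j⁆ = ∑ k, C_{ij}^k X_k`. -/
noncomputable def structureConst (X : Module.Basis (Fin n) ℝ 𝔤) (i j k : Fin n) : ℝ :=
  X.repr ⁅X i, X j⁆ k

/-- The differential operator `∑ j k, C_{ij}^k x_k ∂/∂x_j` attached to `X_i`, acting on functions on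
`𝔤^*`. A point of `𝔤^*` is given by its coordinates `x_k = f (X_k)`, so that `𝔤^* = ℝⁿ`. -/
noncomputable def coadjointOp (X : Module.Basis (Fin n) ℝ 𝔤) (i : Fin n)
    (F : (Fin n → ℝ) → ℝ) (x : Fin n → ℝ) : ℝ :=
  ∑ j, ∑ k, structureConst X i j k * x k * fderiv ℝ F x (Pi.single j 1)

/-- `F` is an invariant of the coadjoint representation on the open set `U` of `𝔤^*`: a real
analytic solution on `U` of the system of linear first-order equations attached to all the `X_i`. -/
def IsInvariantOn (X : Module.Basis (Fin n) ℝ 𝔤) (U : Set (Fin n → ℝ))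
    (F : (Fin n → ℝ) → ℝ) : Prop :=
  AnalyticOnNhd ℝ F U ∧ ∀ x ∈ U, ∀ i, coadjointOp X i F x = 0

/-- `F_1, …, F_k` are functionally independent on `U`: their differentials are linearly independent
on a dense set of points of `U` (generic Jacobian rank `k`). -/
def FunctionallyIndependentOn {k : ℕ} (U : Set (Fin n → ℝ))
    (F : Fin k → (Fin n → ℝ) → ℝ) : Prop :=
  U ⊆ closure {x | x ∈ U ∧ LinearIndependent ℝ fun a => fderiv ℝ (F a) x}

end Invariants

/-- `𝒩(𝔤) = N`: over every basis of `𝔤`, the largest number of functionally independent invariants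
of `𝔤` on a nonempty open set of `𝔤^*` is `N`. -/
def HasInvariantNumber (𝔤 : Type*) [LieRing 𝔤] [LieAlgebra ℝ 𝔤] [FiniteDimensional ℝ 𝔤]
    (N : ℕ) : Prop :=
  ∀ X : Module.Basis (Fin (Module.finrank ℝ 𝔤)) ℝ 𝔤,
    IsGreatest {k : ℕ | ∃ (U : Set (Fin (Module.finrank ℝ 𝔤) → ℝ))
      (F : Fin k → (Fin (Module.finrank ℝ 𝔤) → ℝ) → ℝ),
      IsOpen U ∧ U.Nonempty ∧ (∀ a, IsInvariantOn X U (F a)) ∧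
      FunctionallyIndependentOn U F} N

/-! The invariants are the first integrals of the vector fields that generate the coadjoint orbits.
At a point of maximal orbit dimension the orbits are locally the common level sets of analytic
functions with independent differentials, so $\mathcal N(\mathfrak g)=\dim\mathfrak g-\rho$, where
$\rho$ is the maximal rank of the alternating forms $(x,y)\mapsto F([x,y])$
(`hasInvariantNumber_of_finrank_range_orbitForm`). An alternating form has even rank, so in
dimension nine it is enough to show $\rho\ge 6$.

Suppose instead that $\rho<6$, that is, all $6\times 6$ Gram determinants of these forms vanish.
This polynomial condition passes to the complexification. If the Levi factor $S$ had an orbit of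
dimension three in $R^*$, where $R$ is the radical, three elements of $S$ and three elements of $R$
dual to the orbit directions would have a nonzero Gram determinant. Hence all $S$-orbits in $R^*$
have dimension at most two. By indecomposability $S$ acts faithfully on $R$. Highest weight theory
then shows that $S$ is spanned by an $\mathfrak{sl}_2$ triple and that $R$ is a trivial module plus
one simple module $W=[S,R]$ of dimension two or three (`exists_isSl2Triple_generates`).

Further Gram determinants, with solvability of $R$, show that $R^S$ commutes with $W$, that
$[W,W]\subseteq R^S$, and that $R^S$ is abelian or $[W,W]=0$ (`IsNearlySplit`). These statements
descend to $\mathbb R$. If $C$ is a suitable complement of $[W,W]$ in $R^S$, then $S+W+[W,W]$ and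
$C$ are complementary ideals. As $\dim R\ge 6$ and $\dim(W+[W,W])\le 3$, both are nonzero, against
indecomposability (`IsIndecomposableLie.not_isNearlySplit`). -/

set_option linter.unusedSectionVars false

/-! ### Modules over an `sl₂` triple: weights allowed by orbits of dimension at most two -/

section Sl2Modules

open LieModule Module

variable {K L M : Type*} [Field K] [CharZero K] [LieRing L] [LieAlgebra K L]
  [AddCommGroup M] [Module K M] [LieRingModule L M] [LieModule K L M] [FiniteDimensional K M]

/-- All orbits `⁅L, m⁆` of the Lie module `M` have dimension at most two. -/
def HasOrbitsOfRankLETwo (K L M : Type*) [Field K] [LieRing L] [AddCommGroup M] [Module K M]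
    [LieRingModule L M] : Prop :=
  ∀ (m : M) (x y z : L), ¬ LinearIndependent K ![⁅x, m⁆, ⁅y, m⁆, ⁅z, m⁆]

lemma HasOrbitsOfRankLETwo.exists_relation (H : HasOrbitsOfRankLETwo K L M) (m : M) (x y z : L)
    (h : ∀ a b c : K, a • ⁅x, m⁆ + b • ⁅y, m⁆ + c • ⁅z, m⁆ = 0 → a = 0 ∧ b = 0 ∧ c = 0) :
    False := by
  refine H m x y z ?_
  rw [Fintype.linearIndependent_iff]
  intro g hg
  simp only [Fin.sum_univ_three, Matrix.cons_val_zero, Matrix.cons_val_one, Matrix.cons_val] at hg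
  obtain ⟨h0, h1, h2⟩ := h _ _ _ hg
  intro i
  fin_cases i <;> assumption

namespace IsSl2Triple

variable {h e f : L}

lemma lie_h_toEnd_e_pow (t : IsSl2Triple h e f) (n : ℕ) :
    toEnd K L M h * toEnd K L M e ^ n =
      toEnd K L M e ^ n * toEnd K L M h + (2 * n : K) • toEnd K L M e ^ n := by
  have h1 : toEnd K L M h * toEnd K L M e = toEnd K L M e * toEnd K L M h
      + (2 : K) • toEnd K L M e := by
    ext m
    simp [leibniz_lie h e m, t.lie_h_e_smul K, add_comm]
  induction n with
  | zero => simp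
  | succ n ih =>
    rw [pow_succ, ← mul_assoc, ih, add_mul, mul_assoc, h1, mul_add, ← mul_assoc]
    simp only [mul_smul_comm, smul_mul_assoc, Nat.cast_add, Nat.cast_one]
    module

/-- The powers of `e` are eigenvectors of commutation with `h`, with the distinct eigenvalues `2 *
n`. If none vanished they would be infinitely many independent elements of a finite-dimensional
space. -/
lemma isNilpotent_toEnd_e (t : IsSl2Triple h e f) : ∃ n, toEnd K L M e ^ n = 0 := by
  by_contra! contra
  let D : End K (End K M) := LinearMap.mulLeft K (toEnd K L M h) - LinearMap.mulRight K (toEnd K L M h)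
  have hs : (Set.range fun n : ℕ ↦ (2 * n : K)).Infinite := by
    rw [Set.infinite_range_iff (fun n m ↦ by simp)]; infer_instance
  exact hs (D.eigenvectors_linearIndependent {x | ∃ n : ℕ, 2 * n = x}
    (fun ⟨s, hs⟩ ↦ toEnd K L M e ^ Classical.choose hs)
    (fun ⟨r, hr⟩ ↦ by
      simp [D, Module.End.hasEigenvector_iff, contra, t.lie_h_toEnd_e_pow,
        Classical.choose_spec hr])).finite

lemma toEnd_e_pow_succ_mul_toEnd_f (t : IsSl2Triple h e f) (n : ℕ) :
    toEnd K L M e ^ (n + 1) * toEnd K L M f = toEnd K L M f * toEnd K L M e ^ (n + 1) +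
      ((n + 1 : K)) • ((toEnd K L M h - (n : K) • 1) * toEnd K L M e ^ n) := by
  have h1 : toEnd K L M e * toEnd K L M f = toEnd K L M f * toEnd K L M e + toEnd K L M h := by
    ext m
    simp [leibniz_lie e f m, t.lie_e_f, add_comm]
  induction n with
  | zero => simp [h1]
  | succ n ih =>
    have h2 := t.lie_h_toEnd_e_pow (K := K) (M := M) 1
    simp only [pow_one, Nat.cast_one, mul_one] at h2
    have h3 : toEnd K L M e * toEnd K L M h = toEnd K L M h * toEnd K L M e
      - (2 : K) • toEnd K L M e := by rw [h2]; abel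
    rw [pow_succ', mul_assoc, ih, mul_add, ← mul_assoc, h1, add_mul, mul_assoc _ (toEnd K L M e),
      ← pow_succ', mul_smul_comm, ← mul_assoc, mul_sub, h3, mul_smul_comm, mul_one]
    simp only [sub_mul, smul_mul_assoc, mul_assoc, one_mul, ← pow_succ', Nat.cast_add,
      Nat.cast_one]
    module

/-- If `e ^ (n + 1) = 0` then the image of `e ^ n` consists of primitive vectors of weight `n`. -/
lemma hasPrimitiveVectorWith_of_pow_succ_eq_zero (t : IsSl2Triple h e f) {n : ℕ}
    (hn : toEnd K L M e ^ (n + 1) = 0) {u : M} (hu : (toEnd K L M e ^ n) u ≠ 0) :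
    HasPrimitiveVectorWith t ((toEnd K L M e ^ n) u) (n : K) where
  ne_zero := hu
  lie_h := by
    -- Both terms of the commutator formula that contain `e ^ (n + 1)` vanish, which leaves `(n + 1)
    -- (h - n) e ^ n = 0`.
    have h1 := LinearMap.congr_fun (t.toEnd_e_pow_succ_mul_toEnd_f (K := K) (M := M) n) u
    have h2 : (n + 1 : K) ≠ 0 := by exact_mod_cast n.succ_ne_zero
    simp only [hn, zero_mul, mul_zero, zero_add, LinearMap.zero_apply, LinearMap.smul_apply] at h1
    have h3 := (smul_eq_zero_iff_right h2).1 h1.symm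
    simpa [sub_mul, sub_eq_zero] using h3
  lie_e := by
    have h1 := LinearMap.congr_fun hn u
    rwa [pow_succ'] at h1

namespace HasPrimitiveVectorWith

variable {t : IsSl2Triple h e f} {v v' w : M} {n : ℕ}

lemma lie_e_lie_f {μ : K} (P : HasPrimitiveVectorWith t v μ) : ⁅e, ⁅f, v⁆⁆ = μ • v := by
  simpa using P.lie_e_pow_succ_toEnd_f 0

lemma lie_h_lie_f {μ : K} (P : HasPrimitiveVectorWith t v μ) : ⁅h, ⁅f, v⁆⁆ = (μ - 2) • ⁅f, v⁆ := by
  simpa using P.lie_h_pow_toEnd_f 1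

lemma lie_e_lie_f_lie_f {μ : K} (P : HasPrimitiveVectorWith t v μ) :
    ⁅e, ⁅f, ⁅f, v⁆⁆⁆ = (2 * (μ - 1)) • ⁅f, v⁆ := by
  have := P.lie_e_pow_succ_toEnd_f 1
  norm_num [pow_succ] at this
  exact this

lemma lie_h_lie_f_lie_f {μ : K} (P : HasPrimitiveVectorWith t v μ) :
    ⁅h, ⁅f, ⁅f, v⁆⁆⁆ = (μ - 4) • ⁅f, ⁅f, v⁆⁆ := by
  have := P.lie_h_pow_toEnd_f 2
  norm_num [pow_succ] at this
  exact this

/-- The test point is the highest weight vector plus the lowest one, `v + f ^ n v`. Its images under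
`e`, `h`, `f` are nonzero multiples of `f ^ (n - 1) v`, `v - f ^ n v` and `f v`. For `n ≥ 3` the
four weights involved are distinct, so the three images are independent. -/
lemma weight_lt_three (H : HasOrbitsOfRankLETwo K L M) (P : HasPrimitiveVectorWith t v (n : K)) :
    n < 3 := by
  by_contra! hn
  obtain ⟨n, rfl⟩ : ∃ j, n = j + 3 := ⟨n - 3, by omega⟩
  set F : ℕ → M := fun i ↦ (toEnd K L M f ^ i) v with hF
  have hne : ∀ i, i ≤ n + 3 → F i ≠ 0 := fun i hi ↦ P.pow_toEnd_f_ne_zero_of_eq_nat rfl hi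
  have hh : ∀ i, ⁅h, F i⁆ = ((n + 3 : ℕ) - 2 * i : K) • F i := fun i ↦ P.lie_h_pow_toEnd_f i
  -- The weight is now `n + 3`. The indices `1` and `n + 2` differ because the original weight is at
  -- least three; for weight two they would coincide.
  let idx : Fin 4 → ℕ := ![0, 1, n + 2, n + 3]
  have hidx : Function.Injective idx := by
    intro i j hij
    fin_cases i <;> fin_cases j <;> simp [idx] at hij ⊢
  have hLI : LinearIndependent K fun i : Fin 4 ↦ F (idx i) := by
    refine Module.End.eigenvectors_linearIndependent' (toEnd K L M h)
      (fun i ↦ ((n + 3 : ℕ) - 2 * (idx i : ℕ) : K)) ?_ _ ?_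
    · intro i j hij
      apply hidx
      simpa using hij
    · intro i
      rw [Module.End.hasEigenvector_iff, Module.End.mem_eigenspace_iff]
      refine ⟨hh _, hne _ ?_⟩
      fin_cases i <;> simp [idx]
  have h0 : F 0 = v := by simp [F]
  have h1 : F 1 = ⁅f, v⁆ := by simp [F]
  have hf : ⁅f, F (n + 3)⁆ = 0 := by
    have := P.pow_toEnd_f_eq_zero_of_eq_nat (n := n + 3) rfl
    rw [pow_succ'] at this
    exact this
  have he : ⁅e, F (n + 3)⁆ = ((n + 2 : ℕ) + 1 : K) • F (n + 2) := by
    have := P.lie_e_pow_succ_toEnd_f (n + 2)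
    simp only [Nat.cast_add, Nat.cast_ofNat] at this ⊢
    rw [show ((n : K) + 2 + 1) * (n + 3 - (n + 2)) = n + 2 + 1 by ring] at this
    exact this
  refine H.exists_relation (v + F (n + 3)) e h f fun a b c habc ↦ ?_
  rw [lie_add, lie_add, lie_add, P.lie_e, P.lie_h, he, hf, hh, ← h1, ← h0, add_zero, zero_add]
    at habc
  have key := Fintype.linearIndependent_iff.1 hLI
    ![b * (n + 3 : ℕ), c, a * ((n + 2 : ℕ) + 1 : K), b * ((n + 3 : ℕ) - 2 * (n + 3 : ℕ))] (by
      rw [Fin.sum_univ_four, ← habc]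
      simp only [idx, Matrix.cons_val_zero, Matrix.cons_val_one, Matrix.cons_val]
      module)
  have k0 := key 0
  have k1 := key 1
  have k2 := key 2
  have hc3 : ((n + 3 : ℕ) : K) ≠ 0 := Nat.cast_ne_zero.2 (by omega)
  have hc2 : ((n + 2 : ℕ) + 1 : K) ≠ 0 := by exact_mod_cast (n + 2).succ_ne_zero
  simp only [Matrix.cons_val_zero, Matrix.cons_val_one, Matrix.cons_val, mul_eq_zero, hc3, hc2,
    or_false] at k0 k1 k2
  exact ⟨k2, k0, k1⟩

/-- Two primitive vectors of the same weight `1` or `2` are proportional. -/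
lemma not_linearIndependent_pair (H : HasOrbitsOfRankLETwo K L M)
    (hn : n = 1 ∨ n = 2)
    (P : HasPrimitiveVectorWith t v (n : K)) (P' : HasPrimitiveVectorWith t v' (n : K)) :
    ¬ LinearIndependent K ![v, v'] := by
  intro hLI
  rw [LinearIndependent.pair_iff] at hLI
  rcases hn with rfl | rfl
  · have hf : ⁅f, ⁅f, v'⁆⁆ = 0 := by
      have := P'.pow_toEnd_f_eq_zero_of_eq_nat (n := 1) rfl
      rwa [pow_two] at this
    -- Highest vector of one copy plus lowest vector of the other: `e`, `h`, `f` send it to `v'`, `v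
    -- - f v'`, `f v`. Applying `e` to a relation isolates its coefficients.
    refine H.exists_relation (v + ⁅f, v'⁆) e h f fun a b c habc ↦ ?_
    rw [lie_add, lie_add, lie_add, P.lie_e, P.lie_h, P'.lie_e_lie_f, P'.lie_h_lie_f, hf] at habc
    have h1 := congrArg (fun x ↦ ⁅e, x⁆) habc
    simp only [lie_add, lie_smul, P.lie_e, P'.lie_e, P'.lie_e_lie_f, P.lie_e_lie_f, lie_zero] at h1
    have h2 := hLI c (-b) (by rw [← h1]; push_cast; module)
    obtain ⟨rfl, hb⟩ := h2
    obtain rfl : b = 0 := by simpa using hb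
    have h3 := hLI 0 a (by rw [← habc]; push_cast; module)
    exact ⟨h3.2, rfl, rfl⟩
  · have hf : ⁅f, ⁅f, ⁅f, v'⁆⁆⁆ = 0 := by
      have := P'.pow_toEnd_f_eq_zero_of_eq_nat (n := 2) rfl
      rwa [pow_succ', pow_two] at this
    refine H.exists_relation (v + ⁅f, ⁅f, v'⁆⁆) e h f fun a b c habc ↦ ?_
    rw [lie_add, lie_add, lie_add, P.lie_e, P.lie_h, P'.lie_e_lie_f_lie_f, P'.lie_h_lie_f_lie_f,
      hf] at habc
    have h1 := congrArg (fun x ↦ ⁅e, x⁆) habc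
    simp only [lie_add, lie_smul, P.lie_e, P'.lie_e_lie_f, P.lie_e_lie_f,
      P'.lie_e_lie_f_lie_f, lie_zero] at h1
    have h2 := congrArg (fun x ↦ ⁅e, x⁆) h1
    simp only [lie_add, lie_smul, P.lie_e, P'.lie_e, P'.lie_e_lie_f, lie_zero] at h2
    have h3 := hLI 0 (-8 * b) (by rw [← h2]; push_cast; module)
    obtain rfl : b = 0 := by simpa using h3.2
    have h4 := hLI (2 * c) (4 * a) (by rw [← h1]; push_cast; module)
    simp only [mul_eq_zero, OfNat.ofNat_ne_zero, false_or] at h4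
    exact ⟨h4.2, rfl, h4.1⟩

/-- Primitive vectors of weights `2` and `1` cannot coexist. -/
lemma false_of_weight_two_one (H : HasOrbitsOfRankLETwo K L M)
    (P : HasPrimitiveVectorWith t v (2 : K)) (Q : HasPrimitiveVectorWith t w (1 : K)) : False := by
  have hLI : LinearIndependent K ![v, w] := by
    rw [LinearIndependent.pair_iff]
    intro a b hab
    have h1 := congrArg (fun x ↦ ⁅h, x⁆) hab
    simp only [lie_add, lie_smul, P.lie_h, Q.lie_h, lie_zero] at h1
    have h2 : a • v = 0 := by
      have : a • v = (a • (2 : K) • v + b • (1 : K) • w) - (a • v + b • w) := by module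
      rw [this, h1, hab, sub_zero]
    have h3 := (smul_eq_zero_iff_left P.ne_zero).1 h2
    subst h3
    rw [zero_smul, zero_add] at hab
    exact ⟨rfl, (smul_eq_zero_iff_left Q.ne_zero).1 hab⟩
  rw [LinearIndependent.pair_iff] at hLI
  -- The images under `e`, `h`, `f` are `w`, `2 v - f w`, `f v`.
  refine H.exists_relation (v + ⁅f, w⁆) e h f fun a b c habc ↦ ?_
  rw [lie_add, lie_add, lie_add, P.lie_e, P.lie_h, Q.lie_e_lie_f, Q.lie_h_lie_f] at habc
  have h1 := congrArg (fun x ↦ ⁅e, x⁆) habc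
  simp only [lie_add, lie_smul, P.lie_e, Q.lie_e, Q.lie_e_lie_f, P.lie_e_lie_f,
    Q.lie_e_lie_f_lie_f, lie_zero] at h1
  have h2 := hLI (2 * c) (-b) (by rw [← h1]; module)
  simp only [mul_eq_zero, OfNat.ofNat_ne_zero, false_or, neg_eq_zero] at h2
  obtain ⟨rfl, rfl⟩ := h2
  have h3 := hLI 0 a (by rw [← habc]; module)
  exact ⟨h3.2, rfl, rfl⟩

end HasPrimitiveVectorWith

end IsSl2Triple

end Sl2Modules

/-! ### Splitting off the trivial part of a module over an `sl₂` triple -/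

section Sl2Modules

open LieModule Module

variable {K L M : Type*} [Field K] [CharZero K] [LieRing L] [LieAlgebra K L]
  [AddCommGroup M] [Module K M] [LieRingModule L M] [LieModule K L M] [FiniteDimensional K M]

lemma linearIndependent_pair_of_lie_eq_smul {h : L} {x y : M} {a b : K} (hx : x ≠ 0) (hy : y ≠ 0)
    (hhx : ⁅h, x⁆ = a • x) (hhy : ⁅h, y⁆ = b • y) (hab : a ≠ b) : LinearIndependent K ![x, y] := by
  rw [LinearIndependent.pair_iff]
  intro c d hcd
  have h1 := congrArg (fun x ↦ ⁅h, x⁆) hcd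
  simp only [lie_add, lie_smul, hhx, hhy, lie_zero] at h1
  have h2 : (c * (a - b)) • x = 0 := by
    have : (c * (a - b)) • x = (c • a • x + d • b • y) - b • (c • x + d • y) := by module
    rw [this, h1, hcd, smul_zero, sub_zero]
  rw [smul_eq_zero_iff_left hx, mul_eq_zero, sub_eq_zero, or_iff_left hab] at h2
  subst h2
  rw [zero_smul, zero_add, smul_eq_zero_iff_left hy] at hcd
  exact ⟨rfl, hcd⟩

lemma HasOrbitsOfRankLETwo.lie_mem_span_pair (H : HasOrbitsOfRankLETwo K L M) {m : M} {x y : L}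
    (hxy : LinearIndependent K ![⁅x, m⁆, ⁅y, m⁆]) (z : L) :
    ⁅z, m⁆ ∈ Submodule.span K {⁅x, m⁆, ⁅y, m⁆} := by
  have := H m z x y
  change ¬ LinearIndependent K (Fin.cons ⁅z, m⁆ ![⁅x, m⁆, ⁅y, m⁆]) at this
  rw [linearIndependent_finCons] at this
  rw [Set.pair_comm]
  simpa [hxy] using this

namespace IsSl2Triple

variable {h e f : L}

/-- Elements of `M` killed by `e`, `f` and `h`. -/
def Kills (h e f : L) (m : M) : Prop := ⁅e, m⁆ = 0 ∧ ⁅f, m⁆ = 0 ∧ ⁅h, m⁆ = 0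

namespace HasPrimitiveVectorWith

variable {t : IsSl2Triple h e f} {v : M}

lemma lie_f_ne_zero (P : HasPrimitiveVectorWith t v (1 : K)) : ⁅f, v⁆ ≠ 0 := by
  have := P.pow_toEnd_f_ne_zero_of_eq_nat (n := 1) (by simp) le_rfl
  simpa using this

lemma lie_f_lie_f_eq_zero (P : HasPrimitiveVectorWith t v (1 : K)) : ⁅f, ⁅f, v⁆⁆ = 0 := by
  have := P.pow_toEnd_f_eq_zero_of_eq_nat (n := 1) (by simp)
  rwa [pow_two] at this

lemma lie_f_ne_zero' (P : HasPrimitiveVectorWith t v (2 : K)) : ⁅f, v⁆ ≠ 0 := by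
  have := P.pow_toEnd_f_ne_zero_of_eq_nat (n := 2) (by simp) (i := 1) (by simp)
  simpa using this

lemma lie_f_lie_f_ne_zero (P : HasPrimitiveVectorWith t v (2 : K)) : ⁅f, ⁅f, v⁆⁆ ≠ 0 := by
  have := P.pow_toEnd_f_ne_zero_of_eq_nat (n := 2) (by simp) le_rfl
  rwa [pow_two] at this

lemma lie_f_lie_f_lie_f_eq_zero (P : HasPrimitiveVectorWith t v (2 : K)) :
    ⁅f, ⁅f, ⁅f, v⁆⁆⁆ = 0 := by
  have := P.pow_toEnd_f_eq_zero_of_eq_nat (n := 2) (by simp)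
  rwa [pow_succ', pow_two] at this

lemma lie_h' (P : HasPrimitiveVectorWith t v (1 : K)) : ⁅h, v⁆ = v := by
  simpa using P.lie_h

lemma lie_e_lie_f' (P : HasPrimitiveVectorWith t v (1 : K)) : ⁅e, ⁅f, v⁆⁆ = v := by
  simpa using P.lie_e_lie_f

lemma lie_h_lie_f_one (P : HasPrimitiveVectorWith t v (1 : K)) : ⁅h, ⁅f, v⁆⁆ = -⁅f, v⁆ := by
  rw [P.lie_h_lie_f]; module

lemma lie_h_lie_f_two (P : HasPrimitiveVectorWith t v (2 : K)) : ⁅h, ⁅f, v⁆⁆ = 0 := by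
  rw [P.lie_h_lie_f]; module

lemma lie_e_lie_f_lie_f_two (P : HasPrimitiveVectorWith t v (2 : K)) :
    ⁅e, ⁅f, ⁅f, v⁆⁆⁆ = (2 : K) • ⁅f, v⁆ := by
  rw [P.lie_e_lie_f_lie_f]; module

lemma lie_h_lie_f_lie_f_two (P : HasPrimitiveVectorWith t v (2 : K)) :
    ⁅h, ⁅f, ⁅f, v⁆⁆⁆ = (-2 : K) • ⁅f, ⁅f, v⁆⁆ := by
  rw [P.lie_h_lie_f_lie_f]; module

lemma coeff_eq_zero_one (P : HasPrimitiveVectorWith t v (1 : K)) {a b : K}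
    (hab : a • v + b • ⁅f, v⁆ = 0) : a = 0 ∧ b = 0 :=
  LinearIndependent.pair_iff.1 (linearIndependent_pair_of_lie_eq_smul P.ne_zero P.lie_f_ne_zero
    P.lie_h P.lie_h_lie_f (by norm_num)) a b hab

lemma coeff_eq_zero_two (P : HasPrimitiveVectorWith t v (2 : K)) {a b c : K}
    (habc : a • v + b • ⁅f, v⁆ + c • ⁅f, ⁅f, v⁆⁆ = 0) : a = 0 ∧ b = 0 ∧ c = 0 := by
  have h1 := congrArg (fun x ↦ ⁅e, x⁆) habc
  simp only [lie_add, lie_smul, P.lie_e, P.lie_e_lie_f, P.lie_e_lie_f_lie_f_two, lie_zero] at h1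
  have h2 := congrArg (fun x ↦ ⁅e, x⁆) h1
  simp only [lie_add, lie_smul, P.lie_e, P.lie_e_lie_f, lie_zero] at h2
  have h3 : (4 * c) • v = 0 := by rw [← h2]; module
  obtain rfl : c = 0 := by simpa [P.ne_zero] using h3
  have h4 : (2 * b) • v = 0 := by rw [← h1]; module
  obtain rfl : b = 0 := by simpa [P.ne_zero] using h4
  have h5 : a • v = 0 := by rw [← habc]; module
  exact ⟨by simpa [P.ne_zero] using h5, rfl, rfl⟩

/-- If the image of `e` is spanned by a primitive vector `v` of weight `1`, then `M` is the sum of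
`⟨v, ⁅f, v⁆⟩` and a trivial module. -/
lemma exists_decomp_one (P : HasPrimitiveVectorWith t v (1 : K))
    (he : ∀ m : M, ∃ a : K, ⁅e, m⁆ = a • v) (m : M) :
    ∃ (m₀ : M) (a b : K), Kills h e f m₀ ∧ m = m₀ + (a • v + b • ⁅f, v⁆) := by
  have hh : ∀ m : M, ⁅h, m⁆ = ⁅e, ⁅f, m⁆⁆ - ⁅f, ⁅e, m⁆⁆ := fun m ↦ by
    rw [← t.lie_e_f, lie_lie]
  have hf : ∀ m : M, (2 : K) • ⁅f, m⁆ = ⁅f, ⁅h, m⁆⁆ - ⁅h, ⁅f, m⁆⁆ := fun m ↦ by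
    rw [← lie_lie, ← lie_skew f h, t.lie_lie_smul_f K, neg_neg, smul_lie]
  -- Since `h = e f - f e`, the vectors `h m` and `h (f m)` lie in the span of `v` and `f v`; then
  -- so does `2 f m = f h m - h f m`. The weight of `f m`, computed by applying `h`, excludes a
  -- component along `v`.
  have h1 : ∀ m : M, ∃ b : K, ⁅f, m⁆ = b • ⁅f, v⁆ := by
    intro m
    obtain ⟨a, ha⟩ := he ⁅f, m⁆
    obtain ⟨b, hb⟩ := he m
    obtain ⟨c, hc⟩ := he ⁅f, ⁅f, m⁆⁆
    have h2 : ⁅h, m⁆ = a • v - b • ⁅f, v⁆ := by rw [hh, ha, hb, lie_smul]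
    have h3 : ⁅h, ⁅f, m⁆⁆ = c • v - a • ⁅f, v⁆ := by rw [hh, hc, ha, lie_smul]
    have h4 : (2 : K) • ⁅f, m⁆ = (2 * a) • ⁅f, v⁆ - c • v := by
      rw [hf, h2, h3, lie_sub, lie_smul, lie_smul, P.lie_f_lie_f_eq_zero]; module
    have h5 := congrArg (fun x ↦ ⁅h, x⁆) h4
    simp only [lie_smul, lie_sub, h3, P.lie_h', P.lie_h_lie_f_one] at h5
    have h6 : (3 * c) • v + (0 : K) • ⁅f, v⁆ = 0 := by
      have : (3 * c) • v + (0 : K) • ⁅f, v⁆ =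
        (2 : K) • (c • v - a • ⁅f, v⁆) - ((2 * a) • -⁅f, v⁆ - c • v) := by module
      rw [this, h5, sub_self]
    obtain rfl : c = 0 := by simpa using (P.coeff_eq_zero_one h6).1
    refine ⟨a, ?_⟩
    have h7 : (2 : K) • (⁅f, m⁆ - a • ⁅f, v⁆) = 0 := by rw [smul_sub, h4]; module
    rwa [smul_eq_zero_iff_right two_ne_zero, sub_eq_zero] at h7
  obtain ⟨a, ha⟩ := he m
  obtain ⟨b, hb⟩ := h1 m
  -- The correction has the same images as `m` under `e` and `f`, because `e (f v) = v` and `f (f v)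
  -- = 0`.
  have k1 : ⁅e, m - (b • v + a • ⁅f, v⁆)⁆ = 0 := by
    simp [ha, P.lie_e, P.lie_e_lie_f]
  have k2 : ⁅f, m - (b • v + a • ⁅f, v⁆)⁆ = 0 := by
    simp [hb, P.lie_f_lie_f_eq_zero]
  exact ⟨m - (b • v + a • ⁅f, v⁆), b, a, ⟨k1, k2, by rw [hh, k1, k2]; simp⟩, by abel⟩

/-- If the image of `e` is spanned by `v` and `⁅f, v⁆` for a primitive vector `v` of weight `2`,
then `M` is the sum of `⟨v, ⁅f, v⁆, ⁅f, ⁅f, v⁆⁆⟩` and a trivial module. -/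
lemma exists_decomp_two (P : HasPrimitiveVectorWith t v (2 : K))
    (he : ∀ m : M, ∃ a b : K, ⁅e, m⁆ = a • v + b • ⁅f, v⁆) (m : M) :
    ∃ (m₀ : M) (a b c : K), Kills h e f m₀ ∧
      m = m₀ + (a • v + b • ⁅f, v⁆ + c • ⁅f, ⁅f, v⁆⁆) := by
  have hh : ∀ m : M, ⁅h, m⁆ = ⁅e, ⁅f, m⁆⁆ - ⁅f, ⁅e, m⁆⁆ := fun m ↦ by
    rw [← t.lie_e_f, lie_lie]
  have hf : ∀ m : M, (2 : K) • ⁅f, m⁆ = ⁅f, ⁅h, m⁆⁆ - ⁅h, ⁅f, m⁆⁆ := fun m ↦ by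
    rw [← lie_lie, ← lie_skew f h, t.lie_lie_smul_f K, neg_neg, smul_lie]
  have hhe : ∀ m : M, ⁅h, ⁅e, m⁆⁆ = ⁅e, ⁅h, m⁆⁆ + (2 : K) • ⁅e, m⁆ := fun m ↦ by
    rw [leibniz_lie, t.lie_h_e_smul K, smul_lie, add_comm]
  -- it is enough to treat the vectors killed by `e`
  have h1 : ∀ m : M, ⁅e, m⁆ = 0 → ∃ c : K, Kills h e f (m - c • v) := by
    intro m hm
    obtain ⟨a, b, hab⟩ := he ⁅f, m⁆
    have h2 : ⁅h, m⁆ = a • v + b • ⁅f, v⁆ := by rw [hh, hm, hab]; simp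
    have h3 := hhe m
    rw [hm, h2, lie_zero, lie_add, lie_smul, lie_smul, P.lie_e, P.lie_e_lie_f] at h3
    have h4 : (2 * b) • v + (0 : K) • ⁅f, v⁆ + (0 : K) • ⁅f, ⁅f, v⁆⁆ = 0 := by rw [h3]; module
    obtain rfl : b = 0 := by simpa using (P.coeff_eq_zero_two h4).1
    -- As `h v = 2 v`, this makes `h n = 0` while `e n = 0` persists. Then `f n` has weight `-2`,
    -- but `-2 f n = h f n = e f f n` lies in the span of `v` and `f v`, of weights `2` and `0`.
    -- Hence `f n = 0`.
    set n := m - (a / 2) • v with hn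
    have n1 : ⁅e, n⁆ = 0 := by simp [hn, hm, P.lie_e]
    have n2 : ⁅h, n⁆ = 0 := by rw [hn, lie_sub, h2, lie_smul, P.lie_h]; module
    have n3 : ⁅h, ⁅f, n⁆⁆ = (-2 : K) • ⁅f, n⁆ := by
      have := hf n
      rw [n2, lie_zero, zero_sub] at this
      rw [neg_smul, this, neg_neg]
    obtain ⟨c, d, hcd⟩ := he ⁅f, ⁅f, n⁆⁆
    have n4 : ⁅e, ⁅f, n⁆⁆ = 0 := by
      have := hh n
      rw [n2, n1, lie_zero, sub_zero] at this
      exact this.symm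
    have n5 := hh ⁅f, n⁆
    rw [n3, n4, lie_zero, sub_zero, hcd] at n5
    have n6 : (-2 : K) • ((-2 : K) • ⁅f, n⁆) = ⁅h, c • v + d • ⁅f, v⁆⁆ := by
      rw [← n5, lie_smul, n3]
    rw [n5, lie_add, lie_smul, lie_smul, P.lie_h, P.lie_h_lie_f_two, smul_zero, add_zero] at n6
    have n7 : (4 * c) • v + (2 * d) • ⁅f, v⁆ + (0 : K) • ⁅f, ⁅f, v⁆⁆ = 0 := by
      have : (4 * c) • v + (2 * d) • ⁅f, v⁆ + (0 : K) • ⁅f, ⁅f, v⁆⁆ =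
        c • (2 : K) • v - (-2 : K) • (c • v + d • ⁅f, v⁆) := by module
      rw [this, ← n6, sub_self]
    obtain ⟨hc, hd, -⟩ := P.coeff_eq_zero_two n7
    obtain rfl : c = 0 := by simpa using hc
    obtain rfl : d = 0 := by simpa using hd
    refine ⟨a / 2, n1, ?_, n2⟩
    rw [← hn]
    simpa using n5
  obtain ⟨a, b, hab⟩ := he m
  obtain ⟨c, hc⟩ := h1 (m - ((a / 2) • ⁅f, v⁆ + (b / 2) • ⁅f, ⁅f, v⁆⁆)) (by
    rw [lie_sub, hab, lie_add, lie_smul, lie_smul, P.lie_e_lie_f, P.lie_e_lie_f_lie_f_two]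
    module)
  exact ⟨_, c, a / 2, b / 2, hc, by abel⟩

end HasPrimitiveVectorWith

end IsSl2Triple

end Sl2Modules

-- A nonzero root of a Cartan subalgebra `H` supplies the triple. Without nonzero roots `H` is zero,
-- since the roots span its dual; but a Cartan subalgebra is its own normalizer, and the normalizer
-- of zero is everything.
open LieModule Module LieAlgebra in
lemma LieAlgebra.IsKilling.exists_isSl2Triple (K L : Type*) [Field K] [CharZero K] [IsAlgClosed K]
    [LieRing L] [LieAlgebra K L] [FiniteDimensional K L] [IsKilling K L] [Nontrivial L] :
    ∃ h e f : L, IsSl2Triple h e f := by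
  obtain ⟨x, hx⟩ := exists_isCartanSubalgebra_engel K L
  set H := LieSubalgebra.engel K x
  by_cases hα : ∃ α : Weight K H L, α.IsNonZero
  · obtain ⟨α, hα⟩ := hα
    obtain ⟨h, e, f, t, -⟩ := exists_isSl2Triple_of_weight_isNonZero hα
    exact ⟨h, e, f, t⟩
  exfalso
  push Not at hα
  have h1 := span_weight_eq_top (K := K) (L := L) (H := H)
  have h2 : Set.range (Weight.toLinear K H L) ⊆ {0} := by
    rintro _ ⟨α, rfl⟩
    have : α.IsZero := by simpa using hα α
    ext y
    simpa using congrFun this y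
  have h3 : (⊤ : Submodule K (Module.Dual K H)) = ⊥ := by
    rw [← h1, eq_bot_iff]
    exact (Submodule.span_mono h2).trans (by simp)
  have h4 : ∀ y : H, y = 0 := fun y ↦ by
    rw [← Module.forall_dual_apply_eq_zero_iff K]
    intro φ
    have : φ ∈ (⊤ : Submodule K (Module.Dual K H)) := trivial
    rw [h3, Submodule.mem_bot] at this
    simp [this]
  have h5 : H = ⊥ := by
    rw [eq_bot_iff]
    intro y hy
    have := h4 ⟨y, hy⟩
    simpa using congrArg Subtype.val this
  have h6 := LieSubalgebra.IsCartanSubalgebra.self_normalizing (H := H)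
  obtain ⟨y, hy⟩ := exists_ne (0 : L)
  have h7 : y ∈ H.normalizer := by
    rw [LieSubalgebra.mem_normalizer_iff, h5]
    intro z hz
    simp only [LieSubalgebra.mem_bot] at hz
    simp [hz]
  rw [h6, h5, LieSubalgebra.mem_bot] at h7
  exact hy h7

/-! ### Faithful modules with small orbits: the triple spans the Lie algebra -/

section Sl2Modules

open LieModule Module

variable {K L M : Type*} [Field K] [CharZero K] [LieRing L] [LieAlgebra K L]
  [AddCommGroup M] [Module K M] [LieRingModule L M] [LieModule K L M] [FiniteDimensional K M]

namespace IsSl2Triple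

variable {h e f : L}

/-- `v` is a primitive vector of weight one spanning the image of `e`. -/
def GeneratesOne (K : Type*) [Field K] [LieAlgebra K L] [Module K M] (t : IsSl2Triple h e f)
    (v : M) : Prop :=
  HasPrimitiveVectorWith t v (1 : K) ∧ ∀ m : M, ∃ a : K, ⁅e, m⁆ = a • v

/-- `v` is a primitive vector of weight two such that `v`, `⁅f, v⁆` span the image of `e`. -/
def GeneratesTwo (K : Type*) [Field K] [LieAlgebra K L] [Module K M] (t : IsSl2Triple h e f)
    (v : M) : Prop :=
  HasPrimitiveVectorWith t v (2 : K) ∧ ∀ m : M, ∃ a b : K, ⁅e, m⁆ = a • v + b • ⁅f, v⁆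

/-- Let `e ^ k` be the last nonzero power of `e`. Its image consists, apart from zero, of primitive
vectors of weight `k`, so `k` is `1` or `2` and the image is a line. For `k = 1` this is the claim.
For `k = 2`, anything in the image of `e` outside the span of `v` and `f v` would yield a primitive
vector of weight one. -/
lemma exists_generates (t : IsSl2Triple h e f) (H : HasOrbitsOfRankLETwo K L M)
    (he : ∃ m : M, ⁅e, m⁆ ≠ 0) :
    (∃ v : M, t.GeneratesOne K v) ∨ (∃ v : M, t.GeneratesTwo K v) := by
  obtain ⟨k, hk, hk'⟩ : ∃ k, toEnd K L M e ^ k ≠ 0 ∧ toEnd K L M e ^ (k + 1) = 0 := by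
    refine Nat.exists_not_and_succ_of_not_zero_of_exists ?_ t.isNilpotent_toEnd_e
    obtain ⟨m, hm⟩ := he
    intro h0
    have := LinearMap.congr_fun h0 ⁅e, m⁆
    exact hm (by simpa using this)
  obtain ⟨u, hu⟩ : ∃ u, (toEnd K L M e ^ k) u ≠ 0 := by
    by_contra! hcon
    exact hk (LinearMap.ext hcon)
  have P := t.hasPrimitiveVectorWith_of_pow_succ_eq_zero hk' hu
  have hlt := P.weight_lt_three H
  have hprop : (k = 1 ∨ k = 2) → ∀ m : M, ∃ a : K,
      (toEnd K L M e ^ k) m = a • (toEnd K L M e ^ k) u := by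
    intro hk12 m
    by_cases hm : (toEnd K L M e ^ k) m = 0
    · exact ⟨0, by simp [hm]⟩
    have Q := t.hasPrimitiveVectorWith_of_pow_succ_eq_zero hk' hm
    have := P.not_linearIndependent_pair H hk12 Q
    rw [LinearIndependent.pair_iff' hu] at this
    push Not at this
    obtain ⟨a, ha⟩ := this
    exact ⟨a, ha.symm⟩
  interval_cases k
  · exfalso
    obtain ⟨m, hm⟩ := he
    have := LinearMap.congr_fun hk' m
    exact hm (by simpa using this)
  · left
    simp only [pow_one, toEnd_apply_apply, Nat.cast_one] at P hprop
    exact ⟨_, P, hprop (by simp)⟩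
  · right
    simp only [pow_two, Module.End.mul_apply, toEnd_apply_apply, Nat.cast_ofNat] at P hprop
    refine ⟨_, P, fun m ↦ ?_⟩
    set v := ⁅e, ⁅e, u⁆⁆ with hv
    obtain ⟨c, hc⟩ := hprop (by simp) m
    -- The constant comes from `e e f f v = 4 v`; the correction gives `e e n = 0`.
    set n := m - (c / 4) • ⁅f, ⁅f, v⁆⁆ with hn
    have hee : ⁅e, ⁅e, n⁆⁆ = 0 := by
      rw [hn, lie_sub, lie_sub, hc, lie_smul, lie_smul, P.lie_e_lie_f_lie_f_two, lie_smul,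
        P.lie_e_lie_f]
      module
    obtain ⟨d, hd⟩ := hprop (by simp) ⁅f, n⁆
    have h1 := LinearMap.congr_fun (t.toEnd_e_pow_succ_mul_toEnd_f (K := K) (M := M) 1) n
    simp only [Nat.cast_one, Module.End.mul_apply, pow_succ, pow_zero, one_mul, toEnd_apply_apply,
      LinearMap.add_apply, LinearMap.smul_apply, LinearMap.sub_apply, one_smul,
      Module.End.one_apply, hd, hee, lie_zero, zero_add] at h1
    -- The commutator of `e ^ 2` with `f` is `2 (h - 1) e`. Consequently `e n - (d / 2) v` has
    -- weight one and is killed by `e`, so it must vanish.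
    have h2 : ⁅h, ⁅e, n⁆⁆ = ⁅e, n⁆ + (d / 2) • v := by
      have : (d / 2) • v = (2⁻¹ : K) • (d • v) := by module
      rw [this, h1]
      module
    by_cases hw : ⁅e, n⁆ - (d / 2) • v = 0
    · refine ⟨d / 2, c / 2, ?_⟩
      have : ⁅e, m⁆ = ⁅e, n⁆ + (c / 4) • ⁅e, ⁅f, ⁅f, v⁆⁆⁆ := by
        rw [hn, lie_sub, lie_smul]; abel
      rw [this, sub_eq_zero.1 hw, P.lie_e_lie_f_lie_f_two]
      module
    · exfalso
      refine P.false_of_weight_two_one H (w := ⁅e, n⁆ - (d / 2) • v) ⟨hw, ?_, ?_⟩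
      · rw [lie_sub, lie_smul, h2, P.lie_h]; module
      · rw [lie_sub, lie_smul, hee, P.lie_e]; simp

/-- The orbit directions at `w` and at `m₀ + w` both lie in the plane spanned by `x w` and `y w`,
because `x` and `y` kill `m₀`. Subtracting, `z m₀` lies in that plane as well. -/
lemma lie_mem_of_kills (H : HasOrbitsOfRankLETwo K L M) {m₀ w : M} {x y : L} {W : Submodule K M}
    (hx : ⁅x, m₀⁆ = 0) (hy : ⁅y, m₀⁆ = 0) (hxw : ⁅x, w⁆ ∈ W) (hyw : ⁅y, w⁆ ∈ W)
    (hLI : LinearIndependent K ![⁅x, w⁆, ⁅y, w⁆]) (z : L) : ⁅z, m₀⁆ ∈ W := by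
  have hW : Submodule.span K {⁅x, w⁆, ⁅y, w⁆} ≤ W := by
    rw [Submodule.span_le]
    rintro _ (rfl | rfl) <;> assumption
  have h1 := hW (H.lie_mem_span_pair hLI z)
  have h2 := H.lie_mem_span_pair (m := m₀ + w) (x := x) (y := y) (by simpa [hx, hy]) z
  simp only [lie_add, hx, hy, zero_add] at h2
  have h3 := W.sub_mem (hW h2) h1
  simpa using h3

variable [LieAlgebra.HasTrivialRadical K L]

/-- If `L` acts faithfully on `M` and maps `M` into a submodule `W`, then `L` acts faithfully
on `W`. -/
lemma eq_zero_of_forall_mem (hfaith : ∀ x : L, (∀ m : M, ⁅x, m⁆ = 0) → x = 0)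
    {W : Submodule K M} (hW : ∀ (x : L) (m : M), ⁅x, m⁆ ∈ W) {x : L}
    (hx : ∀ w ∈ W, ⁅x, w⁆ = 0) : x = 0 := by
  let I : LieIdeal K L :=
    { carrier := {x | ∀ w ∈ W, ⁅x, w⁆ = 0}
      add_mem' := fun {a b} ha hb w hw ↦ by rw [add_lie, ha w hw, hb w hw, add_zero]
      zero_mem' := fun w _ ↦ zero_lie w
      smul_mem' := fun c a ha w hw ↦ by rw [smul_lie, ha w hw, smul_zero]
      lie_mem := fun {y a} ha w hw ↦ by rw [lie_lie, ha w hw, ha _ (hW y w), lie_zero, sub_zero] }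
  -- Elements of the annihilator `I` of `W` map `M` into `W` and `W` to zero, so their products act
  -- as zero on `M`.
  have hI : IsLieAbelian I := ⟨fun a b ↦ by
    ext
    refine hfaith _ fun m ↦ ?_
    change ⁅⁅(a : L), (b : L)⁆, m⁆ = 0
    rw [lie_lie, a.2 _ (hW _ m), b.2 _ (hW _ m), sub_zero]⟩
  have : I = ⊥ := LieAlgebra.HasTrivialRadical.eq_bot_of_isSolvable I
  have hxI : x ∈ I := hx
  rwa [this, LieSubmodule.mem_bot] at hxI

/-- `L` maps `M` into the plane `W` spanned by `v` and `f v`, hence acts faithfully on `W`. Modulo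
the triple every `2 × 2` matrix is scalar; the scalar remainder is central in `L`, and the center is
zero. -/
lemma exists_coeff_of_generatesOne {t : IsSl2Triple h e f} (H : HasOrbitsOfRankLETwo K L M)
    (hfaith : ∀ x : L, (∀ m : M, ⁅x, m⁆ = 0) → x = 0) {v : M} (hv : t.GeneratesOne K v) (x : L) :
    ∃ a b c : K, x = a • e + b • h + c • f := by
  obtain ⟨P, he⟩ := hv
  set W : Submodule K M := Submodule.span K {v, ⁅f, v⁆} with hWdef
  have hmW : ∀ m, m ∈ W ↔ ∃ a b : K, a • v + b • ⁅f, v⁆ = m := fun m ↦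
    Submodule.mem_span_pair
  have hvW : v ∈ W := Submodule.subset_span (by simp)
  have hfW : ⁅f, v⁆ ∈ W := Submodule.subset_span (by simp)
  have LI1 : LinearIndependent K ![⁅h, v⁆, ⁅f, v⁆] := by
    rw [P.lie_h']
    exact linearIndependent_pair_of_lie_eq_smul P.ne_zero P.lie_f_ne_zero P.lie_h P.lie_h_lie_f
      (by norm_num)
  have LI2 : LinearIndependent K ![⁅e, ⁅f, v⁆⁆, ⁅h, ⁅f, v⁆⁆] := by
    rw [P.lie_e_lie_f', P.lie_h_lie_f]
    exact linearIndependent_pair_of_lie_eq_smul (a := 1) (b := -1) P.ne_zero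
      (smul_ne_zero (by norm_num) P.lie_f_ne_zero) P.lie_h
      (by rw [lie_smul, P.lie_h_lie_f]; module) (by norm_num)
  have hv1 : ∀ z : L, ⁅z, v⁆ ∈ W := fun z ↦
    (Submodule.span_le.2 (by
      rintro _ (rfl | rfl)
      · rw [P.lie_h']; exact hvW
      · exact hfW) : Submodule.span K {⁅h, v⁆, ⁅f, v⁆} ≤ W) (H.lie_mem_span_pair LI1 z)
  have hv2 : ∀ z : L, ⁅z, ⁅f, v⁆⁆ ∈ W := fun z ↦
    (Submodule.span_le.2 (by
      rintro _ (rfl | rfl)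
      · rw [P.lie_e_lie_f']; exact hvW
      · rw [P.lie_h_lie_f]; exact W.smul_mem _ hfW) :
      Submodule.span K {⁅e, ⁅f, v⁆⁆, ⁅h, ⁅f, v⁆⁆} ≤ W) (H.lie_mem_span_pair LI2 z)
  have hW : ∀ (z : L) (m : M), ⁅z, m⁆ ∈ W := by
    intro z m
    obtain ⟨m₀, a, b, ⟨k1, k2, k3⟩, rfl⟩ := P.exists_decomp_one he m
    rw [lie_add, lie_add, lie_smul, lie_smul]
    exact W.add_mem (lie_mem_of_kills H k3 k2 (by rw [P.lie_h']; exact hvW) hfW LI1 z)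
      (W.add_mem (W.smul_mem _ (hv1 z)) (W.smul_mem _ (hv2 z)))
  have hzero : ∀ {y : L}, ⁅y, v⁆ = 0 → ⁅y, ⁅f, v⁆⁆ = 0 → y = 0 := by
    intro y h1 h2
    refine eq_zero_of_forall_mem hfaith hW fun w hw ↦ ?_
    obtain ⟨a, b, rfl⟩ := (hmW w).1 hw
    simp [h1, h2]
  obtain ⟨a, b, hab⟩ := (hmW _).1 (hv1 x)
  obtain ⟨c, d, hcd⟩ := (hmW _).1 (hv2 x)
  -- `y` acts on `W` by a scalar
  set y := x - (c • e + ((a - d) / 2) • h + b • f) with hy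
  have y1 : ⁅y, v⁆ = ((a + d) / 2) • v := by
    rw [hy, sub_lie, add_lie, add_lie, smul_lie, smul_lie, smul_lie, P.lie_e, P.lie_h', ← hab]
    module
  have y2 : ⁅y, ⁅f, v⁆⁆ = ((a + d) / 2) • ⁅f, v⁆ := by
    rw [hy, sub_lie, add_lie, add_lie, smul_lie, smul_lie, smul_lie, P.lie_e_lie_f',
      P.lie_h_lie_f_one, P.lie_f_lie_f_eq_zero, ← hcd]
    module
  have y3 : ∀ w ∈ W, ⁅y, w⁆ = ((a + d) / 2) • w := by
    intro w hw
    obtain ⟨p, q, rfl⟩ := (hmW w).1 hw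
    rw [lie_add, lie_smul, lie_smul, y1, y2]
    module
  have y4 : ∀ z : L, ⁅z, y⁆ = 0 := by
    intro z
    apply hzero
    · rw [lie_lie, y1, y3 _ (hv1 z), lie_smul, sub_self]
    · rw [lie_lie, y2, y3 _ (hv2 z), lie_smul, sub_self]
  have y5 : y ∈ LieAlgebra.center K L := by
    rw [LieModule.mem_maxTrivSubmodule]
    exact y4
  rw [LieAlgebra.center_eq_bot, LieSubmodule.mem_bot, hy, sub_eq_zero] at y5
  exact ⟨_, _, _, y5⟩

/-- `L` acts faithfully on the three-dimensional `W` spanned by `v`, `p`, `q`. At each point where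
the triple already gives a two-dimensional orbit, every element of `L` must move within that plane.
The points `v`, `p`, `q` leave six matrix entries, and the points `v + p`, `p + q`, `v + q` give
three relations among them, which leave exactly the action of the triple. -/
lemma exists_coeff_of_generatesTwo {t : IsSl2Triple h e f} (H : HasOrbitsOfRankLETwo K L M)
    (hfaith : ∀ x : L, (∀ m : M, ⁅x, m⁆ = 0) → x = 0) {v : M} (hv : t.GeneratesTwo K v) (x : L) :
    ∃ a b c : K, x = a • e + b • h + c • f := by
  obtain ⟨P, he⟩ := hv
  set p := ⁅f, v⁆ with hp
  set q := ⁅f, p⁆ with hq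
  have ev : ⁅e, v⁆ = 0 := P.lie_e
  have hv : ⁅h, v⁆ = (2 : K) • v := P.lie_h
  have ep : ⁅e, p⁆ = (2 : K) • v := P.lie_e_lie_f
  have hhp : ⁅h, p⁆ = 0 := P.lie_h_lie_f_two
  have eq : ⁅e, q⁆ = (2 : K) • p := P.lie_e_lie_f_lie_f_two
  have hhq : ⁅h, q⁆ = (-2 : K) • q := P.lie_h_lie_f_lie_f_two
  have fq : ⁅f, q⁆ = 0 := P.lie_f_lie_f_lie_f_eq_zero
  have hp0 : p ≠ 0 := P.lie_f_ne_zero'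
  have hq0 : q ≠ 0 := P.lie_f_lie_f_ne_zero
  have coeff : ∀ {a b c : K}, a • v + b • p + c • q = 0 → a = 0 ∧ b = 0 ∧ c = 0 :=
    fun habc ↦ P.coeff_eq_zero_two habc
  have two : (2 : K) ≠ 0 := two_ne_zero
  set W : Submodule K M := Submodule.span K {v, p, q} with hWdef
  have hmW : ∀ m, m ∈ W ↔ ∃ a b c : K, a • v + b • p + c • q = m := fun m ↦
    Submodule.mem_span_triple
  have LI1 : LinearIndependent K ![⁅h, v⁆, ⁅f, v⁆] := by
    rw [LinearIndependent.pair_iff]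
    intro a b hab
    obtain ⟨h1, h2, -⟩ := coeff (a := a * 2) (b := b) (c := 0) (by rw [← hab, hv]; module)
    exact ⟨by simpa using h1, h2⟩
  have LI2 : LinearIndependent K ![⁅e, p⁆, ⁅f, p⁆] := by
    rw [LinearIndependent.pair_iff]
    intro a b hab
    obtain ⟨h1, -, h2⟩ := coeff (a := a * 2) (b := 0) (c := b) (by rw [← hab, ep]; module)
    exact ⟨by simpa using h1, h2⟩
  have LI3 : LinearIndependent K ![⁅e, q⁆, ⁅h, q⁆] := by
    rw [LinearIndependent.pair_iff]
    intro a b hab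
    obtain ⟨-, h1, h2⟩ := coeff (a := 0) (b := a * 2) (c := b * -2)
      (by rw [← hab, eq, hhq]; module)
    exact ⟨by simpa using h1, by simpa using h2⟩
  have sv : ∀ z : L, ∃ a b : K, ⁅z, v⁆ = a • v + b • p := fun z ↦ by
    obtain ⟨a, b, hab⟩ := Submodule.mem_span_pair.1 (H.lie_mem_span_pair LI1 z)
    exact ⟨a * 2, b, by rw [← hab, hv]; module⟩
  have sp : ∀ z : L, ∃ a b : K, ⁅z, p⁆ = a • v + b • q := fun z ↦ by
    obtain ⟨a, b, hab⟩ := Submodule.mem_span_pair.1 (H.lie_mem_span_pair LI2 z)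
    exact ⟨a * 2, b, by rw [← hab, ep]; module⟩
  have sq : ∀ z : L, ∃ a b : K, ⁅z, q⁆ = a • p + b • q := fun z ↦ by
    obtain ⟨a, b, hab⟩ := Submodule.mem_span_pair.1 (H.lie_mem_span_pair LI3 z)
    exact ⟨a * 2, b * -2, by rw [← hab, eq, hhq]; module⟩
  have hW : ∀ (z : L) (m : M), ⁅z, m⁆ ∈ W := by
    intro z m
    obtain ⟨m₀, a, b, c, ⟨k1, k2, k3⟩, rfl⟩ := P.exists_decomp_two he m
    rw [lie_add]
    refine W.add_mem (lie_mem_of_kills H k3 k2 ((hmW _).2 ⟨2, 0, 0, by rw [hv]; module⟩)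
      ((hmW _).2 ⟨0, 1, 0, by module⟩) LI1 z) ?_
    obtain ⟨a1, b1, h1⟩ := sv z
    obtain ⟨a2, b2, h2⟩ := sp z
    obtain ⟨a3, b3, h3⟩ := sq z
    refine (hmW _).2 ⟨a * a1 + b * a2, a * b1 + c * a3, b * b2 + c * b3, ?_⟩
    rw [lie_add, lie_add, lie_smul, lie_smul, lie_smul, h1, h2, h3]
    module
  obtain ⟨a, b, h1⟩ := sv x
  obtain ⟨c, d, h2⟩ := sp x
  obtain ⟨r, s, h3⟩ := sq x
  -- At `v + p` the elements `h` and `f` give `2 v` and `p + q`, so the coefficients along `p` and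
  -- `q` must agree. The next two claims use the planes of `v + p` and `q` at `p + q`, and of `v -
  -- q` and `p` at `v + q`.
  have hbd : d = b := by
    by_contra hne
    refine H.exists_relation (v + p) x h f fun α β γ hrel ↦ ?_
    rw [lie_add, lie_add, lie_add, h1, h2, hv, hhp, ← hp, ← hq] at hrel
    obtain ⟨k1, k2, k3⟩ := coeff (a := α * (a + c) + 2 * β) (b := α * b + γ) (c := α * d + γ)
      (by rw [← hrel]; module)
    have k4 : α * (d - b) = 0 := by linear_combination k3 - k2
    rw [mul_eq_zero, sub_eq_zero, or_iff_left hne] at k4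
    subst k4
    simp only [zero_mul, zero_add, mul_eq_zero, two, false_or] at k1 k2
    exact ⟨rfl, k1, k2⟩
  have hcr : r = c := by
    by_contra hne
    refine H.exists_relation (p + q) x h e fun α β γ hrel ↦ ?_
    rw [lie_add, lie_add, lie_add, h2, h3, hhp, hhq, ep, eq] at hrel
    obtain ⟨k1, k2, k3⟩ := coeff (a := α * c + 2 * γ) (b := α * r + 2 * γ)
      (c := α * (d + s) - 2 * β) (by rw [← hrel]; module)
    have k4 : α * (r - c) = 0 := by linear_combination k2 - k1
    rw [mul_eq_zero, sub_eq_zero, or_iff_left hne] at k4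
    subst k4
    simp only [zero_mul, zero_add, zero_sub, neg_eq_zero, mul_eq_zero, two, false_or] at k1 k3
    exact ⟨rfl, k3, k1⟩
  have has : s = -a := by
    by_contra hne
    refine H.exists_relation (v + q) x h f fun α β γ hrel ↦ ?_
    rw [lie_add, lie_add, lie_add, h1, h3, hv, hhq, ← hp, fq] at hrel
    obtain ⟨k1, k2, k3⟩ := coeff (a := α * a + 2 * β) (b := α * (b + r) + γ)
      (c := α * s - 2 * β) (by rw [← hrel]; module)
    have k4 : α * (s + a) = 0 := by linear_combination k1 + k3
    rw [mul_eq_zero, or_iff_left (fun h ↦ hne (eq_neg_of_add_eq_zero_left h))] at k4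
    subst k4
    simp only [zero_mul, zero_add, mul_eq_zero, two, false_or] at k1 k2
    exact ⟨rfl, k1, k2⟩
  subst hbd hcr has
  refine ⟨r / 2, a / 2, d, ?_⟩
  rw [← sub_eq_zero]
  refine eq_zero_of_forall_mem hfaith hW fun w hw ↦ ?_
  obtain ⟨a', b', c', rfl⟩ := (hmW w).1 hw
  simp only [lie_add, lie_smul, sub_lie, add_lie, smul_lie, h1, h2, h3, ev, ep, eq, hv, hhp, hhq,
    ← hp, ← hq, fq]
  module

end IsSl2Triple

end Sl2Modules

/-! ### Transfer from the dual module to the module -/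

section Sl2Modules

open LieModule Module

variable {K L N : Type*} [Field K] [CharZero K] [LieRing L] [LieAlgebra K L]
  [AddCommGroup N] [Module K N] [LieRingModule L N] [LieModule K L N] [FiniteDimensional K N]

namespace IsSl2Triple

variable {h e f : L} {t : IsSl2Triple h e f}

/-- The action of `e` on `N` is, up to sign, the transpose of its action on the dual. It therefore
also has rank one and square zero, and any nonzero vector in its image is primitive of weight one.
-/
lemma GeneratesOne.exists_of_dual {v : Dual K N} (hv : t.GeneratesOne K v) :
    ∃ w : N, t.GeneratesOne K w := by
  obtain ⟨P, he⟩ := hv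
  have h0 : ∀ m, v m = 0 → ⁅e, m⁆ = 0 := by
    intro m hm
    rw [← forall_dual_apply_eq_zero_iff K]
    intro F
    obtain ⟨a, ha⟩ := he F
    have := congrArg (fun G : Dual K N ↦ G m) ha
    simpa [Module.Dual.lie_apply, hm] using this
  obtain ⟨u, hu⟩ : ∃ u, v u ≠ 0 := by
    by_contra! hcon
    exact P.ne_zero (LinearMap.ext hcon)
  have hem : ∀ m, ⁅e, m⁆ = (v m / v u) • ⁅e, u⁆ := by
    intro m
    have := h0 (m - (v m / v u) • u) (by simp [hu])
    rwa [lie_sub, lie_smul, sub_eq_zero] at this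
  have hee : toEnd K L N e ^ (1 + 1) = 0 := by
    ext m
    rw [← sub_eq_zero, ← forall_dual_apply_eq_zero_iff K]
    intro F
    obtain ⟨a, ha⟩ := he F
    have h2 : ⁅e, ⁅e, F⁆⁆ = 0 := by rw [ha, lie_smul, P.lie_e, smul_zero]
    have := congrArg (fun G : Dual K N ↦ G m) h2
    simpa [Module.Dual.lie_apply, pow_two] using this
  have hne : (toEnd K L N e ^ 1) u ≠ 0 := by
    intro hcon
    have hcon' : ⁅e, u⁆ = 0 := by simpa using hcon
    refine P.ne_zero ?_
    rw [← P.lie_e_lie_f']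
    ext m
    rw [Module.Dual.lie_apply, hem, hcon']
    simp
  have Q := t.hasPrimitiveVectorWith_of_pow_succ_eq_zero hee hne
  simp only [pow_one, toEnd_apply_apply, Nat.cast_one] at Q
  exact ⟨_, Q, fun m ↦ ⟨_, hem m⟩⟩

/-- By transposition `e` has rank at most two on `N`, with `e ^ 3 = 0`, and `e ^ 2 ≠ 0` because `e e
f f v = 4 v` in the dual. A vector `w` in the image of `e ^ 2` is primitive of weight two, and the
independent vectors `w`, `f w` of the image of `e` fill it by dimension. -/
lemma GeneratesTwo.exists_of_dual {v : Dual K N} (hv : t.GeneratesTwo K v) :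
    ∃ w : N, t.GeneratesTwo K w := by
  obtain ⟨P, he⟩ := hv
  have hrank : finrank K (toEnd K L N e).range ≤ 2 := by
    rw [← LinearMap.finrank_range_dualMap_eq_finrank_range]
    have hle : (toEnd K L N e).dualMap.range ≤ Submodule.span K {v, ⁅f, v⁆} := by
      rintro _ ⟨F, rfl⟩
      obtain ⟨a, b, hab⟩ := he F
      rw [Submodule.mem_span_pair]
      refine ⟨-a, -b, ?_⟩
      have : (toEnd K L N e).dualMap F = -⁅e, F⁆ := by
        ext m
        simp [Module.Dual.lie_apply, LinearMap.dualMap_apply]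
      rw [this, hab]
      module
    refine (Submodule.finrank_mono hle).trans ?_
    classical
    have := finrank_span_finset_le_card (R := K) ({v, ⁅f, v⁆} : Finset (Dual K N))
    simp only [Finset.coe_insert, Finset.coe_singleton] at this
    exact this.trans Finset.card_le_two
  have heee : toEnd K L N e ^ (2 + 1) = 0 := by
    ext m
    rw [← sub_eq_zero, ← forall_dual_apply_eq_zero_iff K]
    intro F
    obtain ⟨a, b, ha⟩ := he F
    have h2 : ⁅e, ⁅e, ⁅e, F⁆⁆⁆ = 0 := by
      simp [ha, P.lie_e, P.lie_e_lie_f]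
    have := congrArg (fun G : Dual K N ↦ G m) h2
    simpa [Module.Dual.lie_apply, pow_succ] using this
  obtain ⟨u, hu⟩ : ∃ u, (toEnd K L N e ^ 2) u ≠ 0 := by
    by_contra! hcon
    have h4 : ⁅e, ⁅e, ⁅f, ⁅f, v⁆⁆⁆⁆ = (4 : K) • v := by
      rw [P.lie_e_lie_f_lie_f_two, lie_smul, P.lie_e_lie_f]; module
    have h5 : (4 : K) • v = 0 := by
      rw [← h4]
      ext m
      have := hcon m
      simp only [pow_two, Module.End.mul_apply, toEnd_apply_apply] at this
      simp [Module.Dual.lie_apply, this]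
    rw [smul_eq_zero_iff_left P.ne_zero] at h5
    norm_num at h5
  have Q := t.hasPrimitiveVectorWith_of_pow_succ_eq_zero heee hu
  simp only [pow_two, Module.End.mul_apply, toEnd_apply_apply, Nat.cast_ofNat] at Q
  refine ⟨_, Q, fun m ↦ ?_⟩
  set w := ⁅e, ⁅e, u⁆⁆
  have hle : Submodule.span K (Set.range ![w, ⁅f, w⁆]) ≤ (toEnd K L N e).range := by
    rw [Submodule.span_le]
    rintro _ ⟨i, rfl⟩
    fin_cases i
    · exact ⟨⁅e, u⁆, rfl⟩
    · refine ⟨(2⁻¹ : K) • ⁅f, ⁅f, w⁆⁆, ?_⟩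
      simp [Q.lie_e_lie_f_lie_f_two]
  have hLI : LinearIndependent K ![w, ⁅f, w⁆] :=
    linearIndependent_pair_of_lie_eq_smul Q.ne_zero Q.lie_f_ne_zero' Q.lie_h Q.lie_h_lie_f
      (by norm_num)
  have heq := Submodule.eq_of_le_of_finrank_le hle
    (by rw [finrank_span_eq_card hLI]; simpa using hrank)
  have hm : ⁅e, m⁆ ∈ (toEnd K L N e).range := ⟨m, rfl⟩
  rw [← heq, Matrix.range_cons, Matrix.range_cons, Matrix.range_empty, Set.union_empty,
    Set.singleton_union, Submodule.mem_span_pair] at hm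
  obtain ⟨a, b, hab⟩ := hm
  exact ⟨a, b, hab.symm⟩

end IsSl2Triple

/-- A semisimple Lie algebra acting faithfully on `N` whose orbits in `Dual K N` have dimension at
most two is spanned by an `sl₂` triple and acts on `N` as on the sum of a trivial module and a
simple module of dimension two or three. -/
theorem exists_isSl2Triple_generates [IsAlgClosed K] [FiniteDimensional K L] [Nontrivial L]
    [LieAlgebra.IsKilling K L] (hfaith : ∀ x : L, (∀ m : N, ⁅x, m⁆ = 0) → x = 0)
    (H : HasOrbitsOfRankLETwo K L (Dual K N)) :
    ∃ (h e f : L) (t : IsSl2Triple h e f), (∀ x, ∃ a b c : K, x = a • e + b • h + c • f) ∧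
      ((∃ w : N, t.GeneratesOne K w) ∨ (∃ w : N, t.GeneratesTwo K w)) := by
  obtain ⟨h, e, f, t⟩ := LieAlgebra.IsKilling.exists_isSl2Triple K L
  have hfaith' : ∀ x : L, (∀ F : Dual K N, ⁅x, F⁆ = 0) → x = 0 := by
    refine fun x hx ↦ hfaith x fun m ↦ ?_
    rw [← forall_dual_apply_eq_zero_iff K]
    intro F
    have := congrArg (fun G : Dual K N ↦ G m) (hx F)
    simpa [Module.Dual.lie_apply] using this
  have he : ∃ F : Dual K N, ⁅e, F⁆ ≠ 0 := by
    by_contra! hcon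
    exact t.e_ne_zero (hfaith' _ hcon)
  refine ⟨h, e, f, t, ?_⟩
  rcases t.exists_generates H he with ⟨v, hv⟩ | ⟨v, hv⟩
  · exact ⟨IsSl2Triple.exists_coeff_of_generatesOne H hfaith' hv, Or.inl hv.exists_of_dual⟩
  · exact ⟨IsSl2Triple.exists_coeff_of_generatesTwo H hfaith' hv, Or.inr hv.exists_of_dual⟩

end Sl2Modules

/-! ### Gram determinants and the target structure of the radical -/

section RankBound

open LieModule Module

variable {K G : Type*} [Field K] [LieRing G] [LieAlgebra K G]

/-- All `6 × 6` Gram determinants of the forms `(x, y) ↦ F ⁅x, y⁆` on `G` vanish. -/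
def HasVanishingGramDet (K G : Type*) [Field K] [LieRing G] [LieAlgebra K G] : Prop :=
  ∀ (F : Dual K G) (a : Fin 6 → G), (Matrix.of fun i j ↦ F ⁅a i, a j⁆).det = 0

/-- The form in which Gram determinants are refuted: a vanishing determinant gives a nonzero
combination `X` of the six elements orthogonal to all of them. -/
lemma HasVanishingGramDet.false_of_forall (hG : HasVanishingGramDet K G) (F : Dual K G)
    (x₀ x₁ x₂ x₃ x₄ x₅ : G)
    (h : ∀ c₀ c₁ c₂ c₃ c₄ c₅ : K, ∀ X : G,
      X = c₀ • x₀ + c₁ • x₁ + c₂ • x₂ + c₃ • x₃ + c₄ • x₄ + c₅ • x₅ →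
      F ⁅X, x₀⁆ = 0 → F ⁅X, x₁⁆ = 0 → F ⁅X, x₂⁆ = 0 → F ⁅X, x₃⁆ = 0 → F ⁅X, x₄⁆ = 0 →
      F ⁅X, x₅⁆ = 0 → c₀ = 0 ∧ c₁ = 0 ∧ c₂ = 0 ∧ c₃ = 0 ∧ c₄ = 0 ∧ c₅ = 0) : False := by
  obtain ⟨c, hc, hc'⟩ := Matrix.exists_vecMul_eq_zero_iff.2 (hG F ![x₀, x₁, x₂, x₃, x₄, x₅])
  have key : ∀ j, F ⁅c 0 • x₀ + c 1 • x₁ + c 2 • x₂ + c 3 • x₃ + c 4 • x₄ + c 5 • x₅,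
      ![x₀, x₁, x₂, x₃, x₄, x₅] j⁆ = 0 := by
    intro j
    have := congrFun hc' j
    simpa [Matrix.vecMul, dotProduct, Fin.sum_univ_six] using this
  obtain ⟨h0, h1, h2, h3, h4, h5⟩ :=
    h _ _ _ _ _ _ _ rfl (key 0) (key 1) (key 2) (key 3) (key 4) (key 5)
  apply hc
  ext i
  fin_cases i <;> assumption

lemma exists_dual_forall_eq {V ι : Type*} [AddCommGroup V] [Module K V] [Fintype ι]
    {v : ι → V} (hv : LinearIndependent K v) (y : ι → K) :
    ∃ F : Dual K V, ∀ i, F (v i) = y i := by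
  classical
  obtain ⟨g, hg⟩ := (Fintype.linearCombination K v).exists_leftInverse_of_injective
    (LinearMap.ker_eq_bot.2 hv.fintypeLinearCombination_injective)
  refine ⟨(Fintype.linearCombination K y).comp g, fun i ↦ ?_⟩
  have h1 := LinearMap.congr_fun hg (Pi.single i 1)
  simp only [LinearMap.comp_apply, Fintype.linearCombination_apply_single, one_smul,
    LinearMap.id_apply] at h1
  rw [LinearMap.comp_apply, h1, Fintype.linearCombination_apply_single, one_smul]

lemma exists_forall_apply_eq {V ι : Type*} [AddCommGroup V] [Module K V] [FiniteDimensional K V]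
    [Fintype ι] {F : ι → Dual K V} (hF : LinearIndependent K F) (y : ι → K) :
    ∃ v : V, ∀ i, F i v = y i := by
  obtain ⟨φ, hφ⟩ := exists_dual_forall_eq hF y
  refine ⟨(evalEquiv K V).symm φ, fun i ↦ ?_⟩
  rw [← hφ i, apply_evalEquiv_symm_apply]

variable {S : LieSubalgebra K G} {R : LieIdeal K G}

lemma exists_dual_of_isCompl (hc : IsCompl S.toSubmodule R.toSubmodule) (φ : Dual K S)
    (ψ : Dual K R) :
    ∃ F : Dual K G, (∀ x : S, F x = φ x) ∧ ∀ n : R, F n = ψ n :=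
  ⟨LinearMap.ofIsCompl hc φ ψ, fun x ↦ LinearMap.ofIsCompl_apply_left hc x,
    fun n ↦ LinearMap.ofIsCompl_apply_right hc n⟩

/-- Extend `m` by zero on `S`, and choose `p`, `q`, `r` in `R` dual to three independent orbit
vectors. The Gram matrix of `x`, `y`, `z`, `p`, `q`, `r` has a zero upper left block and identity
off-diagonal blocks up to sign, so it is invertible whatever the last block is. -/
lemma HasVanishingGramDet.hasOrbitsOfRankLETwo [FiniteDimensional K G]
    (hG : HasVanishingGramDet K G) (hc : IsCompl S.toSubmodule R.toSubmodule) :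
    HasOrbitsOfRankLETwo K S (Dual K R) := by
  intro m x y z hLI
  obtain ⟨F, hF1, hF2⟩ := exists_dual_of_isCompl hc 0 m
  have hFS : ∀ a b : S, F ⁅(a : G), (b : G)⁆ = 0 := fun a b ↦ hF1 ⁅a, b⁆
  have hFR : ∀ (a : S) (n : R), F ⁅(n : G), (a : G)⁆ = ⁅a, m⁆ n := fun a n ↦ by
    rw [Module.Dual.lie_apply, ← lie_skew, map_neg]
    congr 1
    exact hF2 ⁅a, n⁆
  have hFR' : ∀ (a : S) (n : R), F ⁅(a : G), (n : G)⁆ = -⁅a, m⁆ n := fun a n ↦ by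
    rw [← hFR, ← lie_skew, map_neg]
  obtain ⟨p, hp⟩ := exists_forall_apply_eq hLI ![1, 0, 0]
  obtain ⟨q, hq⟩ := exists_forall_apply_eq hLI ![0, 1, 0]
  obtain ⟨r, hr⟩ := exists_forall_apply_eq hLI ![0, 0, 1]
  have p0 := hp 0; have p1 := hp 1; have p2 := hp 2
  have q0 := hq 0; have q1 := hq 1; have q2 := hq 2
  have r0 := hr 0; have r1 := hr 1; have r2 := hr 2
  simp only [Matrix.cons_val_zero, Matrix.cons_val_one, Matrix.cons_val]
    at p0 p1 p2 q0 q1 q2 r0 r1 r2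
  refine hG.false_of_forall F x y z p q r ?_
  rintro c₀ c₁ c₂ c₃ c₄ c₅ X rfl h0 h1 h2 h3 h4 h5
  simp only [add_lie, smul_lie, map_add, map_smul, hFS, hFR, p0, p1, p2, q0, q1, q2,
    r0, r1, r2, smul_eq_mul, mul_one, mul_zero, add_zero, zero_add] at h0 h1 h2
  subst h0 h1 h2
  simp only [add_lie, smul_lie, map_add, map_smul, hFR', p0, p1, p2, q0, q1, q2,
    r0, r1, r2, smul_eq_mul, mul_neg, mul_one, mul_zero, add_zero, zero_add, neg_zero, zero_mul,
    neg_eq_zero] at h3 h4 h5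
  exact ⟨h3, h4, h5, rfl, rfl, rfl⟩

/-- The elements of `R` centralised by `S`. -/
def fixedPart (S : LieSubalgebra K G) (R : LieIdeal K G) : Submodule K G where
  carrier := {n | n ∈ R ∧ ∀ x ∈ S, ⁅x, n⁆ = 0}
  add_mem' := fun {a b} ha hb ↦ ⟨add_mem ha.1 hb.1, fun x hx ↦ by
    rw [lie_add, ha.2 x hx, hb.2 x hx, add_zero]⟩
  zero_mem' := ⟨zero_mem _, fun _ _ ↦ lie_zero _⟩
  smul_mem' := fun c a ha ↦ ⟨R.smul_mem c ha.1, fun x hx ↦ by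
    rw [lie_smul, ha.2 x hx, smul_zero]⟩

lemma mem_fixedPart {n : G} : n ∈ fixedPart S R ↔ n ∈ R ∧ ∀ x ∈ S, ⁅x, n⁆ = 0 := Iff.rfl

/-- The span of the brackets `⁅x, n⁆` with `x ∈ P` and `n ∈ Q`. -/
def bracketSpan (P Q : Submodule K G) : Submodule K G :=
  Submodule.span K {y | ∃ x ∈ P, ∃ n ∈ Q, ⁅x, n⁆ = y}

lemma lie_mem_bracketSpan {P Q : Submodule K G} {x n : G} (hx : x ∈ P) (hn : n ∈ Q) :
    ⁅x, n⁆ ∈ bracketSpan P Q := Submodule.subset_span ⟨x, hx, n, hn, rfl⟩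

lemma bracketSpan_le {P Q T : Submodule K G} :
    bracketSpan P Q ≤ T ↔ ∀ x ∈ P, ∀ n ∈ Q, ⁅x, n⁆ ∈ T := by
  rw [bracketSpan, Submodule.span_le]
  constructor
  · exact fun h x hx n hn ↦ h ⟨x, hx, n, hn, rfl⟩
  · rintro h _ ⟨x, hx, n, hn, rfl⟩
    exact h x hx n hn

/-- The part `⁅S, R⁆` of `R`. -/
abbrev movedPart (S : LieSubalgebra K G) (R : LieIdeal K G) : Submodule K G :=
  bracketSpan S.toSubmodule R.toSubmodule

/-- The structure of the radical forced by the vanishing of the Gram determinants. -/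
structure IsNearlySplit (S : LieSubalgebra K G) (R : LieIdeal K G) : Prop where
  le_sup : R.toSubmodule ≤ fixedPart S R ⊔ movedPart S R
  disjoint : Disjoint (fixedPart S R) (movedPart S R)
  lie_eq_zero : ∀ n ∈ fixedPart S R, ∀ w ∈ movedPart S R, ⁅n, w⁆ = 0
  bracketSpan_le_fixedPart : bracketSpan (movedPart S R) (movedPart S R) ≤ fixedPart S R
  -- This makes the second of the two complementary ideals nonzero.
  not_le : ¬ R.toSubmodule ≤ movedPart S R ⊔ bracketSpan (movedPart S R) (movedPart S R)
  -- Either alternative yields a complement of the bracket span in `fixedPart` that is a subalgebra.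
  abelian_or : (∀ a ∈ fixedPart S R, ∀ b ∈ fixedPart S R, ⁅a, b⁆ = 0) ∨
    bracketSpan (movedPart S R) (movedPart S R) = ⊥

end RankBound

/-! ### The radical when the nontrivial simple summand has dimension two -/

section RankBound

open LieModule Module

variable {K G : Type*} [Field K] [CharZero K] [LieRing G] [LieAlgebra K G] [FiniteDimensional K G]

/-- In the adjoint module `e` is primitive of weight two, with `[f, e] = -h` and `[f, [f, e]] = -2
f`; thus `e`, `h`, `f` are independent. -/
lemma IsSl2Triple.exists_dual_apply {L : Type*} [LieRing L] [LieAlgebra K L] [FiniteDimensional K L]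
    {h e f : L} (t : IsSl2Triple h e f) : ∃ φ : Dual K L, φ e = 0 ∧ φ h = 0 ∧ φ f = 1 := by
  have P : HasPrimitiveVectorWith t e (2 : K) := ⟨t.e_ne_zero, t.lie_h_e_smul K, lie_self e⟩
  have h1 : ⁅f, e⁆ = -h := by rw [← lie_skew, t.lie_e_f]
  have h2 : ⁅f, ⁅f, e⁆⁆ = (-2 : K) • f := by
    rw [h1, lie_neg, ← lie_skew, t.lie_lie_smul_f K]; module
  have hLI : LinearIndependent K ![e, h, f] := by
    rw [Fintype.linearIndependent_iff]
    intro g hg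
    simp only [Fin.sum_univ_three, Matrix.cons_val_zero, Matrix.cons_val_one, Matrix.cons_val] at hg
    obtain ⟨k0, k1, k2⟩ := P.coeff_eq_zero_two (a := g 0) (b := -g 1) (c := -(g 2) / 2) (by
      rw [h2, h1, ← hg]; module)
    intro i
    fin_cases i
    · exact k0
    · simpa using k1
    · simpa using k2
  obtain ⟨φ, hφ⟩ := exists_dual_forall_eq hLI ![0, 0, 1]
  exact ⟨φ, hφ 0, hφ 1, hφ 2⟩

variable {S : LieSubalgebra K G} {R : LieIdeal K G} {h e f : S} {t : IsSl2Triple h e f}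

lemma mem_fixedPart_of_kills (hspan : ∀ x : S, ∃ a b c : K, x = a • e + b • h + c • f)
    {n : R} (hn : IsSl2Triple.Kills h e f n) : (n : G) ∈ fixedPart S R := by
  refine ⟨n.2, fun x hx ↦ ?_⟩
  obtain ⟨a, b, c, habc⟩ := hspan ⟨x, hx⟩
  have : ⁅(⟨x, hx⟩ : S), n⁆ = 0 := by
    rw [habc, add_lie, add_lie, smul_lie, smul_lie, smul_lie, hn.1, hn.2.1, hn.2.2]
    simp
  exact congrArg Subtype.val this

/-- Here `movedPart` is the plane spanned by `v` and `p = f v`, and `[v, p]` is fixed by `S` since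
the exterior square of the plane is trivial. A fixed element commutes with `S`, so it acts on the
plane by a scalar. A nonzero scalar, and likewise a nonzero bracket of two fixed elements, is
excluded by an explicit invertible Gram matrix. The plane and `[v, p]` span at most three
dimensions, fewer than those of `R`. -/
theorem HasVanishingGramDet.isNearlySplit_of_generatesOne (hG : HasVanishingGramDet K G)
    (hc : IsCompl S.toSubmodule R.toSubmodule) (hdim : 6 ≤ finrank K R)
    (hspan : ∀ x : S, ∃ a b c : K, x = a • e + b • h + c • f)
    {w : R} (hw : t.GeneratesOne K w) : IsNearlySplit S R := by
  obtain ⟨P, he⟩ := hw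
  set w' : R := ⁅f, w⁆ with hw'
  set v := (w : G) with hvdef
  set p := (w' : G) with hpdef
  have ev : ⁅(e : G), v⁆ = 0 := congrArg Subtype.val P.lie_e
  have hv : ⁅(h : G), v⁆ = v := congrArg Subtype.val P.lie_h'
  have fv : ⁅(f : G), v⁆ = p := rfl
  have ep : ⁅(e : G), p⁆ = v := congrArg Subtype.val P.lie_e_lie_f'
  have hhp : ⁅(h : G), p⁆ = -p := congrArg Subtype.val P.lie_h_lie_f_one
  have fp : ⁅(f : G), p⁆ = 0 := congrArg Subtype.val P.lie_f_lie_f_eq_zero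
  have ve : ⁅v, (e : G)⁆ = 0 := by rw [← lie_skew, ev, neg_zero]
  have vh : ⁅v, (h : G)⁆ = -v := by rw [← lie_skew, hv]
  have vf : ⁅v, (f : G)⁆ = -p := by rw [← lie_skew, fv]
  have pe : ⁅p, (e : G)⁆ = -v := by rw [← lie_skew, ep]
  have ph : ⁅p, (h : G)⁆ = p := by rw [← lie_skew, hhp, neg_neg]
  have pf : ⁅p, (f : G)⁆ = 0 := by rw [← lie_skew, fp, neg_zero]
  have hhe : ⁅(h : G), (e : G)⁆ = (2 : K) • (e : G) := congrArg Subtype.val (t.lie_h_e_smul K)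
  have heh : ⁅(e : G), (h : G)⁆ = -(2 : K) • (e : G) := by rw [← lie_skew, hhe, neg_smul]
  have hhf : ⁅(h : G), (f : G)⁆ = -((2 : K) • (f : G)) :=
    congrArg Subtype.val (t.lie_lie_smul_f K)
  have hfh : ⁅(f : G), (h : G)⁆ = (2 : K) • (f : G) := by rw [← lie_skew, hhf, neg_neg]
  have hef : ⁅(e : G), (f : G)⁆ = (h : G) := congrArg Subtype.val t.lie_e_f
  have hfe : ⁅(f : G), (e : G)⁆ = -(h : G) := by rw [← lie_skew, hef]
  have v0 : v ≠ 0 := fun hcon ↦ P.ne_zero (Subtype.ext hcon)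
  have p0 : p ≠ 0 := fun hcon ↦ P.lie_f_ne_zero (Subtype.ext hcon)
  have vR : v ∈ R := w.2
  have pR : p ∈ R := w'.2
  have coeff : ∀ {a b : K}, a • v + b • p = 0 → a = 0 ∧ b = 0 := fun {a b} hab ↦
    P.coeff_eq_zero_one (Subtype.ext hab)
  have decomp : ∀ n ∈ R, ∃ n₀ ∈ fixedPart S R, ∃ a b : K, n = n₀ + (a • v + b • p) := by
    intro n hn
    obtain ⟨m₀, a, b, hm, hab⟩ := P.exists_decomp_one he ⟨n, hn⟩
    exact ⟨m₀, mem_fixedPart_of_kills hspan hm, a, b, congrArg Subtype.val hab⟩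
  have hS : ∀ x ∈ S, ∃ a b c : K, x = a • (e : G) + b • (h : G) + c • (f : G) := by
    intro x hx
    obtain ⟨a, b, c, habc⟩ := hspan ⟨x, hx⟩
    exact ⟨a, b, c, congrArg Subtype.val habc⟩
  have killed : ∀ {n : G}, n ∈ R → ⁅(e : G), n⁆ = 0 → ⁅(h : G), n⁆ = 0 → ⁅(f : G), n⁆ = 0 →
      n ∈ fixedPart S R := by
    intro n hn h1 h2 h3
    refine ⟨hn, fun x hx ↦ ?_⟩
    obtain ⟨a, b, c, rfl⟩ := hS x hx
    simp [h1, h2, h3]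
  have hmoved : ∀ x, x ∈ movedPart S R ↔ ∃ a b : K, a • v + b • p = x := by
    intro x
    rw [← Submodule.mem_span_pair]
    refine ⟨fun hx ↦ ?_, fun hx ↦ ?_⟩
    · refine bracketSpan_le.2 ?_ hx
      intro y hy n hn
      obtain ⟨a, b, c, rfl⟩ := hS y hy
      obtain ⟨n₀, hn₀, a', b', rfl⟩ := decomp n hn
      rw [Submodule.mem_span_pair]
      refine ⟨a * b' + b * a', -b * b' + c * a', ?_⟩
      rw [lie_add, hn₀.2 _ hy]
      simp only [add_lie, smul_lie, lie_add, lie_smul, ev, hv, fv, ep, hhp, fp]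
      module
    · refine (Submodule.span_le.2 ?_ : Submodule.span K {v, p} ≤ movedPart S R) hx
      rintro _ (rfl | rfl)
      · exact ep ▸ lie_mem_bracketSpan e.2 pR
      · exact fv ▸ lie_mem_bracketSpan f.2 vR
  -- `S` acts trivially on `⁅v, p⁆`
  have hz : ⁅v, p⁆ ∈ fixedPart S R := by
    refine killed (lie_mem_right K G R v p pR) ?_ ?_ ?_
    · rw [leibniz_lie, ev, ep, lie_self, zero_lie, add_zero]
    · rw [leibniz_lie, hv, hhp, lie_neg, add_neg_cancel]
    · rw [leibniz_lie, fv, fp, lie_self, lie_zero, add_zero]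
  have hbr : ∀ x, x ∈ bracketSpan (movedPart S R) (movedPart S R) → ∃ c : K, c • ⁅v, p⁆ = x := by
    intro x hx
    rw [← Submodule.mem_span_singleton]
    refine bracketSpan_le.2 ?_ hx
    intro y hy n hn
    obtain ⟨a, b, rfl⟩ := (hmoved y).1 hy
    obtain ⟨a', b', rfl⟩ := (hmoved n).1 hn
    rw [Submodule.mem_span_singleton]
    refine ⟨a * b' - b * a', ?_⟩
    simp only [add_lie, smul_lie, lie_add, lie_smul, lie_self]
    rw [← lie_skew v p]
    module
  obtain ⟨φ, φe, φh, φf⟩ := t.exists_dual_apply (K := K)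
  have hLI : LinearIndependent K ![w, w'] :=
    LinearIndependent.pair_iff.2 fun a b hab ↦ P.coeff_eq_zero_one hab
  -- `fixedPart` acts trivially on `movedPart`
  have hchi : ∀ a ∈ fixedPart S R, ⁅a, v⁆ = 0 ∧ ⁅a, p⁆ = 0 := by
    intro a ha
    have ea := ha.2 e e.2
    have haa := ha.2 h h.2
    have fa := ha.2 f f.2
    obtain ⟨y₀, hy₀, α, β, hy⟩ := decomp ⁅a, v⁆ (lie_mem_right K G R a v vR)
    have k1 : ⁅(h : G), ⁅a, v⁆⁆ = ⁅a, v⁆ := by rw [leibniz_lie, haa, hv, zero_lie, zero_add]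
    have k2 : ⁅(e : G), ⁅a, v⁆⁆ = 0 := by rw [leibniz_lie, ea, ev, zero_lie, lie_zero, add_zero]
    rw [hy, lie_add, hy₀.2 _ h.2, zero_add, lie_add, lie_smul, lie_smul, hv, hhp, ← hy] at k1
    have k3 : β = 0 := by
      have := k2
      rw [← k1, lie_add, lie_smul, lie_smul, lie_neg, ev, ep] at this
      simpa [v0] using this
    subst k3
    have av : ⁅a, v⁆ = α • v := by rw [← k1]; module
    have af : ⁅a, (f : G)⁆ = 0 := by rw [← lie_skew, fa, neg_zero]
    have ap : ⁅a, p⁆ = α • p := by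
      rw [← fv, leibniz_lie, af, zero_lie, zero_add, av, lie_smul]
    by_cases hα : α = 0
    · subst hα
      exact ⟨by rw [av, zero_smul], by rw [ap, zero_smul]⟩
    exfalso
    set x := α⁻¹ • a with hx
    have xv : ⁅x, v⁆ = v := by rw [hx, smul_lie, av, smul_smul, inv_mul_cancel₀ hα, one_smul]
    have xp : ⁅x, p⁆ = p := by rw [hx, smul_lie, ap, smul_smul, inv_mul_cancel₀ hα, one_smul]
    have vx : ⁅v, x⁆ = -v := by rw [← lie_skew, xv]
    have px : ⁅p, x⁆ = -p := by rw [← lie_skew, xp]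
    have ex : ⁅(e : G), x⁆ = 0 := by rw [hx, lie_smul, ea, smul_zero]
    have hhx : ⁅(h : G), x⁆ = 0 := by rw [hx, lie_smul, haa, smul_zero]
    have fx : ⁅(f : G), x⁆ = 0 := by rw [hx, lie_smul, fa, smul_zero]
    have xe : ⁅x, (e : G)⁆ = 0 := by rw [← lie_skew, ex, neg_zero]
    have xh : ⁅x, (h : G)⁆ = 0 := by rw [← lie_skew, hhx, neg_zero]
    have xf : ⁅x, (f : G)⁆ = 0 := by rw [← lie_skew, fx, neg_zero]
    -- With `F f = F v = 1` and `F` zero on `e`, `h`, `p`, the main pairings are `h` with `f`, `e`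
    -- with `p`, and `v` with `x`.
    obtain ⟨ψ, hψ⟩ := exists_dual_forall_eq hLI ![1, 0]
    obtain ⟨F, hF1, hF2⟩ := exists_dual_of_isCompl hc φ ψ
    have Fe : F e = 0 := by rw [hF1, φe]
    have Fh : F h = 0 := by rw [hF1, φh]
    have Ff : F f = 1 := by rw [hF1, φf]
    have Fv : F v = 1 := (hF2 w).trans (hψ 0)
    have Fp : F p = 0 := (hF2 w').trans (hψ 1)
    refine hG.false_of_forall F h e f v p x ?_
    rintro c₀ c₁ c₂ c₃ c₄ c₅ X rfl h0 h1 h2 h3 h4 h5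
    simp only [add_lie, smul_lie, map_add, map_smul, map_neg, lie_self, map_zero, smul_eq_mul,
      mul_zero, add_zero, zero_add, mul_one, mul_neg, neg_zero, neg_smul,
      ev, hv, fv, ep, hhp, fp, ve, vh, vf, pe, ph, pf, hhe, heh, hhf, hfh, hef, hfe,
      xv, xp, vx, px, ex, hhx, fx, xe, xh, xf, Fe, Fh, Ff, Fv, Fp] at h0 h1 h2 h3 h4 h5
    -- The value of `F` on `[v, p]` is not controlled. The columns of `f`, `x`, `e` avoid it and
    -- give three zeros, including the coefficients of `v` and `p`, after which it drops out.
    have q0 : c₀ = 0 := by linear_combination (-1 / 2) * h2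
    have q3 : c₃ = 0 := by linear_combination (-1) * h5
    have q4 : c₄ = 0 := by linear_combination (-1) * h1
    subst q0 q3 q4
    refine ⟨rfl, ?_, ?_, rfl, rfl, ?_⟩
    · linear_combination h4
    · linear_combination (1 / 2) * h0
    · linear_combination h3
  have hfix : ∀ a ∈ fixedPart S R, ∀ b ∈ fixedPart S R, ⁅a, b⁆ ∈ fixedPart S R := by
    intro a ha b hb
    refine ⟨lie_mem_right K G R a b hb.1, fun x hx ↦ ?_⟩
    rw [leibniz_lie, ha.2 x hx, hb.2 x hx, zero_lie, lie_zero, add_zero]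
  refine ⟨?_, ?_, ?_, ?_, ?_, Or.inl ?_⟩
  · intro n hn
    obtain ⟨n₀, hn₀, a, b, rfl⟩ := decomp n hn
    exact Submodule.add_mem_sup hn₀ ((hmoved _).2 ⟨a, b, rfl⟩)
  · rw [Submodule.disjoint_def]
    intro x hx hx'
    obtain ⟨a, b, rfl⟩ := (hmoved x).1 hx'
    have k1 := hx.2 e e.2
    have k2 := hx.2 f f.2
    rw [lie_add, lie_smul, lie_smul, ev, ep, smul_zero, zero_add,
      smul_eq_zero_iff_left v0] at k1
    rw [lie_add, lie_smul, lie_smul, fv, fp, smul_zero, add_zero,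
      smul_eq_zero_iff_left p0] at k2
    simp [k1, k2]
  · intro n hn y hy
    obtain ⟨a, b, rfl⟩ := (hmoved y).1 hy
    rw [lie_add, lie_smul, lie_smul, (hchi n hn).1, (hchi n hn).2]
    simp
  · intro x hx
    obtain ⟨c, rfl⟩ := hbr x hx
    exact (fixedPart S R).smul_mem c hz
  · intro hle
    classical
    have h1 : R.toSubmodule ≤ Submodule.span K (({v, p, ⁅v, p⁆} : Finset G) : Set G) := by
      intro n hn
      obtain ⟨y, hy, z, hz, rfl⟩ := Submodule.mem_sup.1 (hle hn)
      obtain ⟨a, b, rfl⟩ := (hmoved y).1 hy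
      obtain ⟨c, rfl⟩ := hbr z hz
      simp only [Finset.coe_insert, Finset.coe_singleton]
      exact Submodule.mem_span_triple.2 ⟨a, b, c, rfl⟩
    have h2 := (Submodule.finrank_mono h1).trans (finrank_span_finset_le_card _)
    have h3 : ({v, p, ⁅v, p⁆} : Finset G).card ≤ 3 := Finset.card_le_three
    have h4 : finrank K R.toSubmodule = finrank K R := rfl
    omega
  · intro a ha b hb
    by_contra hab
    have hcc := hfix a ha b hb
    set c := ⁅a, b⁆ with hcdef
    have hLI3 : LinearIndependent K ![w, w', (⟨c, hcc.1⟩ : R)] := by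
      rw [Fintype.linearIndependent_iff]
      intro g hg
      simp only [Fin.sum_univ_three, Matrix.cons_val_zero, Matrix.cons_val_one,
        Matrix.cons_val] at hg
      have hg' : g 0 • v + g 1 • p + g 2 • c = 0 := congrArg Subtype.val hg
      have k1 := congrArg (fun x ↦ ⁅(e : G), x⁆) hg'
      have k2 := congrArg (fun x ↦ ⁅(f : G), x⁆) hg'
      simp only [lie_add, lie_smul, ev, ep, fv, fp, hcc.2 e e.2, hcc.2 f f.2, lie_zero,
        smul_zero, zero_add, add_zero, smul_eq_zero_iff_left v0, smul_eq_zero_iff_left p0] at k1 k2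
      rw [k1, k2, zero_smul, zero_smul, zero_add, zero_add, smul_eq_zero_iff_left hab] at hg'
      intro i
      fin_cases i
      · exact k2
      · exact k1
      · exact hg'
    -- With `F v = F c = 1` the pairings are `h` with `v`, `e` with `p`, and `a` with `b`.
    -- Independence of `v`, `p`, `c` holds because `c` is fixed by `S`.
    obtain ⟨ψ, hψ⟩ := exists_dual_forall_eq hLI3 ![1, 0, 1]
    obtain ⟨F, hF1, hF2⟩ := exists_dual_of_isCompl hc 0 ψ
    have Fe : F e = 0 := hF1 e
    have Fv : F v = 1 := (hF2 w).trans (hψ 0)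
    have Fp : F p = 0 := (hF2 w').trans (hψ 1)
    have Fc : F c = 1 := (hF2 ⟨c, hcc.1⟩).trans (hψ 2)
    have comm : ∀ y ∈ fixedPart S R, ⁅(h : G), y⁆ = 0 ∧ ⁅(e : G), y⁆ = 0 ∧ ⁅y, (h : G)⁆ = 0 ∧
        ⁅y, (e : G)⁆ = 0 ∧ ⁅y, v⁆ = 0 ∧ ⁅y, p⁆ = 0 ∧ ⁅v, y⁆ = 0 ∧ ⁅p, y⁆ = 0 := by
      intro y hy
      have k1 := hy.2 h h.2
      have k2 := hy.2 e e.2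
      have k3 := hchi y hy
      refine ⟨k1, k2, ?_, ?_, k3.1, k3.2, ?_, ?_⟩
      · rw [← lie_skew, k1, neg_zero]
      · rw [← lie_skew, k2, neg_zero]
      · rw [← lie_skew, k3.1, neg_zero]
      · rw [← lie_skew, k3.2, neg_zero]
    obtain ⟨a1, a2, a3, a4, a5, a6, a7, a8⟩ := comm a ha
    obtain ⟨b1, b2, b3, b4, b5, b6, b7, b8⟩ := comm b hb
    have hba : ⁅b, a⁆ = -c := by rw [← lie_skew]
    refine hG.false_of_forall F h e v p a b ?_
    rintro c₀ c₁ c₂ c₃ c₄ c₅ X rfl h0 h1 h2 h3 h4 h5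
    simp only [add_lie, smul_lie, map_add, map_smul, map_neg, lie_self, map_zero, smul_eq_mul,
      mul_zero, add_zero, zero_add, mul_one, mul_neg, neg_zero, neg_smul,
      ev, hv, ep, hhp, ve, vh, pe, ph, hhe, heh, a1, a2, a3, a4, a5, a6, a7, a8,
      b1, b2, b3, b4, b5, b6, b7, b8, hba, ← hcdef, Fe, Fv, Fp, Fc] at h0 h1 h2 h3 h4 h5
    have q2 : c₂ = 0 := by linear_combination (-1) * h0
    have q3 : c₃ = 0 := by linear_combination (-1) * h1
    subst q2 q3
    refine ⟨?_, ?_, rfl, rfl, ?_, ?_⟩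
    · linear_combination h2
    · linear_combination h3
    · linear_combination h5
    · linear_combination (-1) * h4

end RankBound

/-! ### The radical when the nontrivial simple summand has dimension three -/

section RankBound

open LieModule Module

variable {K G : Type*} [Field K] [CharZero K] [LieRing G] [LieAlgebra K G] [FiniteDimensional K G]
  {S : LieSubalgebra K G} {R : LieIdeal K G} {h e f : S} {t : IsSl2Triple h e f}

/-- The bracket `[v, p]` has weight two and is killed by `e`, so it is `α v`; applying `f` gives
`[v, q] = α p` and `[p, q] = α q`. If `α ≠ 0` then `v`, `p`, `q` survive in every derived ideal of
`R`, against solvability. So `movedPart` is commutative, and only the scalar action of fixed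
elements has to be excluded by a Gram determinant. -/
theorem HasVanishingGramDet.isNearlySplit_of_generatesTwo (hG : HasVanishingGramDet K G)
    (hc : IsCompl S.toSubmodule R.toSubmodule) (hdim : 6 ≤ finrank K R)
    (hsolv : ∃ k, LieAlgebra.derivedSeriesOfIdeal K G k R = ⊥)
    (hspan : ∀ x : S, ∃ a b c : K, x = a • e + b • h + c • f)
    {w : R} (hw : t.GeneratesTwo K w) : IsNearlySplit S R := by
  obtain ⟨P, he⟩ := hw
  set w' : R := ⁅f, w⁆ with hw'
  set w'' : R := ⁅f, w'⁆ with hw''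
  set v := (w : G) with hvdef
  set p := (w' : G) with hpdef
  set q := (w'' : G) with hqdef
  have ev : ⁅(e : G), v⁆ = 0 := congrArg Subtype.val P.lie_e
  have hv : ⁅(h : G), v⁆ = (2 : K) • v := congrArg Subtype.val P.lie_h
  have fv : ⁅(f : G), v⁆ = p := rfl
  have ep : ⁅(e : G), p⁆ = (2 : K) • v := congrArg Subtype.val P.lie_e_lie_f
  have hhp : ⁅(h : G), p⁆ = 0 := congrArg Subtype.val P.lie_h_lie_f_two
  have fp : ⁅(f : G), p⁆ = q := rfl
  have eq : ⁅(e : G), q⁆ = (2 : K) • p := congrArg Subtype.val P.lie_e_lie_f_lie_f_two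
  have hhq : ⁅(h : G), q⁆ = (-2 : K) • q := congrArg Subtype.val P.lie_h_lie_f_lie_f_two
  have fq : ⁅(f : G), q⁆ = 0 := congrArg Subtype.val P.lie_f_lie_f_lie_f_eq_zero
  have ve : ⁅v, (e : G)⁆ = 0 := by rw [← lie_skew, ev, neg_zero]
  have vf : ⁅v, (f : G)⁆ = -p := by rw [← lie_skew, fv]
  have pe : ⁅p, (e : G)⁆ = (-2 : K) • v := by rw [← lie_skew, ep, neg_smul]
  have pf : ⁅p, (f : G)⁆ = -q := by rw [← lie_skew, fp]
  have qe : ⁅q, (e : G)⁆ = (-2 : K) • p := by rw [← lie_skew, eq, neg_smul]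
  have qf : ⁅q, (f : G)⁆ = 0 := by rw [← lie_skew, fq, neg_zero]
  have hef : ⁅(e : G), (f : G)⁆ = (h : G) := congrArg Subtype.val t.lie_e_f
  have hfe : ⁅(f : G), (e : G)⁆ = -(h : G) := by rw [← lie_skew, hef]
  have v0 : v ≠ 0 := fun hcon ↦ P.ne_zero (Subtype.ext hcon)
  have p0 : p ≠ 0 := fun hcon ↦ P.lie_f_ne_zero' (Subtype.ext hcon)
  have vR : v ∈ R := w.2
  have pR : p ∈ R := w'.2
  have qR : q ∈ R := w''.2
  have coeff : ∀ {a b c : K}, a • v + b • p + c • q = 0 → a = 0 ∧ b = 0 ∧ c = 0 :=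
    fun {a b c} habc ↦ P.coeff_eq_zero_two (Subtype.ext habc)
  have decomp : ∀ n ∈ R, ∃ n₀ ∈ fixedPart S R, ∃ a b c : K,
      n = n₀ + (a • v + b • p + c • q) := by
    intro n hn
    obtain ⟨m₀, a, b, c, hm, habc⟩ := P.exists_decomp_two he ⟨n, hn⟩
    exact ⟨m₀, mem_fixedPart_of_kills hspan hm, a, b, c, congrArg Subtype.val habc⟩
  have hS : ∀ x ∈ S, ∃ a b c : K, x = a • (e : G) + b • (h : G) + c • (f : G) := by
    intro x hx
    obtain ⟨a, b, c, habc⟩ := hspan ⟨x, hx⟩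
    exact ⟨a, b, c, congrArg Subtype.val habc⟩
  have hmoved : ∀ x, x ∈ movedPart S R ↔ ∃ a b c : K, a • v + b • p + c • q = x := by
    intro x
    rw [← Submodule.mem_span_triple]
    refine ⟨fun hx ↦ ?_, fun hx ↦ ?_⟩
    · refine bracketSpan_le.2 ?_ hx
      intro y hy n hn
      obtain ⟨a, b, c, rfl⟩ := hS y hy
      obtain ⟨n₀, hn₀, a', b', c', rfl⟩ := decomp n hn
      rw [Submodule.mem_span_triple]
      refine ⟨2 * a * b' + 2 * b * a', 2 * a * c' + c * a', -2 * b * c' + c * b', ?_⟩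
      rw [lie_add, hn₀.2 _ hy]
      simp only [add_lie, smul_lie, lie_add, lie_smul, ev, hv, fv, ep, hhp, fp, eq, hhq, fq]
      module
    · refine (Submodule.span_le.2 ?_ : Submodule.span K {v, p, q} ≤ movedPart S R) hx
      rintro _ (rfl | rfl | rfl)
      · have := (movedPart S R).smul_mem (2⁻¹ : K) (lie_mem_bracketSpan e.2 pR)
        simpa [ep] using this
      · exact fv ▸ lie_mem_bracketSpan f.2 vR
      · exact fp ▸ lie_mem_bracketSpan f.2 pR
  -- an element of `R` of weight two killed by `e` is a multiple of `v`
  have hmul : ∀ y ∈ R, ⁅(h : G), y⁆ = (2 : K) • y → ⁅(e : G), y⁆ = 0 → ∃ α : K, y = α • v := by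
    intro y hyR k1 k2
    obtain ⟨y₀, hy₀, a, b, c, hy⟩ := decomp y hyR
    have k3 : (2 : K) • y = (2 * a) • v - (2 * c) • q := by
      rw [← k1]
      nth_rw 1 [hy]
      rw [lie_add, hy₀.2 _ h.2, lie_add, lie_add, lie_smul, lie_smul, lie_smul, hv, hhp, hhq]
      module
    have k4 := congrArg (fun x ↦ ⁅(e : G), x⁆) k3
    simp only [lie_smul, lie_sub, k2, ev, eq] at k4
    obtain ⟨-, hc0, -⟩ := coeff (a := 0) (b := 4 * c) (c := 0) (by
      have : (0 : K) • v + (4 * c) • p + (0 : K) • q =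
        -((2 * a) • (0 : G) - (2 * c) • (2 : K) • p) := by module
      rw [this, ← k4]; simp)
    obtain rfl : c = 0 := by simpa using hc0
    refine ⟨a, ?_⟩
    have k5 : (2 : K) • (y - a • v) = 0 := by rw [smul_sub, k3]; module
    rwa [smul_eq_zero_iff_right two_ne_zero, sub_eq_zero] at k5
  have hLI : LinearIndependent K ![w, w', w''] := by
    rw [Fintype.linearIndependent_iff]
    intro g hg
    simp only [Fin.sum_univ_three, Matrix.cons_val_zero, Matrix.cons_val_one,
      Matrix.cons_val] at hg
    obtain ⟨k1, k2, k3⟩ := P.coeff_eq_zero_two hg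
    intro i
    fin_cases i <;> assumption
  -- `movedPart` is commutative
  have hcomm : ⁅v, p⁆ = 0 ∧ ⁅v, q⁆ = 0 ∧ ⁅p, q⁆ = 0 := by
    obtain ⟨α, vp⟩ := hmul ⁅v, p⁆ (lie_mem_right K G R v p pR)
      (by rw [leibniz_lie, hv, hhp, lie_zero, smul_lie, add_zero])
      (by rw [leibniz_lie, ev, ep, lie_smul, lie_self, zero_lie, smul_zero, add_zero])
    have vq : ⁅v, q⁆ = α • p := by
      have k := leibniz_lie (f : G) v p
      rw [vp, lie_smul, fv, fp, lie_self, zero_add] at k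
      exact k.symm
    have pq : ⁅p, q⁆ = α • q := by
      have k := leibniz_lie (f : G) v q
      rw [vq, lie_smul, fv, fp, fq, lie_zero, add_zero] at k
      exact k.symm
    by_cases hα : α = 0
    · subst hα
      exact ⟨by rw [vp, zero_smul], by rw [vq, zero_smul], by rw [pq, zero_smul]⟩
    exfalso
    obtain ⟨k, hk⟩ := hsolv
    have hall : ∀ k, v ∈ LieAlgebra.derivedSeriesOfIdeal K G k R ∧
        p ∈ LieAlgebra.derivedSeriesOfIdeal K G k R ∧
        q ∈ LieAlgebra.derivedSeriesOfIdeal K G k R := by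
      intro k
      induction k with
      | zero => exact ⟨vR, pR, qR⟩
      | succ k ih =>
        obtain ⟨h1, h2, h3⟩ := ih
        rw [LieAlgebra.derivedSeriesOfIdeal_succ]
        set D := LieAlgebra.derivedSeriesOfIdeal K G k R
        refine ⟨?_, ?_, ?_⟩
        · have := (⁅D, D⁆ : LieIdeal K G).smul_mem α⁻¹ (LieSubmodule.lie_mem_lie h1 h2)
          rwa [vp, smul_smul, inv_mul_cancel₀ hα, one_smul] at this
        · have := (⁅D, D⁆ : LieIdeal K G).smul_mem α⁻¹ (LieSubmodule.lie_mem_lie h1 h3)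
          rwa [vq, smul_smul, inv_mul_cancel₀ hα, one_smul] at this
        · have := (⁅D, D⁆ : LieIdeal K G).smul_mem α⁻¹ (LieSubmodule.lie_mem_lie h2 h3)
          rwa [pq, smul_smul, inv_mul_cancel₀ hα, one_smul] at this
    have hv0 := (hall k).1
    rw [hk, LieSubmodule.mem_bot] at hv0
    exact v0 hv0
  obtain ⟨vp, vq, pq⟩ := hcomm
  have pv : ⁅p, v⁆ = 0 := by rw [← lie_skew, vp, neg_zero]
  have qv : ⁅q, v⁆ = 0 := by rw [← lie_skew, vq, neg_zero]
  have qp : ⁅q, p⁆ = 0 := by rw [← lie_skew, pq, neg_zero]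
  have hbr : bracketSpan (movedPart S R) (movedPart S R) = ⊥ := by
    rw [eq_bot_iff, bracketSpan_le]
    intro y hy n hn
    obtain ⟨a, b, c, rfl⟩ := (hmoved y).1 hy
    obtain ⟨a', b', c', rfl⟩ := (hmoved n).1 hn
    simp [vp, vq, pq, pv, qv, qp]
  -- `fixedPart` acts trivially on `movedPart`
  have hchi : ∀ a ∈ fixedPart S R, ⁅a, v⁆ = 0 ∧ ⁅a, p⁆ = 0 ∧ ⁅a, q⁆ = 0 := by
    intro a ha
    have ea := ha.2 e e.2
    have haa := ha.2 h h.2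
    have fa := ha.2 f f.2
    have af : ⁅a, (f : G)⁆ = 0 := by rw [← lie_skew, fa, neg_zero]
    obtain ⟨α, av⟩ := hmul ⁅a, v⁆ (lie_mem_right K G R a v vR)
      (by rw [leibniz_lie, haa, hv, zero_lie, zero_add, lie_smul])
      (by rw [leibniz_lie, ea, ev, zero_lie, lie_zero, add_zero])
    have ap : ⁅a, p⁆ = α • p := by
      rw [← fv, leibniz_lie, af, zero_lie, zero_add, av, lie_smul]
    have aq : ⁅a, q⁆ = α • q := by
      rw [← fp, leibniz_lie, af, zero_lie, zero_add, ap, lie_smul]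
    by_cases hα : α = 0
    · subst hα
      exact ⟨by rw [av, zero_smul], by rw [ap, zero_smul], by rw [aq, zero_smul]⟩
    exfalso
    set x := α⁻¹ • a with hx
    have xv : ⁅x, v⁆ = v := by rw [hx, smul_lie, av, smul_smul, inv_mul_cancel₀ hα, one_smul]
    have xp : ⁅x, p⁆ = p := by rw [hx, smul_lie, ap, smul_smul, inv_mul_cancel₀ hα, one_smul]
    have xq : ⁅x, q⁆ = q := by rw [hx, smul_lie, aq, smul_smul, inv_mul_cancel₀ hα, one_smul]
    have vx : ⁅v, x⁆ = -v := by rw [← lie_skew, xv]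
    have px : ⁅p, x⁆ = -p := by rw [← lie_skew, xp]
    have qx : ⁅q, x⁆ = -q := by rw [← lie_skew, xq]
    have ex : ⁅(e : G), x⁆ = 0 := by rw [hx, lie_smul, ea, smul_zero]
    have fx : ⁅(f : G), x⁆ = 0 := by rw [hx, lie_smul, fa, smul_zero]
    have xe : ⁅x, (e : G)⁆ = 0 := by rw [← lie_skew, ex, neg_zero]
    have xf : ⁅x, (f : G)⁆ = 0 := by rw [← lie_skew, fx, neg_zero]
    -- With `F p = 1` and `F` zero on `S`, `v`, `q`, the pairings are `e` with `q`, `f` with `v`,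
    -- and `x` with `p`.
    obtain ⟨ψ, hψ⟩ := exists_dual_forall_eq hLI ![0, 1, 0]
    obtain ⟨F, hF1, hF2⟩ := exists_dual_of_isCompl hc 0 ψ
    have Fh : F h = 0 := hF1 h
    have Fv : F v = 0 := (hF2 w).trans (hψ 0)
    have Fp : F p = 1 := (hF2 w').trans (hψ 1)
    have Fq : F q = 0 := (hF2 w'').trans (hψ 2)
    refine hG.false_of_forall F e f x v p q ?_
    rintro c₀ c₁ c₂ c₃ c₄ c₅ X rfl h0 h1 h2 h3 h4 h5
    simp only [add_lie, smul_lie, map_add, map_smul, map_neg, lie_self, map_zero, smul_eq_mul,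
      mul_zero, add_zero, zero_add, mul_one, mul_neg, neg_zero,
      ev, fv, ep, fp, eq, fq, ve, vf, pe, pf, qe, qf, hef, hfe, vp, vq, pq, pv, qv, qp,
      xv, xp, xq, vx, px, qx, ex, fx, xe, xf, Fh, Fv, Fp, Fq] at h0 h1 h2 h3 h4 h5
    refine ⟨?_, ?_, ?_, ?_, ?_, ?_⟩
    · linear_combination (1 / 2) * h5
    · linear_combination h3
    · linear_combination h4
    · linear_combination (-1) * h1
    · linear_combination (-1) * h2
    · linear_combination (-1 / 2) * h0
  refine ⟨?_, ?_, ?_, ?_, ?_, Or.inr hbr⟩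
  · intro n hn
    obtain ⟨n₀, hn₀, a, b, c, rfl⟩ := decomp n hn
    exact Submodule.add_mem_sup hn₀ ((hmoved _).2 ⟨a, b, c, rfl⟩)
  · rw [Submodule.disjoint_def]
    intro x hx hx'
    obtain ⟨a, b, c, rfl⟩ := (hmoved x).1 hx'
    have k1 := hx.2 e e.2
    have k2 := hx.2 f f.2
    simp only [lie_add, lie_smul, ev, ep, eq, fv, fp, fq] at k1 k2
    obtain ⟨hb, hc, -⟩ := coeff (a := 2 * b) (b := 2 * c) (c := 0) (by rw [← k1]; module)
    obtain ⟨-, ha, -⟩ := coeff (a := 0) (b := a) (c := b) (by rw [← k2]; module)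
    obtain rfl : b = 0 := by simpa using hb
    obtain rfl : c = 0 := by simpa using hc
    simp [ha]
  · intro n hn y hy
    obtain ⟨a, b, c, rfl⟩ := (hmoved y).1 hy
    obtain ⟨k1, k2, k3⟩ := hchi n hn
    simp [k1, k2, k3]
  · rw [hbr]
    exact bot_le
  · rw [hbr, sup_bot_eq]
    intro hle
    classical
    have h1 : R.toSubmodule ≤ Submodule.span K (({v, p, q} : Finset G) : Set G) := by
      intro n hn
      simp only [Finset.coe_insert, Finset.coe_singleton]
      exact Submodule.mem_span_triple.2 ((hmoved n).1 (hle hn))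
    have h2 := (Submodule.finrank_mono h1).trans (finrank_span_finset_le_card _)
    have h3 : ({v, p, q} : Finset G).card ≤ 3 := Finset.card_le_three
    have h4 : finrank K R.toSubmodule = finrank K R := rfl
    omega

/-- If all `6 × 6` Gram determinants of the forms `F ⁅x, y⁆` vanish, then the radical is close to
being split by the Levi factor. -/
theorem HasVanishingGramDet.isNearlySplit [IsAlgClosed K] (hG : HasVanishingGramDet K G)
    (hc : IsCompl S.toSubmodule R.toSubmodule) (hdim : 9 ≤ finrank K G)
    (hsolv : ∃ k, LieAlgebra.derivedSeriesOfIdeal K G k R = ⊥)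
    [LieAlgebra.IsKilling K S] (hS : Nontrivial S)
    (hfaith : ∀ x ∈ S, (∀ n ∈ R, ⁅x, n⁆ = 0) → x = 0) : IsNearlySplit S R := by
  obtain ⟨h, e, f, t, hspan, hgen⟩ := exists_isSl2Triple_generates (K := K) (L := S) (N := R)
    (fun x hx ↦ Subtype.ext (hfaith x x.2 fun n hn ↦ congrArg Subtype.val (hx ⟨n, hn⟩)))
    (hG.hasOrbitsOfRankLETwo hc)
  have hdimS : finrank K S ≤ 3 := by
    classical
    have h1 : (⊤ : Submodule K S) ≤ Submodule.span K (({e, h, f} : Finset S) : Set S) := by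
      intro x _
      obtain ⟨a, b, c, rfl⟩ := hspan x
      simp only [Finset.coe_insert, Finset.coe_singleton]
      exact Submodule.mem_span_triple.2 ⟨a, b, c, rfl⟩
    have h2 := (Submodule.finrank_mono h1).trans (finrank_span_finset_le_card _)
    have h3 : ({e, h, f} : Finset S).card ≤ 3 := Finset.card_le_three
    rw [finrank_top] at h2
    omega
  -- The bound nine on the dimension enters here: a Levi factor of dimension at most three leaves a
  -- radical too large for the moved part and its brackets.
  have hdimR : 6 ≤ finrank K R := by
    have h1 := Submodule.finrank_add_eq_of_isCompl hc
    have h2 : finrank K S.toSubmodule = finrank K S := rfl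
    have h3 : finrank K R.toSubmodule = finrank K R := rfl
    omega
  rcases hgen with ⟨w, hw⟩ | ⟨w, hw⟩
  · exact hG.isNearlySplit_of_generatesOne hc hdimR hspan hw
  · exact hG.isNearlySplit_of_generatesTwo hc hdimR hsolv hspan hw

end RankBound

/-! ### Complexification of the Gram condition -/

section Complexification

open LieModule Module
open scoped TensorProduct

/-- A decomposition of the elements of a field extension `A` of `ℝ` into real and imaginary parts. -/
structure ReImDecomposition (A : Type*) [Field A] [Algebra ℝ A] where
  re : A →ₗ[ℝ] ℝ
  im : A →ₗ[ℝ] ℝ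
  I : A
  I_sq : I ^ 2 = -1
  re_one : re 1 = 1
  im_one : im 1 = 0
  re_I : re I = 0
  im_I : im I = 1
  eq_re_add_im : ∀ z, z = re z • (1 : A) + im z • I

/-- Real and imaginary parts of complex numbers. -/
noncomputable def Complex.reImDecomposition : ReImDecomposition ℂ where
  re := Complex.reLm
  im := Complex.imLm
  I := Complex.I
  I_sq := Complex.I_sq
  re_one := Complex.one_re
  im_one := Complex.one_im
  re_I := Complex.I_re
  im_I := Complex.I_im
  eq_re_add_im z := by simp

namespace ReImDecomposition

attribute [simp] re_one im_one re_I im_I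

variable {A : Type*} [Field A] [Algebra ℝ A] (D : ReImDecomposition A)

section VectorSpace

variable {V : Type*} [AddCommGroup V] [Module ℝ V]

/-- The real part `A ⊗ V → V`. -/
noncomputable def complexificationRe (V : Type*) [AddCommGroup V] [Module ℝ V] :
    A ⊗[ℝ] V →ₗ[ℝ] V :=
  (TensorProduct.lid ℝ V).toLinearMap.comp (D.re.rTensor V)

/-- The imaginary part `A ⊗ V → V`. -/
noncomputable def complexificationIm (V : Type*) [AddCommGroup V] [Module ℝ V] :
    A ⊗[ℝ] V →ₗ[ℝ] V :=
  (TensorProduct.lid ℝ V).toLinearMap.comp (D.im.rTensor V)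

@[simp] lemma complexificationRe_tmul (z : A) (v : V) :
    D.complexificationRe V (z ⊗ₜ v) = D.re z • v := by simp [complexificationRe]

@[simp] lemma complexificationIm_tmul (z : A) (v : V) :
    D.complexificationIm V (z ⊗ₜ v) = D.im z • v := by simp [complexificationIm]

lemma eq_tmul_add_tmul (x : A ⊗[ℝ] V) :
    x = (1 : A) ⊗ₜ D.complexificationRe V x + D.I ⊗ₜ D.complexificationIm V x := by
  induction x using TensorProduct.induction_on with
  | zero => simp
  | tmul z v =>
    rw [complexificationRe_tmul, complexificationIm_tmul, ← TensorProduct.smul_tmul,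
      ← TensorProduct.smul_tmul, ← TensorProduct.add_tmul]
    congr 1
    exact D.eq_re_add_im z
  | add x y hx hy =>
    nth_rw 1 [hx, hy]
    rw [map_add, map_add, TensorProduct.tmul_add, TensorProduct.tmul_add]
    abel

lemma complexification_ext {x : A ⊗[ℝ] V} (h1 : D.complexificationRe V x = 0)
    (h2 : D.complexificationIm V x = 0) : x = 0 := by
  rw [D.eq_tmul_add_tmul x, h1, h2]; simp

lemma mem_baseChange_complex {p : Submodule ℝ V} {x : A ⊗[ℝ] V} :
    x ∈ p.baseChange A ↔ D.complexificationRe V x ∈ p ∧ D.complexificationIm V x ∈ p := by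
  constructor
  · intro hx
    rw [Submodule.baseChange_eq_span] at hx
    induction hx using Submodule.span_induction with
    | mem x hx =>
      obtain ⟨v, hv, rfl⟩ := hx
      simpa using hv
    | zero => simp
    | add x y _ _ hx hy =>
      rw [map_add, map_add]
      exact ⟨p.add_mem hx.1 hy.1, p.add_mem hx.2 hy.2⟩
    | smul c x _ hx =>
      rw [D.eq_tmul_add_tmul x, smul_add, TensorProduct.smul_tmul', TensorProduct.smul_tmul', map_add,
        map_add]
      simp only [complexificationRe_tmul, complexificationIm_tmul]
      exact ⟨p.add_mem (p.smul_mem _ hx.1) (p.smul_mem _ hx.2),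
        p.add_mem (p.smul_mem _ hx.1) (p.smul_mem _ hx.2)⟩
  · rintro ⟨h1, h2⟩
    rw [D.eq_tmul_add_tmul x]
    exact add_mem (Submodule.tmul_mem_baseChange_of_mem _ h1)
      (Submodule.tmul_mem_baseChange_of_mem _ h2)

lemma one_tmul_mem_baseChange (D : ReImDecomposition A) {p : Submodule ℝ V} {v : V} :
    (1 : A) ⊗ₜ v ∈ p.baseChange A ↔ v ∈ p := by
  simp [D.mem_baseChange_complex]

lemma baseChange_complex_le (D : ReImDecomposition A) {p q : Submodule ℝ V} :
    p.baseChange A ≤ q.baseChange A ↔ p ≤ q :=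
  ⟨fun h _ hv ↦ D.one_tmul_mem_baseChange.1 (h (D.one_tmul_mem_baseChange.2 hv)),
    fun h _ hx ↦ D.mem_baseChange_complex.2
      ⟨h (D.mem_baseChange_complex.1 hx).1, h (D.mem_baseChange_complex.1 hx).2⟩⟩

lemma baseChange_complex_sup (D : ReImDecomposition A) (p q : Submodule ℝ V) :
    (p ⊔ q).baseChange A = p.baseChange A ⊔ q.baseChange A := by
  refine le_antisymm (fun x hx ↦ ?_)
    (sup_le (D.baseChange_complex_le.2 le_sup_left) (D.baseChange_complex_le.2 le_sup_right))
  obtain ⟨h1, h2⟩ := D.mem_baseChange_complex.1 hx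
  obtain ⟨a, ha, b, hb, hab⟩ := Submodule.mem_sup.1 h1
  obtain ⟨c, hc, d, hd, hcd⟩ := Submodule.mem_sup.1 h2
  rw [D.eq_tmul_add_tmul x, ← hab, ← hcd, TensorProduct.tmul_add, TensorProduct.tmul_add,
    add_add_add_comm]
  exact Submodule.add_mem_sup
    (add_mem (Submodule.tmul_mem_baseChange_of_mem _ ha)
      (Submodule.tmul_mem_baseChange_of_mem _ hc))
    (add_mem (Submodule.tmul_mem_baseChange_of_mem _ hb)
      (Submodule.tmul_mem_baseChange_of_mem _ hd))

lemma disjoint_baseChange_complex (D : ReImDecomposition A) {p q : Submodule ℝ V} :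
    Disjoint (p.baseChange A) (q.baseChange A) ↔ Disjoint p q := by
  rw [Submodule.disjoint_def, Submodule.disjoint_def]
  constructor
  · intro h x hx hx'
    have := h _ (D.one_tmul_mem_baseChange.2 hx) (D.one_tmul_mem_baseChange.2 hx')
    simpa using congrArg (D.complexificationRe V) this
  · intro h x hx hx'
    rw [D.mem_baseChange_complex] at hx hx'
    exact D.complexification_ext (h _ hx.1 hx'.1) (h _ hx.2 hx'.2)

end VectorSpace

variable {𝔤 : Type*} [LieRing 𝔤] [LieAlgebra ℝ 𝔤]

lemma complexificationRe_lie (y : 𝔤) (x : A ⊗[ℝ] 𝔤) :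
    D.complexificationRe 𝔤 ⁅(1 : A) ⊗ₜ[ℝ] y, x⁆ = ⁅y, D.complexificationRe 𝔤 x⁆ := by
  nth_rw 1 [D.eq_tmul_add_tmul x]
  simp

lemma complexificationIm_lie (y : 𝔤) (x : A ⊗[ℝ] 𝔤) :
    D.complexificationIm 𝔤 ⁅(1 : A) ⊗ₜ[ℝ] y, x⁆ = ⁅y, D.complexificationIm 𝔤 x⁆ := by
  nth_rw 1 [D.eq_tmul_add_tmul x]
  simp

/-- Write `F = F₁ + I F₂` on `𝔤` and `a i = u i + I w i`. Replacing `I` by a real `s` gives a real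
Gram determinant, which vanishes. It is a polynomial in `s`, so it is zero identically and in
particular at `I`. -/
lemma hasVanishingGramDet (D : ReImDecomposition A) (h : HasVanishingGramDet ℝ 𝔤) :
    HasVanishingGramDet A (A ⊗[ℝ] 𝔤) := by
  intro F a
  let ι : 𝔤 →ₗ[ℝ] A ⊗[ℝ] 𝔤 := TensorProduct.mk ℝ A 𝔤 1
  let F₁ : Dual ℝ 𝔤 := D.re.comp ((F.restrictScalars ℝ).comp ι)
  let F₂ : Dual ℝ 𝔤 := D.im.comp ((F.restrictScalars ℝ).comp ι)
  let u : Fin 6 → 𝔤 := fun i ↦ D.complexificationRe 𝔤 (a i)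
  let w : Fin 6 → 𝔤 := fun i ↦ D.complexificationIm 𝔤 (a i)
  have hF : ∀ (z : A) (y : 𝔤), F (z ⊗ₜ y) =
      z * (algebraMap ℝ A (F₁ y) + algebraMap ℝ A (F₂ y) * D.I) := by
    intro z y
    have : z ⊗ₜ[ℝ] y = z • ((1 : A) ⊗ₜ[ℝ] y) := by simp [TensorProduct.smul_tmul']
    rw [this, map_smul, smul_eq_mul]
    congr 1
    rw [Algebra.algebraMap_eq_smul_one, ← Algebra.smul_def]
    exact D.eq_re_add_im _
  let P : Matrix (Fin 6) (Fin 6) (Polynomial ℝ) := Matrix.of fun i j ↦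
    Polynomial.C (F₁ ⁅u i, u j⁆) +
    Polynomial.C (F₂ ⁅u i, u j⁆ + F₁ ⁅u i, w j⁆ + F₁ ⁅w i, u j⁆) * Polynomial.X +
    Polynomial.C (F₂ ⁅u i, w j⁆ + F₂ ⁅w i, u j⁆ + F₁ ⁅w i, w j⁆) * Polynomial.X ^ 2 +
    Polynomial.C (F₂ ⁅w i, w j⁆) * Polynomial.X ^ 3
  have hP : P.det = 0 := by
    refine Polynomial.funext fun s ↦ ?_
    rw [Polynomial.eval_zero, ← Polynomial.coe_evalRingHom, RingHom.map_det]
    rw [← h (F₁ + s • F₂) (fun i ↦ u i + s • w i)]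
    congr 1
    ext i j
    simp only [P, RingHom.mapMatrix_apply, Matrix.map_apply, Matrix.of_apply,
      Polynomial.coe_evalRingHom, Polynomial.eval_add, Polynomial.eval_mul, Polynomial.eval_C,
      Polynomial.eval_X, Polynomial.eval_pow, LinearMap.add_apply, LinearMap.smul_apply, add_lie,
      lie_add, smul_lie, lie_smul, map_add, map_smul, smul_eq_mul]
    ring
  have h2 := congrArg (Polynomial.aeval D.I) hP
  rw [map_zero, AlgHom.map_det] at h2
  refine Eq.trans (congrArg Matrix.det ?_) h2
  ext i j
  have key : F ⁅a i, a j⁆ = F ⁅(1 : A) ⊗ₜ[ℝ] u i + D.I ⊗ₜ[ℝ] w i,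
      (1 : A) ⊗ₜ[ℝ] u j + D.I ⊗ₜ[ℝ] w j⁆ := by
    rw [← D.eq_tmul_add_tmul (a i), ← D.eq_tmul_add_tmul (a j)]
  simp only [add_lie, lie_add, LieAlgebra.ExtendScalars.bracket_tmul, map_add, hF, mul_one,
    one_mul] at key
  simp only [P, AlgHom.mapMatrix_apply, Matrix.map_apply, Matrix.of_apply, map_add, map_mul,
    map_pow, Polynomial.aeval_C, Polynomial.aeval_X, key]
  ring

end ReImDecomposition

end Complexification

/-! ### Descent of the structure of the radical from the complexification -/

section Complexification

open LieModule Module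
open scoped TensorProduct

namespace ReImDecomposition

variable {A : Type*} [Field A] [Algebra ℝ A] (D : ReImDecomposition A)
  {𝔤 : Type*} [LieRing 𝔤] [LieAlgebra ℝ 𝔤]

/-- The base change of a Lie subalgebra. -/
noncomputable def baseChangeHom (A : Type*) [Field A] [Algebra ℝ A] (s : LieSubalgebra ℝ 𝔤) :
    A ⊗[ℝ] s →ₗ⁅A⁆ A ⊗[ℝ] 𝔤 :=
  { s.toSubmodule.subtype.baseChange A with
    map_lie' := by
      intro x y
      simp only [AddHom.toFun_eq_coe, LinearMap.coe_toAddHom]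
      induction x using TensorProduct.induction_on with
      | zero => simp
      | tmul a x =>
        induction y using TensorProduct.induction_on with
        | zero => simp
        | tmul b y => simp
        | add y z hy hz => simp only [lie_add, map_add, hy, hz]
      | add x z hx hz => simp only [add_lie, map_add, hx, hz] }

lemma baseChangeHom_tmul (s : LieSubalgebra ℝ 𝔤) (a : A) (x : s) :
    baseChangeHom A s (a ⊗ₜ x) = a ⊗ₜ (x : 𝔤) := rfl

lemma baseChangeHom_injective (s : LieSubalgebra ℝ 𝔤) :
    Function.Injective (baseChangeHom A s) :=
  Module.Flat.lTensor_preserves_injective_linearMap (M := A) s.toSubmodule.subtype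
    s.toSubmodule.injective_subtype

lemma range_baseChangeHom (s : LieSubalgebra ℝ 𝔤) :
    (baseChangeHom A s).range.toSubmodule = s.toSubmodule.baseChange A := rfl

/-- Paired with real elements, the real and imaginary parts of an element of the Killing radical lie
in the real Killing radical, which is zero. -/
lemma isKilling_tensorProduct (D : ReImDecomposition A) {L : Type*} [LieRing L] [LieAlgebra ℝ L]
    [FiniteDimensional ℝ L] [LieAlgebra.IsKilling ℝ L] : LieAlgebra.IsKilling A (A ⊗[ℝ] L) where
  killingCompl_top_eq_bot := by
    rw [eq_bot_iff]
    intro x hx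
    rw [LieIdeal.mem_killingCompl] at hx
    rw [LieSubmodule.mem_bot]
    have hzero : ∀ y : L, killingForm ℝ L y (D.complexificationRe L x) = 0 ∧
        killingForm ℝ L y (D.complexificationIm L x) = 0 := by
      intro y
      have h1 := hx ((1 : A) ⊗ₜ y) trivial
      rw [D.eq_tmul_add_tmul x, killingForm, LieModule.traceForm_baseChange, map_add,
        LinearMap.BilinForm.baseChange_tmul, LinearMap.BilinForm.baseChange_tmul, mul_one,
        one_mul] at h1
      have h2 := congrArg D.re h1
      have h3 := congrArg D.im h1
      simp only [map_add, map_smul, re_one, re_I, im_one, im_I, smul_eq_mul, mul_one, mul_zero,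
        add_zero, zero_add, map_zero] at h2 h3
      exact ⟨h2, h3⟩
    have hnd : ∀ z : L, (∀ y, killingForm ℝ L y z = 0) → z = 0 := fun z hz ↦ by
      have : z ∈ LieIdeal.killingCompl ℝ L ⊤ := (LieIdeal.mem_killingCompl ℝ L ⊤).2 fun y _ ↦ hz y
      rwa [LieAlgebra.IsKilling.killingCompl_top_eq_bot, LieSubmodule.mem_bot] at this
    exact D.complexification_ext (hnd _ fun y ↦ (hzero y).1) (hnd _ fun y ↦ (hzero y).2)

lemma isKilling_range_baseChangeHom (D : ReImDecomposition A) (s : LieSubalgebra ℝ 𝔤)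
    [FiniteDimensional ℝ s] [LieAlgebra.IsKilling ℝ s] :
    LieAlgebra.IsKilling A (baseChangeHom A s).range :=
  have := D.isKilling_tensorProduct (L := s)
  LieAlgebra.isKilling_of_equiv
    (LieEquiv.ofInjective (baseChangeHom A s) (baseChangeHom_injective s))

lemma bracketSpan_baseChange (D : ReImDecomposition A) (p q : Submodule ℝ 𝔤) :
    bracketSpan (p.baseChange A) (q.baseChange A) = (bracketSpan p q).baseChange A := by
  refine le_antisymm (bracketSpan_le.2 fun x hx y hy ↦ ?_) ?_
  · rw [D.mem_baseChange_complex] at hx hy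
    have key : ⁅x, y⁆ = ⁅(1 : A) ⊗ₜ[ℝ] D.complexificationRe 𝔤 x +
        D.I ⊗ₜ[ℝ] D.complexificationIm 𝔤 x, (1 : A) ⊗ₜ[ℝ] D.complexificationRe 𝔤 y +
        D.I ⊗ₜ[ℝ] D.complexificationIm 𝔤 y⁆ := by
      rw [← D.eq_tmul_add_tmul x, ← D.eq_tmul_add_tmul y]
    rw [key]
    simp only [add_lie, lie_add, LieAlgebra.ExtendScalars.bracket_tmul]
    have hm : ∀ (a : A) (u v : 𝔤), u ∈ p → v ∈ q →
        a ⊗ₜ[ℝ] ⁅u, v⁆ ∈ (bracketSpan p q).baseChange A := fun a u v hu hv ↦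
      Submodule.tmul_mem_baseChange_of_mem _ (lie_mem_bracketSpan hu hv)
    exact add_mem (add_mem (hm _ _ _ hx.1 hy.1) (hm _ _ _ hx.2 hy.1))
      (add_mem (hm _ _ _ hx.1 hy.2) (hm _ _ _ hx.2 hy.2))
  · rw [Submodule.baseChange_eq_span, Submodule.span_le]
    rintro _ ⟨y, hy, rfl⟩
    induction hy using Submodule.span_induction with
    | mem y hy =>
      obtain ⟨u, hu, v, hv, rfl⟩ := hy
      have := lie_mem_bracketSpan (Submodule.tmul_mem_baseChange_of_mem (1 : A) hu)
        (Submodule.tmul_mem_baseChange_of_mem (1 : A) hv)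
      simpa using this
    | zero => simp
    | add u v _ _ hu hv =>
      rw [map_add]
      exact add_mem hu hv
    | smul c u _ hu =>
      rw [map_smul, ← algebraMap_smul A c]
      exact Submodule.smul_mem _ _ hu

lemma fixedPart_baseChange (D : ReImDecomposition A) (s : LieSubalgebra ℝ 𝔤) (r : LieIdeal ℝ 𝔤) :
    fixedPart (baseChangeHom A s).range (r.baseChange A) = (fixedPart s r).baseChange A := by
  ext x
  rw [mem_fixedPart, D.mem_baseChange_complex, mem_fixedPart, mem_fixedPart]
  have hr : x ∈ r.baseChange A ↔ D.complexificationRe 𝔤 x ∈ r ∧ D.complexificationIm 𝔤 x ∈ r :=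
    D.mem_baseChange_complex (p := r.toSubmodule)
  rw [hr]
  constructor
  · rintro ⟨⟨h1, h2⟩, h3⟩
    have h4 : ∀ y ∈ s, ⁅(1 : A) ⊗ₜ[ℝ] y, x⁆ = 0 := fun y hy ↦
      h3 _ ⟨(1 : A) ⊗ₜ (⟨y, hy⟩ : s), rfl⟩
    exact ⟨⟨h1, fun y hy ↦ by rw [← D.complexificationRe_lie, h4 y hy, map_zero]⟩,
      ⟨h2, fun y hy ↦ by rw [← D.complexificationIm_lie, h4 y hy, map_zero]⟩⟩
  · rintro ⟨⟨h1, h3⟩, ⟨h2, h4⟩⟩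
    refine ⟨⟨h1, h2⟩, ?_⟩
    rintro _ ⟨y, rfl⟩
    change ⁅baseChangeHom A s y, x⁆ = 0
    induction y using TensorProduct.induction_on with
    | zero => simp
    | tmul a y =>
      rw [baseChangeHom_tmul]
      have key : ⁅a ⊗ₜ[ℝ] (y : 𝔤), x⁆ = ⁅a ⊗ₜ[ℝ] (y : 𝔤), (1 : A) ⊗ₜ[ℝ] D.complexificationRe 𝔤 x +
        D.I ⊗ₜ[ℝ] D.complexificationIm 𝔤 x⁆ := by rw [← D.eq_tmul_add_tmul x]
      rw [key, lie_add, LieAlgebra.ExtendScalars.bracket_tmul,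
        LieAlgebra.ExtendScalars.bracket_tmul, h3 _ y.2, h4 _ y.2]
      simp
    | add y z hy hz => rw [map_add, add_lie, hy, hz, add_zero]

/-- `fixedPart`, `movedPart` and `bracketSpan` commute with base change, and base change reflects
the inclusions, disjointness and vanishing statements that make up the structure. -/
lemma isNearlySplit_of_baseChange (D : ReImDecomposition A) {s : LieSubalgebra ℝ 𝔤}
    {r : LieIdeal ℝ 𝔤} (h : IsNearlySplit (baseChangeHom A s).range (r.baseChange A)) :
    IsNearlySplit s r := by
  obtain ⟨h1, h2, h3, h4, h5, h6⟩ := h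
  have hmoved : movedPart (baseChangeHom A s).range (r.baseChange A) =
      (movedPart s r).baseChange A := D.bracketSpan_baseChange s.toSubmodule r.toSubmodule
  have hinj : ∀ {y : 𝔤}, (1 : A) ⊗ₜ[ℝ] y = 0 → y = 0 := fun {y} hy ↦ by
    simpa using congrArg (D.complexificationRe 𝔤) hy
  rw [hmoved, D.fixedPart_baseChange] at h1 h2 h3
  rw [hmoved, D.fixedPart_baseChange, D.bracketSpan_baseChange] at h4 h6
  rw [hmoved, D.bracketSpan_baseChange] at h5
  refine ⟨?_, D.disjoint_baseChange_complex.1 h2, ?_, (D.baseChange_complex_le).1 h4, ?_, ?_⟩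
  · rw [← D.baseChange_complex_sup] at h1
    exact D.baseChange_complex_le.1 h1
  · intro n hn w hw
    have := h3 _ (D.one_tmul_mem_baseChange.2 hn) _ (D.one_tmul_mem_baseChange.2 hw)
    rw [LieAlgebra.ExtendScalars.bracket_tmul, mul_one] at this
    exact hinj this
  · intro hle
    apply h5
    rw [← D.baseChange_complex_sup]
    exact D.baseChange_complex_le.2 hle
  · refine h6.imp (fun h a ha b hb ↦ ?_) (fun h ↦ ?_)
    · have := h _ (D.one_tmul_mem_baseChange.2 ha) _ (D.one_tmul_mem_baseChange.2 hb)
      rw [LieAlgebra.ExtendScalars.bracket_tmul, mul_one] at this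
      exact hinj this
    · rw [eq_bot_iff] at h ⊢
      rw [← Submodule.baseChange_bot (A := A), D.baseChange_complex_le] at h
      exact h

end ReImDecomposition

open ReImDecomposition in
/-- The structure of the radical of a real Lie algebra all of whose coadjoint orbits are small. -/
theorem HasVanishingGramDet.isNearlySplit_real {𝔤 : Type*} [LieRing 𝔤] [LieAlgebra ℝ 𝔤]
    [FiniteDimensional ℝ 𝔤] (hG : HasVanishingGramDet ℝ 𝔤) {s : LieSubalgebra ℝ 𝔤}
    {r : LieIdeal ℝ 𝔤} (hc : IsCompl s.toSubmodule r.toSubmodule) (hdim : 9 ≤ finrank ℝ 𝔤)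
    (hsolv : ∃ k, LieAlgebra.derivedSeriesOfIdeal ℝ 𝔤 k r = ⊥)
    [LieAlgebra.IsKilling ℝ s] (hs : s ≠ ⊥)
    (hfaith : ∀ x ∈ s, (∀ n ∈ r, ⁅x, n⁆ = 0) → x = 0) : IsNearlySplit s r := by
  have D : ReImDecomposition ℂ := Complex.reImDecomposition
  have : LieAlgebra.IsKilling ℂ (baseChangeHom ℂ s).range := D.isKilling_range_baseChangeHom s
  refine D.isNearlySplit_of_baseChange ((D.hasVanishingGramDet hG).isNearlySplit ?_ ?_ ?_ ?_ ?_)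
  · rw [range_baseChangeHom, LieSubmodule.coe_baseChange]
    refine ⟨D.disjoint_baseChange_complex.2 hc.disjoint, ?_⟩
    rw [codisjoint_iff, ← D.baseChange_complex_sup, hc.sup_eq_top, Submodule.baseChange_top]
  · rwa [Module.finrank_baseChange]
  · obtain ⟨k, hk⟩ := hsolv
    exact ⟨k, by rw [LieAlgebra.derivedSeriesOfIdeal_baseChange, hk, LieSubmodule.baseChange_bot]⟩
  · obtain ⟨x, hx, hx0⟩ : ∃ x ∈ s, x ≠ 0 := by
      by_contra! hcon
      exact hs (LieSubalgebra.eq_bot_iff _ |>.2 hcon)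
    refine ⟨⟨⟨baseChangeHom ℂ s ((1 : ℂ) ⊗ₜ (⟨x, hx⟩ : s)), _, rfl⟩, 0, fun h0 ↦ hx0 ?_⟩⟩
    have h1 := congrArg Subtype.val h0
    simpa [baseChangeHom_tmul] using congrArg (D.complexificationRe 𝔤) h1
  · intro x hx hxn
    have hx' : x ∈ s.toSubmodule.baseChange ℂ := by
      rw [← range_baseChangeHom]; exact hx
    rw [D.mem_baseChange_complex] at hx'
    have hn : ∀ n ∈ r, ⁅(1 : ℂ) ⊗ₜ[ℝ] n, x⁆ = 0 := fun n hn ↦ by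
      rw [← lie_skew, hxn _ (LieSubmodule.tmul_mem_baseChange_of_mem 1 hn), neg_zero]
    refine D.complexification_ext (hfaith _ hx'.1 fun n hnr ↦ ?_) (hfaith _ hx'.2 fun n hnr ↦ ?_)
    · rw [← lie_skew, ← D.complexificationRe_lie, hn n hnr, map_zero, neg_zero]
    · rw [← lie_skew, ← D.complexificationIm_lie, hn n hnr, map_zero, neg_zero]

end Complexification

/-! ### Consequences of indecomposability -/

section Indecomposable

open LieModule Module

variable {𝔤 : Type*} [LieRing 𝔤] [LieAlgebra ℝ 𝔤]

/-- Commuting complementary subalgebras are automatically ideals. -/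
lemma IsIndecomposableLie.eq_bot_or_eq_bot (h : IsIndecomposableLie 𝔤) {P Q : Submodule ℝ 𝔤}
    (hPP : ∀ x ∈ P, ∀ y ∈ P, ⁅x, y⁆ ∈ P) (hQQ : ∀ x ∈ Q, ∀ y ∈ Q, ⁅x, y⁆ ∈ Q)
    (hPQ : ∀ x ∈ P, ∀ y ∈ Q, ⁅x, y⁆ = 0) (hc : IsCompl P Q) : P = ⊥ ∨ Q = ⊥ := by
  have hsum : ∀ x : 𝔤, ∃ p ∈ P, ∃ q ∈ Q, p + q = x := fun x ↦
    Submodule.mem_sup.1 (by rw [hc.sup_eq_top]; trivial)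
  let I : LieIdeal ℝ 𝔤 := { P with
    lie_mem := by
      intro x y hy
      obtain ⟨p, hp, q, hq, rfl⟩ := hsum x
      rw [add_lie, ← lie_skew q y, hPQ y hy q hq, neg_zero, add_zero]
      exact hPP p hp y hy }
  let J : LieIdeal ℝ 𝔤 := { Q with
    lie_mem := by
      intro x y hy
      obtain ⟨p, hp, q, hq, rfl⟩ := hsum x
      rw [add_lie, hPQ p hp y hy, zero_add]
      exact hQQ q hq y hy }
  have hIJ : IsCompl I J := by
    rw [← LieSubmodule.isCompl_toSubmodule]
    exact hc
  refine (h.2 I J hIJ).imp (fun h ↦ ?_) (fun h ↦ ?_)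
  · rw [← LieSubmodule.toSubmodule_eq_bot] at h
    exact h
  · rw [← LieSubmodule.toSubmodule_eq_bot] at h
    exact h

/-- A Levi factor of an indecomposable Lie algebra acts faithfully on the radical. -/
lemma IsIndecomposableLie.eq_zero_of_forall_lie_eq_zero [FiniteDimensional ℝ 𝔤]
    (h : IsIndecomposableLie 𝔤)
    {s : LieSubalgebra ℝ 𝔤} [LieAlgebra.IsKilling ℝ s] {r : LieIdeal ℝ 𝔤} (hr : r ≠ ⊥)
    (hc : IsCompl s.toSubmodule r.toSubmodule) (x : 𝔤) (hx : x ∈ s)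
    (hxr : ∀ n ∈ r, ⁅x, n⁆ = 0) : x = 0 := by
  -- With `k'` the Killing complement of the kernel `k`, the subspaces `k` and `k' + r` are
  -- commuting complementary subalgebras. As `r ≠ 0`, indecomposability forces `k = 0`.
  let k : LieIdeal ℝ s := LieModule.ker ℝ s r
  have hk : ∀ y : s, y ∈ k ↔ ∀ n ∈ r, ⁅(y : 𝔤), n⁆ = 0 := fun y ↦ by
    rw [LieModule.mem_ker]
    refine ⟨fun hy n hn ↦ congrArg Subtype.val (hy ⟨n, hn⟩), fun hy n ↦ Subtype.ext (hy n n.2)⟩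
  let k' : LieIdeal ℝ s := LieIdeal.killingCompl ℝ s k
  have hkk : IsCompl k k' := LieIdeal.isCompl_killingCompl k
  have hkk' := (LieSubmodule.isCompl_toSubmodule (N := k) (N' := k')).2 hkk
  set P : Submodule ℝ 𝔤 := k.toSubmodule.map s.toSubmodule.subtype with hP
  set P' : Submodule ℝ 𝔤 := k'.toSubmodule.map s.toSubmodule.subtype with hP'
  have hPs : P ⊔ P' = s.toSubmodule := by
    rw [hP, hP', ← Submodule.map_sup, hkk'.sup_eq_top, Submodule.map_subtype_top]
  have h0 : P = ⊥ ∨ P' ⊔ r.toSubmodule = ⊥ := by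
    refine h.eq_bot_or_eq_bot ?_ ?_ ?_ ⟨?_, ?_⟩
    · rintro _ ⟨(a : s), -, rfl⟩ _ ⟨(b : s), hb, rfl⟩
      exact ⟨⁅a, b⁆, k.lie_mem hb, rfl⟩
    · intro u hu v hv
      obtain ⟨_, ⟨(a : s), ha, rfl⟩, n, hn, rfl⟩ := Submodule.mem_sup.1 hu
      obtain ⟨_, ⟨(b : s), hb, rfl⟩, n', hn', rfl⟩ := Submodule.mem_sup.1 hv
      rw [add_lie, lie_add, add_assoc]
      refine add_mem (Submodule.mem_sup_left ⟨⁅a, b⁆, k'.lie_mem hb, rfl⟩)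
        (Submodule.mem_sup_right (add_mem (r.lie_mem hn') (lie_mem_left ℝ 𝔤 r _ _ hn)))
    · rintro _ ⟨(a : s), ha, rfl⟩ v hv
      obtain ⟨_, ⟨(b : s), hb, rfl⟩, n, hn, rfl⟩ := Submodule.mem_sup.1 hv
      have hab : ⁅a, b⁆ = 0 := by
        have h1 : ⁅a, b⁆ ∈ k := lie_mem_left ℝ s k _ _ ha
        have h2 : ⁅a, b⁆ ∈ k' := k'.lie_mem hb
        exact Submodule.disjoint_def.1 hkk'.disjoint _ h1 h2
      rw [lie_add]
      have h3 : ⁅(a : 𝔤), n⁆ = 0 := (hk a).1 ha n hn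
      have h4 : ⁅(a : 𝔤), (b : 𝔤)⁆ = 0 := congrArg Subtype.val hab
      change ⁅(a : 𝔤), (b : 𝔤)⁆ + ⁅(a : 𝔤), n⁆ = 0
      rw [h3, h4, add_zero]
    · rw [Submodule.disjoint_def]
      rintro _ ⟨a, ha, rfl⟩ hv
      obtain ⟨_, ⟨(b : s), hb, rfl⟩, n, hn, hab⟩ := Submodule.mem_sup.1 hv
      change (b : 𝔤) + n = a at hab
      have hn0 : n = 0 := by
        refine Submodule.disjoint_def.1 hc.disjoint n ?_ hn
        rw [← eq_sub_iff_add_eq'] at hab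
        rw [hab]
        exact sub_mem a.2 b.2
      rw [hn0, add_zero] at hab
      have hab' : b = a := Subtype.ext hab
      have : a = 0 := Submodule.disjoint_def.1 hkk'.disjoint _ ha (hab' ▸ hb)
      rw [this, map_zero]
    · rw [codisjoint_iff, ← sup_assoc, hPs, hc.sup_eq_top]
  rcases h0 with h0 | h0
  · have : x ∈ P := ⟨⟨x, hx⟩, (hk ⟨x, hx⟩).2 hxr, rfl⟩
    rwa [h0] at this
  · refine absurd ?_ hr
    rw [← LieSubmodule.toSubmodule_eq_bot]
    exact (sup_eq_bot_iff.1 h0).2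

/-- With `C` a complement of `Z = [W, W]` in the fixed part, `s + W + Z` and `C` are commuting
complementary subalgebras. Since `s ≠ 0`, `C` is zero, and then `r` lies in `W + Z`, which is
excluded. -/
lemma IsIndecomposableLie.not_isNearlySplit (h : IsIndecomposableLie 𝔤) {s : LieSubalgebra ℝ 𝔤}
    {r : LieIdeal ℝ 𝔤} (hs : s ≠ ⊥) (hc : IsCompl s.toSubmodule r.toSubmodule) :
    ¬ IsNearlySplit s r := by
  rintro ⟨h1, h2, h3, h4, h5, h6⟩
  set r₀ := fixedPart s r with hr₀
  set W := movedPart s r with hW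
  set Z := bracketSpan W W with hZ
  have hr₀r : r₀ ≤ r.toSubmodule := fun n hn ↦ hn.1
  have hWr : W ≤ r.toSubmodule := bracketSpan_le.2 fun x _ n hn ↦ r.lie_mem hn
  obtain ⟨C, hCr, hZC, hd, hCC, hZC0⟩ : ∃ C ≤ r₀, Z ⊔ C = r₀ ∧ Disjoint Z C ∧
      (∀ x ∈ C, ∀ y ∈ C, ⁅x, y⁆ ∈ C) ∧ ∀ x ∈ Z, ∀ y ∈ r₀, ⁅x, y⁆ = 0 := by
    -- If the fixed part is abelian, any linear complement of `Z` in it is a subalgebra; if `Z = 0`,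
    -- the whole fixed part serves.
    rcases h6 with h6 | h6
    · obtain ⟨C', hC'⟩ := exists_isCompl Z
      refine ⟨C' ⊓ r₀, inf_le_right, ?_, hC'.disjoint.mono_right inf_le_left, ?_, ?_⟩
      · rw [← sup_inf_assoc_of_le _ h4, hC'.sup_eq_top, top_inf_eq]
      · intro x hx y hy
        rw [h6 x hx.2 y hy.2]
        exact zero_mem _
      · exact fun x hx y hy ↦ h6 x (h4 hx) y hy
    · refine ⟨r₀, le_rfl, by rw [h6, bot_sup_eq], by rw [h6]; exact disjoint_bot_left, ?_, ?_⟩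
      · refine fun x hx y hy ↦ ⟨r.lie_mem hy.1, fun a ha ↦ ?_⟩
        rw [leibniz_lie, hx.2 a ha, hy.2 a ha, zero_lie, lie_zero, add_zero]
      · intro x hx y _
        rw [h6, Submodule.mem_bot] at hx
        rw [hx, zero_lie]
  have hZr : Z ≤ r.toSubmodule := h4.trans hr₀r
  have key : s.toSubmodule ⊔ (W ⊔ Z) = ⊥ ∨ C = ⊥ := by
    have decomp : ∀ x ∈ s.toSubmodule ⊔ (W ⊔ Z), ∃ a ∈ s, ∃ w ∈ W, ∃ z ∈ Z, x = a + w + z := by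
      intro x hx
      obtain ⟨a, ha, y, hy, rfl⟩ := Submodule.mem_sup.1 hx
      obtain ⟨w, hw, z, hz, rfl⟩ := Submodule.mem_sup.1 hy
      exact ⟨a, ha, w, hw, z, hz, (add_assoc _ _ _).symm⟩
    refine h.eq_bot_or_eq_bot ?_ hCC ?_ ⟨?_, ?_⟩
    · intro x hx y hy
      obtain ⟨a, ha, w, hw, z, hz, rfl⟩ := decomp x hx
      obtain ⟨a', ha', w', hw', z', hz', rfl⟩ := decomp y hy
      have e1 : ⁅a, z'⁆ = 0 := (h4 hz').2 a ha
      have e2 : ⁅z, a'⁆ = 0 := by rw [← lie_skew, (h4 hz).2 a' ha', neg_zero]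
      have e3 : ⁅z, w'⁆ = 0 := h3 z (h4 hz) w' hw'
      have e4 : ⁅w, z'⁆ = 0 := by rw [← lie_skew, h3 z' (h4 hz') w hw, neg_zero]
      have e5 : ⁅z, z'⁆ = 0 := hZC0 z hz z' (h4 hz')
      have e6 : ⁅w, a'⁆ ∈ W := by
        rw [← lie_skew]
        exact neg_mem (lie_mem_bracketSpan ha' (hWr hw))
      simp only [add_lie, lie_add, e1, e2, e3, e4, e5, add_zero]
      have m1 : ⁅a, a'⁆ ∈ s.toSubmodule := s.lie_mem ha ha'
      have m2 : ⁅a, w'⁆ ∈ W := lie_mem_bracketSpan ha (hWr hw')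
      have m3 : ⁅w, w'⁆ ∈ Z := lie_mem_bracketSpan hw hw'
      have i1 : s.toSubmodule ≤ s.toSubmodule ⊔ (W ⊔ Z) := le_sup_left
      have i2 : W ≤ s.toSubmodule ⊔ (W ⊔ Z) := le_sup_left.trans le_sup_right
      have i3 : Z ≤ s.toSubmodule ⊔ (W ⊔ Z) := le_sup_right.trans le_sup_right
      exact add_mem (add_mem (i1 m1) (i2 e6)) (add_mem (i2 m2) (i3 m3))
    · intro x hx c hcC
      obtain ⟨a, ha, w, hw, z, hz, rfl⟩ := decomp x hx
      rw [add_lie, add_lie, (hCr hcC).2 a ha, ← lie_skew w c, h3 c (hCr hcC) w hw,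
        hZC0 z hz c (hCr hcC), neg_zero, add_zero, add_zero]
    · rw [Submodule.disjoint_def]
      intro x hx hxC
      obtain ⟨a, ha, w, hw, z, hz, rfl⟩ := decomp x hx
      have ha0 : a = 0 := by
        refine Submodule.disjoint_def.1 hc.disjoint a ha ?_
        have : a = (a + w + z) - w - z := by abel
        rw [this]
        exact sub_mem (sub_mem (hr₀r (hCr hxC)) (hWr hw)) (hZr hz)
      rw [ha0, zero_add] at hxC ⊢
      have hw0 : w = 0 := by
        refine Submodule.disjoint_def.1 h2 w ?_ hw
        have : w = (w + z) - z := by abel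
        rw [this]
        exact sub_mem (hCr hxC) (h4 hz)
      rw [hw0, zero_add] at hxC ⊢
      exact Submodule.disjoint_def.1 hd z hz hxC
    · rw [codisjoint_iff, sup_assoc, sup_assoc, hZC, sup_comm W, eq_top_iff, ← hc.sup_eq_top]
      exact sup_le_sup_left h1 _
  rcases key with key | key
  · refine hs ?_
    rw [← LieSubalgebra.toSubmodule_inj, (sup_eq_bot_iff.1 key).1]
    rfl
  · rw [key, sup_bot_eq] at hZC
    exact h5 (by rw [hZC, sup_comm]; exact h1)

/-- The coadjoint orbits of an indecomposable Lie algebra of dimension at least nine with a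
nontrivial Levi decomposition have generic dimension at least six. -/
theorem IsIndecomposableLie.not_hasVanishingGramDet [FiniteDimensional ℝ 𝔤]
    (h : IsIndecomposableLie 𝔤) (hlevi : HasNontrivialLeviDecomposition 𝔤)
    (hdim : 9 ≤ finrank ℝ 𝔤) : ¬ HasVanishingGramDet ℝ 𝔤 := by
  intro hG
  obtain ⟨s, hss, hc, hs, hr⟩ := hlevi
  have : LieAlgebra.IsKilling ℝ s := inferInstance
  have hsolv : ∃ k, LieAlgebra.derivedSeriesOfIdeal ℝ 𝔤 k (LieAlgebra.radical ℝ 𝔤) = ⊥ := by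
    obtain ⟨k, hk⟩ := (LieAlgebra.isSolvable_iff ℝ (LieAlgebra.radical ℝ 𝔤)).1 inferInstance
    exact ⟨k, (LieIdeal.derivedSeries_eq_bot_iff _ _).1 hk⟩
  exact h.not_isNearlySplit hs hc (hG.isNearlySplit_real hc hdim hsolv hs
    (h.eq_zero_of_forall_lie_eq_zero hr hc))

end Indecomposable

/-! ### Products of one-parameter groups -/

section OrbitMaps

open Module

section BanachAlgebra

variable {𝔸 : Type*} [NormedRing 𝔸] [NormedAlgebra ℝ 𝔸] [CompleteSpace 𝔸]

lemma exp_mul_exp_neg (A : 𝔸) : NormedSpace.exp A * NormedSpace.exp (-A) = 1 := by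
  let _ := NormedAlgebra.restrictScalars ℚ ℝ 𝔸
  rw [← NormedSpace.exp_add_of_commute (Commute.neg_right rfl), add_neg_cancel,
    NormedSpace.exp_zero]

/-- Conjugation by `exp A` is the exponential of the commutator with `A`. -/
lemma exp_mul_mul_exp_neg (A B : 𝔸) : NormedSpace.exp A * B * NormedSpace.exp (-A) =
    NormedSpace.exp (ContinuousLinearMap.mul ℝ 𝔸 A - (ContinuousLinearMap.mul ℝ 𝔸).flip A) B := by
  set D : 𝔸 →L[ℝ] 𝔸 := ContinuousLinearMap.mul ℝ 𝔸 A - (ContinuousLinearMap.mul ℝ 𝔸).flip A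
  have hD : ∀ C, D C = A * C - C * A := fun C ↦ rfl
  -- Undoing the flow of `D` on the conjugate of `B` gives a constant curve; its values at `0` and
  -- `1` are then compared.
  have hconst : ∀ s : ℝ, HasDerivAt (fun u : ℝ ↦ NormedSpace.exp (u • (-D))
      (NormedSpace.exp (u • A) * B * NormedSpace.exp (u • (-A)))) 0 s := by
    intro s
    have h1 := (hasDerivAt_exp_smul_const' (𝕂 := ℝ) A s).mul_const B
    have h2 := hasDerivAt_exp_smul_const (𝕂 := ℝ) (-A) s
    have h3 := (hasDerivAt_exp_smul_const (𝕂 := ℝ) (-D) s).clm_apply (h1.mul h2)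
    refine h3.congr_deriv ?_
    rw [mul_apply_eq_comp, ← map_add, neg_apply, hD]
    simp only [Pi.mul_apply]
    rw [← map_zero (NormedSpace.exp (s • (-D)))]
    congr 1
    noncomm_ring
  have h1 := is_const_of_deriv_eq_zero (fun s ↦ (hconst s).differentiableAt)
    (fun s ↦ (hconst s).deriv) 1 0
  simp only [one_smul, zero_smul, NormedSpace.exp_zero, one_mul, mul_one] at h1
  have h2 := congrArg (fun v ↦ (NormedSpace.exp D : 𝔸 →L[ℝ] 𝔸) v) h1
  have h0 : NormedSpace.exp ((0 : ℝ) • (-D)) = 1 := by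
    have h3 : (0 : ℝ) • (-D) = 0 := zero_smul ℝ (-D)
    rw [h3, NormedSpace.exp_zero]
  replace h2 := h2.trans (congrArg (fun T : 𝔸 →L[ℝ] 𝔸 ↦ NormedSpace.exp D (T B)) h0)
  rw [← mul_apply_eq_comp, exp_mul_exp_neg] at h2
  exact h2

lemma exp_mul_mul_exp_neg_mem {N : Submodule ℝ 𝔸} (hN : IsClosed (N : Set 𝔸)) {A : 𝔸}
    (hA : ∀ B ∈ N, A * B - B * A ∈ N) {B : 𝔸} (hB : B ∈ N) :
    NormedSpace.exp A * B * NormedSpace.exp (-A) ∈ N := by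
  rw [exp_mul_mul_exp_neg]
  set D : 𝔸 →L[ℝ] 𝔸 := ContinuousLinearMap.mul ℝ 𝔸 A - (ContinuousLinearMap.mul ℝ 𝔸).flip A
  have hpow : ∀ n : ℕ, (D ^ n) B ∈ N := by
    intro n
    induction n with
    | zero => simpa using hB
    | succ n ih =>
      rw [pow_succ', mul_apply_eq_comp]
      exact hA _ ih
  have hsum := (NormedSpace.exp_series_hasSum_exp' (𝕂 := ℝ) D).mapL
    (ContinuousLinearMap.apply ℝ 𝔸 B)
  refine hN.mem_of_tendsto hsum (Filter.Eventually.of_forall fun s ↦ ?_)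
  exact N.sum_mem fun n _ ↦ N.smul_mem _ (hpow n)

/-- A product of one-parameter groups with generators in a Lie algebra `N` of operators: it is
analytic, with logarithmic derivative in `N`. -/
lemma exists_analytic_logDeriv_mem {ι : Type*} [Fintype ι] {N : Submodule ℝ 𝔸}
    (hN : IsClosed (N : Set 𝔸)) (hlie : ∀ A ∈ N, ∀ B ∈ N, A * B - B * A ∈ N)
    (A : ι → 𝔸) (hA : ∀ i, A i ∈ N) (S : Finset ι) :
    ∃ g : (ι → ℝ) → 𝔸, (∀ t, AnalyticAt ℝ g t) ∧ g 0 = 1 ∧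
      (∀ t h, ∃ B ∈ N, fderiv ℝ g t h = B * g t) ∧
      ∀ h, fderiv ℝ g 0 h = ∑ i ∈ S, h i • A i := by
  classical
  induction S using Finset.induction_on with
  | empty =>
    exact ⟨fun _ ↦ 1, fun t ↦ analyticAt_const, rfl, fun t h ↦ ⟨0, zero_mem _, by simp⟩,
      fun h ↦ by simp⟩
  | insert i S hi ih =>
    obtain ⟨g, hg1, hg2, hg3, hg4⟩ := ih
    have hder : ∀ t, HasFDerivAt (fun t : ι → ℝ ↦ NormedSpace.exp (t i • A i) * g t) _ t :=
      fun t ↦ (((hasFDerivAt_exp_smul_const' ℝ (A i) (t i)).comp t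
        (ContinuousLinearMap.proj (R := ℝ) (φ := fun _ ↦ ℝ) i).hasFDerivAt)).mul'
          (hg1 t).differentiableAt.hasFDerivAt
    have hder' : ∀ t h, fderiv ℝ (fun t : ι → ℝ ↦ NormedSpace.exp (t i • A i) * g t) t h =
        NormedSpace.exp (t i • A i) * fderiv ℝ g t h +
          (h i • A i * NormedSpace.exp (t i • A i)) * g t := by
      intro t h
      rw [(hder t).fderiv]
      simp
    refine ⟨fun t ↦ NormedSpace.exp (t i • A i) * g t, fun t ↦ ?_, by simp [hg2], ?_, ?_⟩
    · have : AnalyticAt ℝ (fun t : ι → ℝ ↦ t i • A i) t :=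
        ((ContinuousLinearMap.proj (R := ℝ) (φ := fun _ ↦ ℝ) i).smulRight (A i)).analyticAt t
      exact ((NormedSpace.exp_analytic (𝕂 := ℝ) (t i • A i)).comp_of_eq this rfl).mul (hg1 t)
    · intro t h
      obtain ⟨B, hB, hBg⟩ := hg3 t h
      -- The product rule conjugates the old logarithmic derivative by the new factor, which
      -- preserves `N`, and adds the new generator.
      refine ⟨NormedSpace.exp (t i • A i) * B * NormedSpace.exp (-(t i • A i)) + h i • A i,
        add_mem (exp_mul_mul_exp_neg_mem hN
          (fun C hC ↦ hlie _ (N.smul_mem _ (hA i)) _ hC) hB) (N.smul_mem _ (hA i)), ?_⟩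
      have hinv : NormedSpace.exp (-(t i • A i)) * NormedSpace.exp (t i • A i) = 1 := by
        simpa using exp_mul_exp_neg (-(t i • A i))
      rw [hder', hBg, add_mul, mul_assoc _ (NormedSpace.exp (-(t i • A i))),
        ← mul_assoc (NormedSpace.exp (-(t i • A i))), hinv, one_mul, mul_assoc, mul_assoc]
    · intro h
      rw [hder', hg4, Finset.sum_insert hi, hg2]
      simp [add_comm]

end BanachAlgebra

end OrbitMaps

/-! ### First integrals of a linear Lie algebra of vector fields -/

section FirstIntegrals

open Module Filter Topology

variable {E : Type*} [NormedAddCommGroup E] [NormedSpace ℝ E]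

/-- The tangent space at `x` of the orbit of a Lie algebra `N` of operators. -/
noncomputable def orbitTangent (N : Submodule ℝ (E →L[ℝ] E)) (x : E) : Submodule ℝ E :=
  N.map (ContinuousLinearMap.apply ℝ E x).toLinearMap

lemma mem_orbitTangent {N : Submodule ℝ (E →L[ℝ] E)} {x y : E} :
    y ∈ orbitTangent N x ↔ ∃ A ∈ N, A x = y := Iff.rfl

variable [FiniteDimensional ℝ E]

lemma exists_basis_orbitTangent (N : Submodule ℝ (E →L[ℝ] E)) (x : E) :
    ∃ (A : Fin (finrank ℝ (orbitTangent N x)) → E →L[ℝ] E), (∀ i, A i ∈ N) ∧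
      LinearIndependent ℝ fun i ↦ A i x := by
  let b := finBasis ℝ (orbitTangent N x)
  choose A hA hAx using fun i ↦ mem_orbitTangent.1 (b i).2
  refine ⟨A, hA, ?_⟩
  simp_rw [hAx]
  exact b.linearIndependent.map' _ (Submodule.ker_subtype _)

/-- A linearly independent family extends to linear coordinates. -/
lemma exists_equiv_prod_of_linearIndependent {r m : ℕ} {v : Fin r → E}
    (hv : LinearIndependent ℝ v) (hm : r + m = finrank ℝ E) :
    ∃ e : ((Fin r → ℝ) × (Fin m → ℝ)) ≃L[ℝ] E, ∀ t, e (t, 0) = ∑ i, t i • v i := by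
  obtain ⟨C, hC⟩ := exists_isCompl (Submodule.span ℝ (Set.range v))
  have hfr : finrank ℝ (Submodule.span ℝ (Set.range v)) = r := by
    rw [finrank_span_eq_card hv, Fintype.card_fin]
  have hCm : finrank ℝ C = m := by
    have := Submodule.finrank_add_eq_of_isCompl hC
    omega
  let b := Basis.span hv
  let c := finBasisOfFinrankEq ℝ C hCm
  let e := (b.equivFun.symm.prodCongr c.equivFun.symm).trans
    (Submodule.prodEquivOfIsCompl _ _ hC)
  refine ⟨e.toContinuousLinearEquiv, fun t ↦ ?_⟩
  have : e (t, 0) = ∑ i, t i • v i := by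
    simp [e, b, Basis.equivFun_symm_apply, Basis.span_apply]
  exact this

/-- At a point where the orbit dimension is maximal, the orbits of a linear Lie algebra are locally
the level sets of analytic functions with linearly independent differentials. -/
theorem exists_first_integrals {N : Submodule ℝ (E →L[ℝ] E)}
    (hlie : ∀ A ∈ N, ∀ B ∈ N, A * B - B * A ∈ N) (x₀ : E)
    (hmax : ∀ x, finrank ℝ (orbitTangent N x) ≤ finrank ℝ (orbitTangent N x₀)) {m : ℕ}
    (hm : finrank ℝ (orbitTangent N x₀) + m = finrank ℝ E) :
    ∃ (U : Set E) (F : Fin m → E → ℝ), IsOpen U ∧ U.Nonempty ∧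
      (∀ a, AnalyticOnNhd ℝ (F a) U) ∧
      (∀ a, ∀ x ∈ U, ∀ A ∈ N, fderiv ℝ (F a) x (A x) = 0) ∧
      ∀ x ∈ U, LinearIndependent ℝ fun a ↦ fderiv ℝ (F a) x := by
  set r := finrank ℝ (orbitTangent N x₀) with hr
  have : CompleteSpace E := FiniteDimensional.complete ℝ E
  obtain ⟨A, hAN, hA⟩ := exists_basis_orbitTangent N x₀
  obtain ⟨e, he⟩ := exists_equiv_prod_of_linearIndependent hA hm
  obtain ⟨g, hg1, hg2, hg3, hg4⟩ := exists_analytic_logDeriv_mem (N := N)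
    N.closed_of_finiteDimensional hlie A hAN Finset.univ
  let T : (Fin m → ℝ) →L[ℝ] E := e.toContinuousLinearMap.comp (ContinuousLinearMap.inr ℝ _ _)
  -- The group moves a transversal `x₀ + T y` along the orbits. The derivative of `Φ` at the origin
  -- is the isomorphism `e`, so `Φ` is a local chart, and the transversal coordinates of its inverse
  -- are the first integrals.
  let Φ : (Fin r → ℝ) × (Fin m → ℝ) → E := fun p ↦ g p.1 (x₀ + T p.2)
  have hTan : ∀ p : (Fin r → ℝ) × (Fin m → ℝ), AnalyticAt ℝ (fun p : (Fin r → ℝ) × (Fin m → ℝ) ↦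
      x₀ + T p.2) p := fun p ↦
    analyticAt_const.add ((T.comp (ContinuousLinearMap.snd ℝ _ _)).analyticAt p)
  have hgan : ∀ p : (Fin r → ℝ) × (Fin m → ℝ),
      AnalyticAt ℝ (fun p : (Fin r → ℝ) × (Fin m → ℝ) ↦ g p.1) p := fun p ↦
    (hg1 p.1).comp_of_eq analyticAt_fst rfl
  have hΦan : ∀ p, AnalyticAt ℝ Φ p := fun p ↦
    ((ContinuousLinearMap.id ℝ (E →L[ℝ] E)).analyticAt_bilinear (g p.1, x₀ + T p.2)).comp_of_eq
      ((hgan p).prod (hTan p)) rfl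
  have hΦder : ∀ p h, fderiv ℝ Φ p h = fderiv ℝ g p.1 h.1 (x₀ + T p.2) + g p.1 (T h.2) := by
    intro p h
    have h1 : HasFDerivAt (fun p : (Fin r → ℝ) × (Fin m → ℝ) ↦ g p.1)
        ((fderiv ℝ g p.1).comp (ContinuousLinearMap.fst ℝ _ _)) p :=
      (hg1 p.1).differentiableAt.hasFDerivAt.comp p hasFDerivAt_fst
    have h2 : HasFDerivAt (fun p : (Fin r → ℝ) × (Fin m → ℝ) ↦ x₀ + T p.2)
        (T.comp (ContinuousLinearMap.snd ℝ _ _)) p :=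
      HasFDerivAt.const_add x₀ (T.hasFDerivAt.comp p hasFDerivAt_snd)
    rw [show fderiv ℝ Φ p = _ from (h1.clm_apply h2).fderiv]
    simp [add_comm]
  have hΦ0 : fderiv ℝ Φ 0 = (e : _ →L[ℝ] E) := by
    refine ContinuousLinearMap.ext fun h ↦ ?_
    rw [hΦder]
    have h3 : e h = e (h.1, 0) + e (0, h.2) := by rw [← map_add]; simp
    simp only [Prod.fst_zero, hg4, hg2, Prod.snd_zero, map_zero, add_zero, one_apply_eq_self,
      ContinuousLinearEquiv.coe_coe]
    rw [h3, he]
    simp [T]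
  have hmem : ∀ p h, fderiv ℝ Φ p (h, 0) ∈ orbitTangent N (Φ p) := by
    intro p h
    obtain ⟨B, hB, hBg⟩ := hg3 p.1 h
    refine ⟨B, hB, ?_⟩
    rw [hΦder, map_zero, map_zero, add_zero, hBg]
    rfl
  have hstrict : HasStrictFDerivAt Φ (e : _ →L[ℝ] E) 0 := by
    rw [← hΦ0]
    exact (hΦan 0).hasStrictFDerivAt
  let φ := hstrict.toOpenPartialHomeomorph Φ
  have hφ : (φ : _ → E) = Φ := hstrict.toOpenPartialHomeomorph_coe
  have h0 : (0 : (Fin r → ℝ) × (Fin m → ℝ)) ∈ φ.source :=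
    hstrict.mem_toOpenPartialHomeomorph_source
  have hψ : AnalyticAt ℝ φ.symm (φ 0) :=
    φ.analyticAt_symm' (i := e) h0 (by rw [hφ]; exact hΦan 0) (by rw [hφ]; exact hΦ0)
  obtain ⟨U, hU, hUo, hU0⟩ := eventually_nhds_iff.1
    (hψ.eventually_analyticAt.and (φ.open_target.mem_nhds (φ.map_source h0)))
  have hinv : ∀ x ∈ U, ∀ v, fderiv ℝ Φ (φ.symm x) (fderiv ℝ φ.symm x v) = v := by
    intro x hx v
    have h1 : HasFDerivAt (Φ ∘ φ.symm) ((fderiv ℝ Φ (φ.symm x)).comp (fderiv ℝ φ.symm x)) x :=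
      (hΦan _).differentiableAt.hasFDerivAt.comp x (hU x hx).1.differentiableAt.hasFDerivAt
    have h2 : Φ ∘ φ.symm =ᶠ[𝓝 x] id := by
      filter_upwards [φ.open_target.mem_nhds (hU x hx).2] with y hy
      rw [Function.comp_apply, ← hφ, φ.right_inv hy, id]
    have h3 := h1.unique ((hasFDerivAt_id x).congr_of_eventuallyEq h2)
    exact DFunLike.congr_fun h3 v
  have hfr : finrank ℝ ((Fin r → ℝ) × (Fin m → ℝ)) = finrank ℝ E := by
    rw [← hm, finrank_prod, finrank_fin_fun, finrank_fin_fun]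
  have hinj : ∀ x ∈ U, Function.Injective (fderiv ℝ Φ (φ.symm x)) := fun x hx ↦
    (LinearMap.injective_iff_surjective_of_finrank_eq_finrank hfr
      (f := (fderiv ℝ Φ (φ.symm x)).toLinearMap)).2 fun v ↦ ⟨_, hinv x hx v⟩
  have hinv' : ∀ x ∈ U, ∀ h, fderiv ℝ φ.symm x (fderiv ℝ Φ (φ.symm x) h) = h := fun x hx h ↦
    hinj x hx (hinv x hx _)
  have hFder : ∀ x ∈ U, ∀ a v, fderiv ℝ (fun x ↦ (φ.symm x).2 a) x v =
      (fderiv ℝ φ.symm x v).2 a := by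
    intro x hx a v
    let Q : (Fin r → ℝ) × (Fin m → ℝ) →L[ℝ] ℝ :=
      (ContinuousLinearMap.proj (R := ℝ) (φ := fun _ ↦ ℝ) a).comp (ContinuousLinearMap.snd ℝ _ _)
    rw [show fderiv ℝ (fun x ↦ (φ.symm x).2 a) x = _ from
      (Q.hasFDerivAt.comp x (hU x hx).1.differentiableAt.hasFDerivAt).fderiv]
    rfl
  refine ⟨U, fun a x ↦ (φ.symm x).2 a, hUo, ⟨_, hU0⟩, fun a x hx ↦ ?_, fun a x hx B hB ↦ ?_,
    fun x hx ↦ ?_⟩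
  · let Q : (Fin r → ℝ) × (Fin m → ℝ) →L[ℝ] ℝ :=
      (ContinuousLinearMap.proj (R := ℝ) (φ := fun _ ↦ ℝ) a).comp (ContinuousLinearMap.snd ℝ _ _)
    exact (Q.analyticAt _).comp (hU x hx).1
  · rw [hFder x hx]
    have hΦx : Φ (φ.symm x) = x := by rw [← hφ, φ.right_inv (hU x hx).2]
    let ι : (Fin r → ℝ) →ₗ[ℝ] E := (fderiv ℝ Φ (φ.symm x)).toLinearMap.comp (LinearMap.inl ℝ _ _)
    have hι : Function.Injective ι := (hinj x hx).comp LinearMap.inl_injective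
    have hle : LinearMap.range ι ≤ orbitTangent N x := by
      rintro _ ⟨h, rfl⟩
      have := hmem (φ.symm x) h
      rwa [hΦx] at this
    -- Maximality at `x₀` is used here: the `r` group directions are independent and tangent to an
    -- orbit of dimension at most `r`, hence span its tangent space.
    have heq : LinearMap.range ι = orbitTangent N x := by
      refine Submodule.eq_of_le_of_finrank_le hle ?_
      rw [LinearMap.finrank_range_of_inj hι, finrank_fin_fun]
      exact hmax x
    obtain ⟨h, hh⟩ : B x ∈ LinearMap.range ι := by
      rw [heq]; exact ⟨B, hB, rfl⟩
    rw [← hh]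
    change (fderiv ℝ φ.symm x (fderiv ℝ Φ (φ.symm x) (h, 0))).2 a = 0
    rw [hinv' x hx]
    rfl
  · rw [Fintype.linearIndependent_iff]
    intro c hc a
    have := DFunLike.congr_fun hc (fderiv ℝ Φ (φ.symm x) (0, Pi.single a 1))
    rw [sum_apply] at this
    simpa [hFder x hx, hinv' x hx, Pi.single_apply] using this

/-- First integrals with independent differentials number at most the generic codimension of the
orbits. -/
theorem card_first_integrals_le {N : Submodule ℝ (E →L[ℝ] E)} (x₀ : E) {U : Set E}
    (hU : IsOpen U) (hne : U.Nonempty) {k : ℕ} {F : Fin k → E → ℝ}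
    (hF : ∀ a, ∀ x ∈ U, ∀ A ∈ N, fderiv ℝ (F a) x (A x) = 0)
    (hind : U ⊆ closure {x | x ∈ U ∧ LinearIndependent ℝ fun a ↦ fderiv ℝ (F a) x}) :
    finrank ℝ (orbitTangent N x₀) + k ≤ finrank ℝ E := by
  obtain ⟨A, hAN, hA⟩ := exists_basis_orbitTangent N x₀
  have hopen : IsOpen {x | LinearIndependent ℝ fun i ↦ A i x} := by
    have hc : Continuous fun x ↦ fun i ↦ A i x :=
      continuous_pi fun i ↦ (A i).continuous
    exact isOpen_setOfPred_linearIndependent.preimage hc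
  obtain ⟨u, hu⟩ := hne
  -- On the line from `u` to `x₀` a suitable minor is a polynomial in the parameter with value `1`
  -- at `x₀`. It has finitely many roots, so it is nonzero at points of the line arbitrarily close
  -- to `u`.
  obtain ⟨p, hpU, hp⟩ : ∃ p ∈ U, LinearIndependent ℝ fun i ↦ A i p := by
    choose f hf using fun j ↦ exists_dual_forall_eq hA (Pi.single j (1 : ℝ))
    open Polynomial in
    let M : Matrix (Fin (finrank ℝ (orbitTangent N x₀))) (Fin (finrank ℝ (orbitTangent N x₀)))
      (Polynomial ℝ) := Matrix.of fun i j ↦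
        C (f j (A i u)) + X * C (f j (A i (x₀ - u)))
    have hM : ∀ s : ℝ, M.det.eval s =
        (Matrix.of fun i j ↦ f j (A i (u + s • (x₀ - u)))).det := by
      intro s
      rw [← Polynomial.coe_evalRingHom, RingHom.map_det]
      congr 1
      ext i j
      simp [M]
    have hM0 : M.det ≠ 0 := by
      intro h0
      have h1 := hM 1
      rw [h0, Polynomial.eval_zero, one_smul, add_sub_cancel] at h1
      have h2 : (Matrix.of fun i j ↦ f j (A i x₀)) = 1 := by
        ext i j
        rw [Matrix.of_apply, hf, Matrix.one_apply, Pi.single_apply]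
      rw [h2, Matrix.det_one] at h1
      exact zero_ne_one h1
    have hline : ∀ᶠ s : ℝ in 𝓝 0, u + s • (x₀ - u) ∈ U := by
      have hc : Continuous fun s : ℝ ↦ u + s • (x₀ - u) := by fun_prop
      exact hc.continuousAt.eventually_mem (by simpa using hU.mem_nhds hu)
    have hfin : {s : ℝ | M.det.IsRoot s}.Finite := Polynomial.finite_setOfPred_isRoot hM0
    have hdense : Dense ({s : ℝ | M.det.IsRoot s})ᶜ :=
      hfin.countable.dense_compl ℝ
    obtain ⟨V, hV, hVo, hV0⟩ := eventually_nhds_iff.1 hline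
    obtain ⟨s, hsV, hs⟩ := hdense.inter_open_nonempty V hVo ⟨0, hV0⟩
    refine ⟨_, hV s hsV, ?_⟩
    have hdet : (Matrix.of fun i j ↦ f j (A i (u + s • (x₀ - u)))).det ≠ 0 := by
      rw [← hM]
      exact hs
    have hrows := Matrix.linearIndependent_rows_of_det_ne_zero hdet
    exact LinearIndependent.of_comp (LinearMap.pi f) hrows
  obtain ⟨x, ⟨hx, -⟩, hxU, hxind⟩ := mem_closure_iff.1 (hind hpU) _ (hopen.inter hU) ⟨hp, hpU⟩
  have hge : finrank ℝ (orbitTangent N x₀) ≤ finrank ℝ (orbitTangent N x) := by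
    have h1 : LinearIndependent ℝ fun i ↦ (⟨A i x, A i, hAN i, rfl⟩ : orbitTangent N x) :=
      LinearIndependent.of_comp (orbitTangent N x).subtype hx
    simpa using h1.fintype_card_le_finrank
  -- The independent differentials all annihilate the orbit tangent space, whose dimension is at
  -- least that at `x₀`.
  have hk : k ≤ finrank ℝ (orbitTangent N x).dualAnnihilator := by
    have h1 : LinearIndependent ℝ fun a ↦ (fderiv ℝ (F a) x).toLinearMap :=
      hxind.map' (ContinuousLinearMap.coeLM ℝ)
        (LinearMap.ker_eq_bot.2 ContinuousLinearMap.coe_injective)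
    have h2 : ∀ a, (fderiv ℝ (F a) x).toLinearMap ∈ (orbitTangent N x).dualAnnihilator := by
      intro a
      rw [Submodule.mem_dualAnnihilator]
      rintro _ ⟨B, hB, rfl⟩
      exact hF a x hxU B hB
    have h3 : LinearIndependent ℝ fun a ↦ (⟨_, h2 a⟩ : (orbitTangent N x).dualAnnihilator) :=
      LinearIndependent.of_comp (orbitTangent N x).dualAnnihilator.subtype h1
    simpa using h3.fintype_card_le_finrank
  have := Subspace.finrank_add_finrank_dualAnnihilator_eq (orbitTangent N x)
  omega

end FirstIntegrals

/-! ### Rank of the orbit forms and the number of invariants -/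

section CoadjointRepresentation

open Module

/-- An alternating form has even rank. -/
lemma LinearMap.BilinForm.IsAlt.even_finrank_range {V : Type*} [AddCommGroup V] [Module ℝ V]
    [FiniteDimensional ℝ V] {B : LinearMap.BilinForm ℝ V} (hB : B.IsAlt) :
    Even (finrank ℝ (LinearMap.range B)) := by
  obtain ⟨C, hC⟩ := exists_isCompl (LinearMap.ker B)
  have hr : finrank ℝ (LinearMap.range B) = finrank ℝ C := by
    have h1 := Submodule.finrank_add_eq_of_isCompl hC
    have h2 := LinearMap.finrank_range_add_finrank_ker B
    omega
  rw [hr]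
  -- On a complement of its kernel the form is nondegenerate, and a skew-symmetric matrix of odd
  -- size has determinant zero.
  have hnd : (B.restrict C).Nondegenerate := by
    have hsep : ∀ x : C, (∀ y : C, B x y = 0) → x = 0 := by
      intro x hx
      have hxk : (x : V) ∈ LinearMap.ker B := by
        rw [LinearMap.mem_ker]
        ext y
        obtain ⟨p, hp, q, hq, rfl⟩ := Submodule.mem_sup.1
          (show y ∈ LinearMap.ker B ⊔ C by rw [hC.sup_eq_top]; trivial)
        rw [map_add, hx ⟨q, hq⟩, add_zero, ← hB.neg_eq, LinearMap.mem_ker.1 hp]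
        simp
      exact Subtype.ext (Submodule.disjoint_def.1 hC.disjoint _ hxk x.2)
    refine ⟨hsep, fun x hx ↦ hsep x fun y ↦ ?_⟩
    rw [← hB.neg_eq, neg_eq_zero]
    exact hx y
  let b := finBasis ℝ C
  have hdet := (LinearMap.BilinForm.nondegenerate_iff_det_ne_zero b).1 hnd
  have hskew : (BilinForm.toMatrix b (B.restrict C)).transpose =
      -BilinForm.toMatrix b (B.restrict C) := by
    ext i j
    simp only [Matrix.transpose_apply, Matrix.neg_apply, BilinForm.toMatrix_apply]
    exact (hB.neg_eq _ _).symm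
  have h := congrArg Matrix.det hskew
  rw [Matrix.det_transpose, Matrix.det_neg, Fintype.card_fin] at h
  by_contra hodd
  rw [Nat.not_even_iff_odd] at hodd
  rw [hodd.neg_one_pow, neg_one_mul, self_eq_neg] at h
  exact hdet h

variable {𝔤 : Type*} [LieRing 𝔤] [LieAlgebra ℝ 𝔤]

/-- The alternating form `F ⁅x, y⁆` attached to a point `F` of the dual of a Lie algebra. -/
noncomputable def orbitForm (F : Dual ℝ 𝔤) : LinearMap.BilinForm ℝ 𝔤 :=
  LinearMap.compr₂ (LieModule.toEnd ℝ 𝔤 𝔤 : 𝔤 →ₗ[ℝ] Module.End ℝ 𝔤) F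

lemma orbitForm_apply (F : Dual ℝ 𝔤) (x y : 𝔤) : orbitForm F x y = F ⁅x, y⁆ := rfl

lemma orbitForm_isAlt (F : Dual ℝ 𝔤) : (orbitForm F).IsAlt := fun x ↦ by
  rw [orbitForm_apply, lie_self, map_zero]

/-- The maximal dimension of the coadjoint orbits is attained. -/
lemma exists_max_finrank_range_orbitForm [FiniteDimensional ℝ 𝔤] :
    ∃ F₀ : Dual ℝ 𝔤, ∀ F : Dual ℝ 𝔤,
      finrank ℝ (LinearMap.range (orbitForm F)) ≤ finrank ℝ (LinearMap.range (orbitForm F₀)) := by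
  have hbdd : BddAbove (Set.range fun F : Dual ℝ 𝔤 ↦
      finrank ℝ (LinearMap.range (orbitForm F))) := by
    refine ⟨finrank ℝ 𝔤, ?_⟩
    rintro _ ⟨F, rfl⟩
    exact LinearMap.finrank_range_le _
  obtain ⟨F₀, hF₀⟩ := Nat.sSup_mem (Set.range_nonempty _) hbdd
  exact ⟨F₀, fun F ↦ (le_csSup hbdd ⟨F, rfl⟩).trans_eq hF₀.symm⟩

lemma exists_six_le_finrank_range_orbitForm [FiniteDimensional ℝ 𝔤]
    (h : ¬ HasVanishingGramDet ℝ 𝔤) :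
    ∃ F : Dual ℝ 𝔤, 6 ≤ finrank ℝ (LinearMap.range (orbitForm F)) := by
  unfold HasVanishingGramDet at h
  push Not at h
  obtain ⟨F, a, ha⟩ := h
  refine ⟨F, ?_⟩
  have hrows := Matrix.linearIndependent_rows_of_det_ne_zero ha
  have h1 : LinearIndependent ℝ fun i ↦ orbitForm F (a i) :=
    LinearIndependent.of_comp (LinearMap.pi fun j ↦ LinearMap.applyₗ (a j)) hrows
  have h2 : LinearIndependent ℝ fun i ↦
      (⟨orbitForm F (a i), a i, rfl⟩ : LinearMap.range (orbitForm F)) :=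
    LinearIndependent.of_comp (LinearMap.range (orbitForm F)).subtype h1
  simpa using h2.fintype_card_le_finrank

section Coordinates

variable {n : ℕ} (X : Module.Basis (Fin n) ℝ 𝔤)

/-- The coadjoint representation in the coordinates `F ↦ F (X k)` on the dual. -/
noncomputable def coadjointCLM : 𝔤 →ₗ[ℝ] (Fin n → ℝ) →L[ℝ] (Fin n → ℝ) :=
  LinearMap.toContinuousLinearMap.toLinearMap ∘ₗ X.dualBasis.equivFun.conj.toLinearMap ∘ₗ
    Module.Dual.transpose ∘ₗ (LieModule.toEnd ℝ 𝔤 𝔤 : 𝔤 →ₗ[ℝ] Module.End ℝ 𝔤)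

lemma coadjointCLM_equivFun (y : 𝔤) (F : Dual ℝ 𝔤) :
    coadjointCLM X y (X.dualBasis.equivFun F) = X.dualBasis.equivFun (orbitForm F y) := by
  change X.dualBasis.equivFun (Module.Dual.transpose _
    (X.dualBasis.equivFun.symm (X.dualBasis.equivFun F))) = _
  rw [LinearEquiv.symm_apply_apply]
  rfl

/-- The bracket is reversed because `coadjointCLM` transposes the adjoint action without a sign.
Only closure of its range under commutators is needed. -/
lemma coadjointCLM_commutator (y z : 𝔤) :
    coadjointCLM X y * coadjointCLM X z - coadjointCLM X z * coadjointCLM X y =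
      coadjointCLM X ⁅z, y⁆ := by
  refine ContinuousLinearMap.ext fun x ↦ ?_
  obtain ⟨F, rfl⟩ := X.dualBasis.equivFun.surjective x
  rw [sub_apply, mul_apply_eq_comp, mul_apply_eq_comp, coadjointCLM_equivFun,
    coadjointCLM_equivFun, coadjointCLM_equivFun, coadjointCLM_equivFun, coadjointCLM_equivFun,
    ← map_sub]
  congr 1
  ext w
  simp only [LinearMap.sub_apply, orbitForm_apply, ← map_sub]
  rw [lie_lie]

lemma finrank_orbitTangent_coadjointCLM (F : Dual ℝ 𝔤) :
    finrank ℝ (orbitTangent (LinearMap.range (coadjointCLM X)) (X.dualBasis.equivFun F)) =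
      finrank ℝ (LinearMap.range (orbitForm F)) := by
  rw [← LinearEquiv.finrank_map_eq X.dualBasis.equivFun (LinearMap.range (orbitForm F))]
  have key : orbitTangent (LinearMap.range (coadjointCLM X)) (X.dualBasis.equivFun F) =
      (LinearMap.range (orbitForm F)).map X.dualBasis.equivFun.toLinearMap := by
    ext v
    rw [mem_orbitTangent]
    constructor
    · rintro ⟨_, ⟨y, rfl⟩, rfl⟩
      exact ⟨orbitForm F y, ⟨y, rfl⟩, (coadjointCLM_equivFun X y F).symm⟩
    · rintro ⟨_, ⟨y, rfl⟩, rfl⟩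
      exact ⟨_, ⟨y, rfl⟩, coadjointCLM_equivFun X y F⟩
  rw [key]

/-- The `j`-th coordinate of the linear vector field of `X i` at the point of a functional `f` is `f
⁅X i, X j⁆`, expanded in the structure constants. -/
lemma coadjointOp_eq (i : Fin n) (F : (Fin n → ℝ) → ℝ) (x : Fin n → ℝ) :
    coadjointOp X i F x = fderiv ℝ F x (coadjointCLM X (X i) x) := by
  have hx : ∀ j, coadjointCLM X (X i) x j = ∑ k, structureConst X i j k * x k := by
    intro j
    obtain ⟨f, rfl⟩ := X.dualBasis.equivFun.surjective x
    rw [coadjointCLM_equivFun]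
    simp only [Basis.dualBasis_equivFun, orbitForm_apply]
    conv_lhs => rw [← X.sum_repr ⁅X i, X j⁆]
    rw [map_sum]
    simp [structureConst]
  rw [pi_eq_sum_univ' (coadjointCLM X (X i) x), map_sum, coadjointOp]
  refine Finset.sum_congr rfl fun j _ ↦ ?_
  rw [map_smul, hx, Finset.sum_smul]
  refine Finset.sum_congr rfl fun k _ ↦ ?_
  congr 2

lemma forall_coadjointOp_eq_zero_iff (F : (Fin n → ℝ) → ℝ) (x : Fin n → ℝ) :
    (∀ i, coadjointOp X i F x = 0) ↔
      ∀ A ∈ LinearMap.range (coadjointCLM X), fderiv ℝ F x (A x) = 0 := by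
  constructor
  · rintro h _ ⟨y, rfl⟩
    rw [← X.sum_repr y, map_sum, sum_apply, map_sum]
    refine Finset.sum_eq_zero fun i _ ↦ ?_
    rw [map_smul, smul_apply, map_smul, ← coadjointOp_eq, h, smul_zero]
  · intro h i
    rw [coadjointOp_eq]
    exact h _ ⟨_, rfl⟩

end Coordinates

/-- The number of functionally independent invariants is the generic codimension of the coadjoint
orbits. -/
theorem hasInvariantNumber_of_finrank_range_orbitForm [FiniteDimensional ℝ 𝔤] {F₀ : Dual ℝ 𝔤}
    (hmax : ∀ F : Dual ℝ 𝔤, finrank ℝ (LinearMap.range (orbitForm F)) ≤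
      finrank ℝ (LinearMap.range (orbitForm F₀))) {N : ℕ}
    (hN : finrank ℝ (LinearMap.range (orbitForm F₀)) + N = finrank ℝ 𝔤) :
    HasInvariantNumber 𝔤 N := by
  intro X
  set x₀ := X.dualBasis.equivFun F₀ with hx₀
  have hfin : finrank ℝ (Fin (finrank ℝ 𝔤) → ℝ) = finrank ℝ 𝔤 := finrank_fin_fun ℝ
  constructor
  · obtain ⟨U, F, hU, hne, hF1, hF2, hF3⟩ := exists_first_integrals
      (N := LinearMap.range (coadjointCLM X)) (m := N) (by
        rintro _ ⟨y, rfl⟩ _ ⟨z, rfl⟩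
        exact ⟨_, (coadjointCLM_commutator X y z).symm⟩) x₀ (fun x ↦ by
        obtain ⟨f, rfl⟩ := X.dualBasis.equivFun.surjective x
        rw [finrank_orbitTangent_coadjointCLM, finrank_orbitTangent_coadjointCLM]
        exact hmax f) (by
        rw [finrank_orbitTangent_coadjointCLM, hfin, hN])
    exact ⟨U, F, hU, hne, fun a ↦ ⟨hF1 a, fun x hx ↦
      (forall_coadjointOp_eq_zero_iff X _ _).2 (hF2 a x hx)⟩,
      fun x hx ↦ subset_closure ⟨hx, hF3 x hx⟩⟩
  · rintro k ⟨U, F, hU, hne, hF, hind⟩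
    have := card_first_integrals_le (N := LinearMap.range (coadjointCLM X)) x₀ hU hne
      (fun a x hx ↦ (forall_coadjointOp_eq_zero_iff X _ _).1 ((hF a).2 x hx)) hind
    rw [finrank_orbitTangent_coadjointCLM, hfin] at this
    omega

end CoadjointRepresentation

theorem mainTheorem2 (𝔤 : Type*) [LieRing 𝔤] [LieAlgebra ℝ 𝔤] [FiniteDimensional ℝ 𝔤]
    (hdim : Module.finrank ℝ 𝔤 = 9)
    (hind : IsIndecomposableLie 𝔤)
    (hlevi : HasNontrivialLeviDecomposition 𝔤) :
    HasInvariantNumber 𝔤 1 ∨ HasInvariantNumber 𝔤 3 := by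
  obtain ⟨F₁, hF₁⟩ := exists_six_le_finrank_range_orbitForm
    (hind.not_hasVanishingGramDet hlevi hdim.ge)
  obtain ⟨F₀, hmax⟩ := exists_max_finrank_range_orbitForm (𝔤 := 𝔤)
  have h6 := hF₁.trans (hmax F₁)
  have h9 : Module.finrank ℝ (LinearMap.range (orbitForm F₀)) ≤ 9 :=
    (LinearMap.finrank_range_le _).trans_eq hdim
  obtain ⟨m, hm⟩ := (orbitForm_isAlt F₀).even_finrank_range
  -- The maximal rank is `m + m`, between six and nine.
  have h68 : m = 3 ∨ m = 4 := by omega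
  rcases h68 with rfl | rfl
  · exact Or.inr (hasInvariantNumber_of_finrank_range_orbitForm hmax (by omega))
  · exact Or.inl (hasInvariantNumber_of_finrank_range_orbitForm hmax (by omega))
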